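/- Let $G$ be a finite group, let $k$ be a $G$-Tambara functor, and let $R_1$ and $R_2$ be $k$-algebras, that is, $G$-Tambara functors equipped with morphisms $k\to R_i$. Let $R_1\times R_2$ be the levelwise product with the induced $k$-algebra structure. For a $k$-algebra $R$: - $R$ is *flat* over $k$ if the functor $R\boxtimes_k-$ on $k$-modules (modules over the underlying Green functor of $k$) is exact, where $\boxtimes_k$ is the relative box product; - the *genuine Kähler differentials* are $\Omega^{1,\mathrm{Tamb}}_{R/k}=I/I^{>1}$, where $I$ is the kernel of the multiplication map $R\boxtimes_k R\to R$ and $I^{>1}\subseteq I$ is the Tambara ideal of $R\boxtimes_k R$ generated by all products of two elements of $I$ and all norms of elements of $I$ along maps $G/K\to G/H$ with $K$ conjugate to a proper subgroup of $H$; - $R$ is *finitely presented* over $k$ if it is isomorphic to a coequalizer, in $k$-algebras, of two maps between free polynomial $k$-algebras on finitely many generators, where each generator lives in the level of some finite $G$-set $X$, and the free $k$-algebra on one generator in level $X$ represents the functor $S\mapsto S(X)$; - $R$ is *étale* over $k$ if it is flat over $k$, $\Omega^{1,\mathrm{Tamb}}_{R/k}=0$, and $R$ is finitely presented over $k$. Then: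 1. $R_1\times R_2$ is flat over $k$ if and only if $R_1$ and $R_2$ are flat over $k$. 2. $\Omega^{1,\mathrm{Tamb}}_{R_1\times R_2/k}=0$ if and only if $\Omega^{1,\mathrm{Tamb}}_{R_1/k}=0$ and $\Omega^{1,\mathrm{Tamb}}_{R_2/k}=0$. 3. $R_1\times R_2$ is finitely presented over $k$ if and only if $R_1$ and $R_2$ are finitely presented over $k$. Consequently, $R_1\times R_2$ is an étale $k$-algebra if and only if $R_1$ and $R_2$ are étale $k$-algebras. -/

import Mathlib

universe u

/-- A finite `G`-set, modelled on an initial segment of the natural numbers (every finite `G`-set is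
isomorphic to one of these, see `GSet.of`, and the collection of all of them is small). -/
structure GSet (G : Type) [Group G] where
  card : ℕ
  action : MulAction G (Fin card)

namespace GSet

variable {G : Type} [Group G]

/-- The underlying set of a finite `G`-set. -/
def Carrier (X : GSet G) : Type := Fin X.card

instance : CoeSort (GSet G) Type := ⟨Carrier⟩

instance (X : GSet G) : MulAction G X := X.action

instance (X : GSet G) : Finite X := inferInstanceAs (Finite (Fin X.card))

/-- The square with `u : P → X`, `v : P → Y`, `f : X → Z`, `g : Y → Z` is cartesian. -/
def IsPullback {P X Y Z : GSet G} (u : P →[G] X) (v : P →[G] Y) (f : X →[G] Z) (g : Y →[G] Z) :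
    Prop :=
  (∀ w, f (u w) = g (v w)) ∧ ∀ x y, f x = g y → ∃! w, u w = x ∧ v w = y

/-- `i : X → Z` and `j : Y → Z` exhibit `Z` as the disjoint union of `X` and `Y`. -/
def IsCoprod {X Y Z : GSet G} (i : X →[G] Z) (j : Y →[G] Z) : Prop :=
  Function.Bijective (Sum.elim i j)

/-- Exponential diagrams. For `h : A → X` and `f : X → Y` the `G`-set `B`, with `q : B → Y`, is
the dependent product `Π_f A` (its points over `y` are the sections of `h` over the fibre
`f ⁻¹ y`), `P` is the fibre product `X ×_Y B` with projections `h ∘ e` and `g`, and `e : P → A`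
is the evaluation map. -/
def IsExp {A X Y P B : GSet G} (h : A →[G] X) (f : X →[G] Y)
    (e : P →[G] A) (g : P →[G] B) (q : B →[G] Y) : Prop :=
  IsPullback (h.comp e) g f q ∧
    ∀ (y : Y) (s : ∀ x : X, f x = y → A), (∀ x hx, h (s x hx) = x) →
      ∃! b, q b = y ∧ ∀ x hx, ∃ w, g w = b ∧ e w = s x hx

/-! ### Finite `G`-sets from arbitrary finite types -/

section of

variable (A : Type) [Finite A] [MulAction G A]

/-- The copy of a finite `G`-set `A` on an initial segment of the natural numbers. -/
noncomputable def of : GSet G where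
  card := Nat.card A
  action := (Finite.equivFin A).symm.mulAction G

/-- The identification of `A` with its copy. -/
noncomputable def ofEquiv : A ≃ (of A : GSet G) := Finite.equivFin A

variable {A}

@[simp] theorem ofEquiv_smul (c : G) (a : A) :
    ofEquiv (G := G) A (c • a) = c • ofEquiv (G := G) A a := by
  change _ = (Finite.equivFin A) (c • (Finite.equivFin A).symm (Finite.equivFin A a))
  simp [ofEquiv]
  rfl

@[simp] theorem ofEquiv_symm_smul (c : G) (a : (of A : GSet G)) :
    (ofEquiv (G := G) A).symm (c • a) = c • (ofEquiv (G := G) A).symm a := by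
  rw [Equiv.symm_apply_eq, ofEquiv_smul, Equiv.apply_symm_apply]

/-- An equivariant map out of `of A`. -/
noncomputable def desc {X : GSet G} (f : A → X) (hf : ∀ (c : G) a, f (c • a) = c • f a) :
    (of A : GSet G) →[G] X where
  toFun a := f ((ofEquiv (G := G) A).symm a)
  map_smul' c a := by simp [hf]

/-- An equivariant map into `of A`. -/
noncomputable def lift {X : GSet G} (f : X → A) (hf : ∀ (c : G) x, f (c • x) = c • f x) :
    X →[G] (of A : GSet G) where
  toFun x := ofEquiv (G := G) A (f x)
  map_smul' c x := by simp [hf]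

@[simp] theorem desc_apply {X : GSet G} (f : A → X) (hf) (a : A) :
    desc (G := G) f hf (ofEquiv A a) = f a := by
  change f _ = _
  simp

@[simp] theorem lift_apply {X : GSet G} (f : X → A) (hf) (x : X) :
    lift (G := G) f hf x = ofEquiv A (f x) := rfl

end of


section constructions

variable {A B P Q W X Y Z T : GSet G}

theorem IsPullback.exists_lift {u : P →[G] X} {v : P →[G] Y} {f : X →[G] Z} {g : Y →[G] Z}
    (H : IsPullback u v f g) (a : T →[G] X) (b : T →[G] Y) (hab : ∀ t, f (a t) = g (b t)) :
    ∃ c : T →[G] P, (∀ t, u (c t) = a t) ∧ ∀ t, v (c t) = b t := by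
  choose c hc hu using fun t => H.2 (a t) (b t) (hab t)
  refine ⟨⟨c, fun γ t => ?_⟩, fun t => (hc t).1, fun t => (hc t).2⟩
  refine (hu (γ • t) (γ • c t) ⟨?_, ?_⟩).symm
  · rw [map_smul, map_smul, (hc t).1]
  · rw [map_smul, map_smul, (hc t).2]

theorem IsPullback.ext {u : P →[G] X} {v : P →[G] Y} {f : X →[G] Z} {g : Y →[G] Z}
    (H : IsPullback u v f g) {w w' : P} (h1 : u w = u w') (h2 : v w = v w') : w = w' :=
  (H.2 (u w') (v w') (H.1 w')).unique ⟨h1, h2⟩ ⟨rfl, rfl⟩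

theorem IsPullback.exists {u : P →[G] X} {v : P →[G] Y} {f : X →[G] Z} {g : Y →[G] Z}
    (H : IsPullback u v f g) {x : X} {y : Y} (h : f x = g y) : ∃ w, u w = x ∧ v w = y :=
  (H.2 x y h).exists

theorem IsPullback.symm {u : P →[G] X} {v : P →[G] Y} {f : X →[G] Z} {g : Y →[G] Z}
    (H : IsPullback u v f g) : IsPullback v u g f :=
  ⟨fun w => (H.1 w).symm, fun x y h => by simpa [and_comm] using H.2 y x h.symm⟩

theorem IsPullback.mk' {u : P →[G] X} {v : P →[G] Y} {f : X →[G] Z} {g : Y →[G] Z}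
    (h : ∀ w, f (u w) = g (v w)) (he : ∀ x y, f x = g y → ∃ w, u w = x ∧ v w = y)
    (hu : ∀ w w', u w = u w' → v w = v w' → w = w') : IsPullback u v f g :=
  ⟨h, fun x y hxy => by
    obtain ⟨w, h1, h2⟩ := he x y hxy
    exact ⟨w, ⟨h1, h2⟩, fun w' h' => hu _ _ (h'.1.trans h1.symm) (h'.2.trans h2.symm)⟩⟩

/-- Pasting of cartesian squares. -/
theorem IsPullback.paste {u : P →[G] X} {v : P →[G] Y} {f : X →[G] Z} {g : Y →[G] Z}
    (H : IsPullback u v f g) {u' : Q →[G] W} {v' : Q →[G] P} {p : W →[G] X}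
    (H' : IsPullback u' v' p u) : IsPullback u' (v.comp v') (f.comp p) g := by
  refine .mk' (fun w => ?_) (fun x y h => ?_) (fun w w' h1 h2 => ?_)
  · simp [H'.1, H.1]
  · obtain ⟨t, ht, rfl⟩ := H.exists (x := p x) (y := y) (by simpa using h)
    obtain ⟨r, hr, rfl⟩ := H'.exists (x := x) (y := t) ht.symm
    exact ⟨r, hr, rfl⟩
  · refine H'.ext h1 (H.ext ?_ h2)
    rw [← H'.1, ← H'.1, h1]

theorem exists_isPullback (f : X →[G] Z) (g : Y →[G] Z) :
    ∃ (P : GSet G) (u : P →[G] X) (v : P →[G] Y), IsPullback u v f g := by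
  let S : SubMulAction G (X × Y) :=
    { carrier := {z | f z.1 = g z.2}
      smul_mem' := fun c z hz => by
        have : f z.1 = g z.2 := hz
        simp [this] }
  have : Finite S := inferInstanceAs (Finite {z : X × Y // f z.1 = g z.2})
  refine ⟨of S, desc (fun z => z.1.1) (fun _ _ => rfl), desc (fun z => z.1.2) (fun _ _ => rfl),
    .mk' (fun w => ?_) (fun x y h => ?_) (fun w w' h1 h2 => ?_)⟩
  · obtain ⟨a, rfl⟩ := (ofEquiv (G := G) S).surjective w
    have := a.2
    change f a.1.1 = g a.1.2 at this
    simpa using this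
  · exact ⟨ofEquiv S ⟨(x, y), h⟩, by simp, by simp⟩
  · obtain ⟨a, rfl⟩ := (ofEquiv (G := G) S).surjective w
    obtain ⟨a', rfl⟩ := (ofEquiv (G := G) S).surjective w'
    congr 1
    simp only [desc_apply] at h1 h2
    exact Subtype.ext (Prod.ext h1 h2)

/-- The empty `G`-set. -/
noncomputable def empty (G : Type) [Group G] : GSet G where
  card := 0
  action := { smul := fun _ x => x, one_smul := fun _ => rfl, mul_smul := fun _ _ _ => rfl }

instance : IsEmpty (empty G) := inferInstanceAs (IsEmpty (Fin 0))

/-- The unique map out of the empty `G`-set. -/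
noncomputable def fromEmpty (X : GSet G) : empty G →[G] X where
  toFun x := isEmptyElim x
  map_smul' _ x := isEmptyElim x

theorem hom_ext_of_isEmpty [IsEmpty X] (f g : X →[G] Y) : f = g :=
  MulActionHom.ext fun x => isEmptyElim x

/-- The disjoint union of two finite `G`-sets. -/
noncomputable def sum (X Y : GSet G) : GSet G := of (X ⊕ Y)

/-- The first inclusion into a disjoint union. -/
noncomputable def inl {X Y : GSet G} : X →[G] sum X Y := lift Sum.inl (fun _ _ => rfl)

/-- The second inclusion into a disjoint union. -/
noncomputable def inr {X Y : GSet G} : Y →[G] sum X Y := lift Sum.inr (fun _ _ => rfl)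

theorem isCoprod_sum : IsCoprod (inl : X →[G] sum X Y) inr := by
  have : Sum.elim (inl : X →[G] sum X Y) (inr : Y →[G] sum X Y) = ofEquiv (G := G) (X ⊕ Y) := by
    ext z; cases z <;> rfl
  unfold IsCoprod
  rw [this]
  exact Equiv.bijective _

theorem IsCoprod.symm {i : X →[G] Z} {j : Y →[G] Z} (H : IsCoprod i j) : IsCoprod j i := by
  have : Sum.elim j i = Sum.elim i j ∘ Sum.swap := by ext z; cases z <;> rfl
  unfold IsCoprod
  rw [this]
  exact Function.Bijective.comp H (Equiv.sumComm _ _).bijective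

theorem IsCoprod.cases {i : X →[G] Z} {j : Y →[G] Z} (H : IsCoprod i j) (z : Z) :
    (∃ x, i x = z) ∨ ∃ y, j y = z := by
  obtain ⟨x | y, h⟩ := H.2 z
  exacts [.inl ⟨x, h⟩, .inr ⟨y, h⟩]

theorem IsCoprod.inl_inj {i : X →[G] Z} {j : Y →[G] Z} (H : IsCoprod i j) {x x' : X}
    (h : i x = i x') : x = x' := Sum.inl_injective (H.1 (a₁ := .inl x) (a₂ := .inl x') h)

theorem IsCoprod.inr_inj {i : X →[G] Z} {j : Y →[G] Z} (H : IsCoprod i j) {x x' : Y}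
    (h : j x = j x') : x = x' := Sum.inr_injective (H.1 (a₁ := .inr x) (a₂ := .inr x') h)

theorem IsCoprod.ne {i : X →[G] Z} {j : Y →[G] Z} (H : IsCoprod i j) {x : X} {y : Y}
    (h : i x = j y) : False := by simpa using H.1 (a₁ := .inl x) (a₂ := .inr y) h

theorem IsCoprod.mk' {i : X →[G] Z} {j : Y →[G] Z} (hc : ∀ z, (∃ x, i x = z) ∨ ∃ y, j y = z)
    (hi : ∀ x x', i x = i x' → x = x') (hj : ∀ x x', j x = j x' → x = x')
    (hn : ∀ x y, i x ≠ j y) : IsCoprod i j := by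
  constructor
  · rintro (x | x) (y | y) h
    · exact congrArg _ (hi _ _ h)
    · exact (hn _ _ h).elim
    · exact (hn _ _ h.symm).elim
    · exact congrArg _ (hj _ _ h)
  · intro z
    rcases hc z with ⟨x, h⟩ | ⟨x, h⟩
    exacts [⟨.inl x, h⟩, ⟨.inr x, h⟩]

theorem IsCoprod.exists_desc {i : X →[G] Z} {j : Y →[G] Z} (H : IsCoprod i j)
    (a : X →[G] T) (b : Y →[G] T) :
    ∃ c : Z →[G] T, (∀ x, c (i x) = a x) ∧ ∀ y, c (j y) = b y := by
  let E := Equiv.ofBijective _ H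
  have hi : ∀ x, E.symm (i x) = .inl x := fun x => E.symm_apply_eq.2 rfl
  have hj : ∀ x, E.symm (j x) = .inr x := fun x => E.symm_apply_eq.2 rfl
  refine ⟨⟨fun z => Sum.elim a b (E.symm z), fun γ z => ?_⟩, fun x => ?_, fun y => ?_⟩
  · rcases H.cases z with ⟨x, rfl⟩ | ⟨x, rfl⟩
    · rw [← map_smul, hi, hi]; simp
    · rw [← map_smul, hj, hj]; simp
  · change Sum.elim a b (E.symm (i x)) = _
    rw [hi]
    rfl
  · change Sum.elim a b (E.symm (j y)) = _
    rw [hj]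
    rfl

/-- The map out of a disjoint union with given components. -/
noncomputable def elim (a : X →[G] T) (b : Y →[G] T) : sum X Y →[G] T :=
  (isCoprod_sum.exists_desc a b).choose

@[simp] theorem elim_inl (a : X →[G] T) (b : Y →[G] T) (x : X) : elim a b (inl x) = a x :=
  (isCoprod_sum.exists_desc a b).choose_spec.1 x

@[simp] theorem elim_inr (a : X →[G] T) (b : Y →[G] T) (x : Y) : elim a b (inr x) = b x :=
  (isCoprod_sum.exists_desc a b).choose_spec.2 x

/-- The folding map. -/
noncomputable def fold (X : GSet G) : sum X X →[G] X := elim (MulActionHom.id G) (MulActionHom.id G)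

@[simp] theorem fold_inl (x : X) : fold X (inl x) = x := by simp [fold]
@[simp] theorem fold_inr (x : X) : fold X (inr x) = x := by simp [fold]

theorem exists_inverse (g : X →[G] Y) (hg : Function.Bijective g) :
    ∃ k : Y →[G] X, (∀ x, k (g x) = x) ∧ ∀ y, g (k y) = y := by
  let E := Equiv.ofBijective _ hg
  refine ⟨⟨E.symm, fun γ y => ?_⟩, E.symm_apply_apply, E.apply_symm_apply⟩
  rw [E.symm_apply_eq]
  change _ = g _
  rw [map_smul]
  congr 1
  exact (E.apply_symm_apply y).symm

/-! ### Exponential diagrams -/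

theorem IsExp.ext {h : A →[G] X} {f : X →[G] Y} {e : P →[G] A} {g : P →[G] B} {q : B →[G] Y}
    (H : IsExp h f e g q) {b b' : B} (hq : q b = q b')
    (hb : ∀ w w', g w = b → g w' = b' → h (e w) = h (e w') → e w = e w') : b = b' := by
  choose w hw1 hw2 using fun (x : X) (hx : f x = q b) => H.1.exists hx
  refine (H.2 (q b) (fun x hx => e (w x hx)) hw1).unique
    ⟨rfl, fun x hx => ⟨w x hx, hw2 x hx, rfl⟩⟩ ⟨hq.symm, fun x hx => ?_⟩
  obtain ⟨w', h1, h2⟩ := H.1.exists (hx.trans hq)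
  exact ⟨w', h2, (hb _ _ (hw2 x hx) h2 ((hw1 x hx).trans h1.symm)).symm⟩

theorem IsExp.mk' {h : A →[G] X} {f : X →[G] Y} {e : P →[G] A} {g : P →[G] B} {q : B →[G] Y}
    (H : IsPullback (h.comp e) g f q)
    (he : ∀ (y : Y) (s : ∀ x : X, f x = y → A), (∀ x hx, h (s x hx) = x) →
      ∃ b, q b = y ∧ ∀ x hx, ∃ w, g w = b ∧ e w = s x hx)
    (hu : ∀ b b', q b = q b' →
      (∀ w w', g w = b → g w' = b' → h (e w) = h (e w') → e w = e w') → b = b') :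
    IsExp h f e g q := by
  refine ⟨H, fun y s hs => ?_⟩
  obtain ⟨b, hb1, hb2⟩ := he y s hs
  refine ⟨b, ⟨hb1, hb2⟩, fun b' ⟨h1, h2⟩ => hu _ _ (h1.trans hb1.symm) fun w w' hw hw' hww => ?_⟩
  have hfx : f (h (e w)) = y := by
    have := H.1 w
    rw [hw, h1] at this
    exact this
  obtain ⟨v, hv1, hv2⟩ := hb2 _ hfx
  obtain ⟨v', hv1', hv2'⟩ := h2 _ hfx
  have e1 : w = v' := H.ext (by simp [hv2', hs]) (hw.trans hv1'.symm)
  have e2 : w' = v := H.ext (by simp [hv2, hs, hww]) (hw'.trans hv1.symm)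
  rw [e1, e2, hv2, hv2']

theorem exists_isExp (h : A →[G] X) (f : X →[G] Y) :
    ∃ (P B : GSet G) (e : P →[G] A) (g : P →[G] B) (q : B →[G] Y), IsExp h f e g q := by
  classical
  let : MulAction G (Set A) := Set.mulActionSet
  let S : SubMulAction G (Y × Set A) :=
    { carrier := {z | (∀ a ∈ z.2, f (h a) = z.1) ∧ ∀ x, f x = z.1 → ∃! a, a ∈ z.2 ∧ h a = x}
      smul_mem' := by
        rintro c ⟨y, T⟩ ⟨h1, h2⟩
        refine ⟨?_, ?_⟩
        · rintro a ha
          have ha : a ∈ c • T := ha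
          rw [Set.mem_smul_set_iff_inv_smul_mem] at ha
          have := h1 _ ha
          simp only [map_smul] at this
          exact inv_smul_eq_iff.1 this
        · intro x hx
          have hx : f x = c • y := hx
          obtain ⟨a, ⟨ha1, ha2⟩, hau⟩ := h2 (c⁻¹ • x) (by simp [hx])
          refine ⟨c • a, ⟨Set.smul_mem_smul_set ha1, by simp [ha2]⟩, ?_⟩
          rintro a' ⟨h3, h4⟩
          have h3 : a' ∈ c • T := h3
          rw [Set.mem_smul_set_iff_inv_smul_mem] at h3
          rw [← hau (c⁻¹ • a') ⟨h3, by simp [h4]⟩, smul_inv_smul] }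
  have hS : ∀ z : S, (∀ a ∈ z.1.2, f (h a) = z.1.1) ∧
      ∀ x, f x = z.1.1 → ∃! a, a ∈ z.1.2 ∧ h a = x := fun z => z.2
  let R : SubMulAction G (A × S) :=
    { carrier := {z | z.1 ∈ z.2.1.2}
      smul_mem' := fun c z hz => Set.smul_mem_smul_set (s := z.2.1.2) hz }
  have hR : ∀ z : R, z.1.1 ∈ z.1.2.1.2 := fun z => z.2
  have : Finite S := Subtype.finite (α := Y × Set A)
  have : Finite R := Subtype.finite (α := A × S)
  refine ⟨of R, of S, desc (fun z => z.1.1) (fun _ _ => rfl),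
    desc (fun z => ofEquiv S z.1.2) (fun c z => ?_), desc (fun z => z.1.1) (fun _ _ => rfl),
    .mk' (.mk' (fun w => ?_) (fun x b hb => ?_) (fun w w' h1 h2 => ?_)) (fun y s hs => ?_)
      (fun b b' hq hb => ?_)⟩
  · rw [← ofEquiv_smul]; rfl
  · obtain ⟨a, rfl⟩ := (ofEquiv (G := G) R).surjective w
    simpa using (hS a.1.2).1 _ (hR a)
  · obtain ⟨b, rfl⟩ := (ofEquiv (G := G) S).surjective b
    obtain ⟨a, ⟨h1, h2⟩, -⟩ := (hS b).2 x (by simpa using hb)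
    exact ⟨ofEquiv R ⟨(a, b), h1⟩, by simpa using h2, by simp⟩
  · obtain ⟨a, rfl⟩ := (ofEquiv (G := G) R).surjective w
    obtain ⟨a', rfl⟩ := (ofEquiv (G := G) R).surjective w'
    simp only [desc_apply, EmbeddingLike.apply_eq_iff_eq, MulActionHom.comp_apply] at h1 h2
    congr 1
    refine Subtype.ext (Prod.ext ?_ h2)
    have hf := (hS a.1.2).1 _ (hR a)
    have hm := hR a'
    rw [← h2] at hm
    exact ((hS a.1.2).2 _ hf).unique ⟨hR a, rfl⟩ ⟨hm, h1.symm⟩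
  · refine ⟨ofEquiv S ⟨(y, {a | ∃ x hx, s x hx = a}), ?_, ?_⟩, by simp, fun x hx => ?_⟩
    · rintro a ⟨x, hx, rfl⟩
      simpa [hs] using hx
    · intro x hx
      refine ⟨s x hx, ⟨⟨x, hx, rfl⟩, hs x hx⟩, ?_⟩
      rintro a ⟨⟨x', hx', rfl⟩, rfl⟩
      congr 1
      exact (hs x' hx').symm
    · exact ⟨ofEquiv R ⟨(s x hx, ⟨(y, {a | ∃ x hx, s x hx = a}), _⟩), ⟨x, hx, rfl⟩⟩,
        by rw [desc_apply], by simp⟩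
  · obtain ⟨b, rfl⟩ := (ofEquiv (G := G) S).surjective b
    obtain ⟨b', rfl⟩ := (ofEquiv (G := G) S).surjective b'
    simp only [desc_apply] at hq
    congr 1
    have key : ∀ b b' : S, b.1.1 = b'.1.1 → (∀ a ∈ b.1.2, ∀ a' ∈ b'.1.2, h a = h a' → a = a') →
        b.1.2 ⊆ b'.1.2 := by
      intro b b' hq hb a ha
      have hf := (hS b).1 _ ha
      obtain ⟨a', ⟨h1, h2⟩, -⟩ := (hS b').2 (h a) (hf.trans hq)
      rw [hb a ha a' h1 h2.symm]
      exact h1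
    have hb' : ∀ a ∈ b.1.2, ∀ a' ∈ b'.1.2, h a = h a' → a = a' := fun a ha a' ha' hh => by
      simpa using hb (ofEquiv R ⟨(a, b), ha⟩) (ofEquiv R ⟨(a', b'), ha'⟩) (by simp) (by simp)
        (by simpa using hh)
    exact Subtype.ext (Prod.ext hq (Set.Subset.antisymm (key _ _ hq hb')
      (key _ _ hq.symm fun a ha a' ha' hh => (hb' _ ha' _ ha hh.symm).symm)))

/-- Exponential diagrams for composites. -/
theorem IsExp.comp {B₁ B₂ P₁ P₂ R : GSet G} {p : A →[G] X} {f₁ : X →[G] Y} {f₂ : Y →[G] Z}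
    {e₁ : P₁ →[G] A} {g₁ : P₁ →[G] B₁} {q₁ : B₁ →[G] Y} (H₁ : IsExp p f₁ e₁ g₁ q₁)
    {e₂ : P₂ →[G] B₁} {g₂ : P₂ →[G] B₂} {q₂ : B₂ →[G] Z} (H₂ : IsExp q₁ f₂ e₂ g₂ q₂)
    {a : R →[G] P₁} {b : R →[G] P₂} (H : IsPullback a b g₁ e₂) :
    IsExp p (f₂.comp f₁) (e₁.comp a) (g₂.comp b) q₂ := by
  have e1 : ∀ w, f₁ (p (e₁ w)) = q₁ (g₁ w) := H₁.1.1
  have e2 : ∀ w, f₂ (q₁ (e₂ w)) = q₂ (g₂ w) := H₂.1.1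
  have e3 := H.1
  refine .mk' (.mk' (fun w => ?_) (fun x b hb => ?_) (fun w w' h1 h2 => ?_)) (fun z s hs => ?_)
      (fun c c' hq hb => ?_)
  · simp [e1, e3, e2]
  · obtain ⟨w2, h1, h2⟩ := H₂.1.exists (x := f₁ x) (y := b) (by simpa using hb)
    obtain ⟨w1, h3, h4⟩ := H₁.1.exists (x := x) (y := e₂ w2) (by simpa using h1.symm)
    obtain ⟨w, h5, h6⟩ := H.exists h4
    exact ⟨w, by simpa [h5] using h3, by simp [h6, h2]⟩
  · simp only [MulActionHom.comp_apply] at h1 h2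
    have : b w = b w' := H₂.1.ext (by simp [← e3, ← e1, h1]) h2
    exact H.ext (H₁.1.ext h1 (by rw [e3, e3, this])) this
  · have : ∀ y, f₂ y = z → ∃ b, q₁ b = y ∧ ∀ x (hx : f₁ x = y) (hx' : f₂ (f₁ x) = z),
        ∃ w, g₁ w = b ∧ e₁ w = s x hx' := by
      intro y hy
      obtain ⟨b, ⟨h1, h2⟩, -⟩ := H₁.2 y (fun x hx => s x (by simp [hx, hy])) (fun x hx => hs _ _)
      exact ⟨b, h1, fun x hx _ => h2 x hx⟩
    choose b hb1 hb2 using this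
    obtain ⟨c, ⟨hc1, hc2⟩, -⟩ := H₂.2 z b hb1
    refine ⟨c, hc1, fun x hx => ?_⟩
    obtain ⟨w2, h1, h2⟩ := hc2 (f₁ x) hx
    obtain ⟨w1, h3, h4⟩ := hb2 (f₁ x) hx x rfl hx
    obtain ⟨w, h5, h6⟩ := H.exists (x := w1) (y := w2) (by rw [h3, h2])
    exact ⟨w, by simp [h6, h1], by simp [h5, h4]⟩
  · refine H₂.ext hq fun w2 w2' h1 h2 h3 => H₁.ext h3 fun w1 w1' h4 h5 h6 => ?_
    obtain ⟨w, h7, h8⟩ := H.exists h4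
    obtain ⟨w', h7', h8'⟩ := H.exists h5
    have := hb w w' (by simp [h8, h1]) (by simp [h8', h2]) (by simp [h7, h7', h6])
    simpa [h7, h7'] using this

/-- Base change of exponential diagrams. -/
theorem IsExp.baseChange {Q' B' W' : GSet G} {p : W →[G] X} {f : X →[G] Z}
    {e : Q →[G] W} {g₀ : Q →[G] B} {q : B →[G] Z} (H : IsExp p f e g₀ q)
    {u : P →[G] X} {v : P →[G] Y} {g : Y →[G] Z} (H₁ : IsPullback u v f g)
    {u' : W' →[G] W} {p' : W' →[G] P} (H₂ : IsPullback u' p' p u)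
    {β : B' →[G] B} {q' : B' →[G] Y} (H₃ : IsPullback β q' q g)
    {κ : Q' →[G] Q} {g₀' : Q' →[G] B'} (H₄ : IsPullback κ g₀' g₀ β) :
    ∃ e' : Q' →[G] W', (∀ w, u' (e' w) = e (κ w)) ∧ IsExp p' v e' g₀' q' := by
  have e0 : ∀ w, f (p (e w)) = q (g₀ w) := H.1.1
  have e1 := H₁.1
  have e2 := H₂.1
  have e3 := H₃.1
  have e4 := H₄.1
  obtain ⟨d, hd1, hd2⟩ := H₁.exists_lift ((p.comp e).comp κ) (q'.comp g₀')
    (fun t => by simp [e0, e4, e3])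
  obtain ⟨e', h1, h2⟩ := H₂.exists_lift (e.comp κ) d (fun t => by simp [hd1])
  simp only [MulActionHom.comp_apply] at hd1 hd2 h1
  refine ⟨e', h1, .mk' (.mk' (fun w => ?_) (fun x b hb => ?_) (fun w w' h3 h4 => ?_))
    (fun y s hs => ?_) (fun c c' hq hb => ?_)⟩
  · simp [h2, hd2]
  · obtain ⟨w, h3, h4⟩ := H.1.exists (x := u x) (y := β b) (by rw [e1, hb, e3])
    obtain ⟨w', h5, h6⟩ := H₄.exists h4
    refine ⟨w', H₁.ext ?_ ?_, h6⟩
    · simpa [h2, hd1, h5] using h3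
    · simp [h2, hd2, h6, hb]
  · simp only [MulActionHom.comp_apply, h2] at h3
    refine H₄.ext (H.1.ext ?_ ?_) h4
    · simp [← hd1, h3]
    · rw [e4, e4, h4]
  · choose r hr1 hr2 using fun x (hx : f x = g y) => H₁.exists hx
    obtain ⟨b, ⟨hb1, hb2⟩, -⟩ := H.2 (g y) (fun x hx => u' (s (r x hx) (hr2 x hx)))
      (fun x hx => by rw [e2, hs, hr1])
    obtain ⟨b', hb3, hb4⟩ := H₃.exists hb1
    refine ⟨b', hb4, fun x hx => ?_⟩
    have hx' : f (u x) = g y := by rw [e1, hx]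
    obtain ⟨w, h3, h4⟩ := hb2 (u x) hx'
    obtain ⟨w', h5, h6⟩ := H₄.exists (x := w) (y := b') (by rw [h3, hb3])
    have hrx : r (u x) hx' = x := H₁.ext (hr1 _ _) ((hr2 _ _).trans hx.symm)
    refine ⟨w', h6, H₂.ext ?_ (H₁.ext ?_ ?_)⟩
    · rw [h1, h5, h4]
      congr 2
    · rw [h2, hd1, h5, h4, e2, hs, hs, hr1]
    · rw [h2, hd2, h6, hb4, hs, hx]
  · refine H₃.ext (H.ext ?_ fun w w' h3 h4 h5 => ?_) hq
    · rw [e3, e3, hq]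
    · obtain ⟨v1, h6, h7⟩ := H₄.exists h3
      obtain ⟨v2, h8, h9⟩ := H₄.exists h4
      have := hb v1 v2 h7 h9 (H₁.ext (by simp [h2, hd1, h6, h8, h5]) (by simp [h2, hd2, h7, h9, hq]))
      rw [← h6, ← h8, ← h1, ← h1, this]

/-- Exponential diagrams for a composite `W → A → X` over `X`. -/
theorem IsExp.trans {B₂ P₂ : GSet G} {h : A →[G] X} {f : X →[G] Y}
    {e : P →[G] A} {g : P →[G] B} {q : B →[G] Y} (H : IsExp h f e g q) {w : W →[G] A}
    {a : Q →[G] W} {b : Q →[G] P} (H₁ : IsPullback a b w e)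
    {e₂ : P₂ →[G] Q} {g₂ : P₂ →[G] B₂} {q₂ : B₂ →[G] B} (H₂ : IsExp b g e₂ g₂ q₂) :
    IsExp (h.comp w) f (a.comp e₂) g₂ (q.comp q₂) := by
  have e0 : ∀ w, f (h (e w)) = q (g w) := H.1.1
  have e1 := H₁.1
  have e2 : ∀ w, g (b (e₂ w)) = q₂ (g₂ w) := H₂.1.1
  refine .mk' (.mk' (fun w => ?_) (fun x c hc => ?_) (fun w w' h1 h2 => ?_)) (fun y s hs => ?_)
      (fun c c' hq hb => ?_)
  · simp [e1, e0, e2]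
  · obtain ⟨w1, h1, h2⟩ := H.1.exists (x := x) (y := q₂ c) (by simpa using hc)
    obtain ⟨w2, h3, h4⟩ := H₂.1.exists h2
    simp only [MulActionHom.comp_apply] at h1 h3
    exact ⟨w2, by simp [e1, h3, h1], h4⟩
  · simp only [MulActionHom.comp_apply, e1] at h1
    refine H₂.1.ext (H.1.ext h1 ?_) h2
    simp [e2, h2]
  · simp only [MulActionHom.comp_apply] at hs
    obtain ⟨c, ⟨h1, h2⟩, -⟩ := H.2 y (fun x hx => w (s x hx)) hs
    have h3 : ∀ x, g x = c → f (h (e x)) = y := fun x hx => by rw [e0, hx, h1]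
    have h4 : ∀ x (hx : g x = c), e x = w (s (h (e x)) (h3 x hx)) := by
      intro x hx
      obtain ⟨v, hv1, hv2⟩ := h2 _ (h3 x hx)
      rw [← hv2, H.1.ext (w := x) (w' := v) (by simp [hv2, hs]) (hx.trans hv1.symm)]
    choose t ht1 ht2 using fun x (hx : g x = c) => H₁.exists (h4 x hx).symm
    obtain ⟨c', ⟨h5, h6⟩, -⟩ := H₂.2 c t ht2
    refine ⟨c', by simp [h5, h1], fun x hx => ?_⟩
    obtain ⟨v, hv1, hv2⟩ := h2 x hx
    obtain ⟨v', hv3, hv4⟩ := h6 v hv1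
    refine ⟨v', hv3, ?_⟩
    have : h (e v) = x := by rw [hv2, hs]
    simp only [MulActionHom.comp_apply, hv4, ht1]
    congr 1
  · have key : ∀ x x', g₂ x = c → g₂ x' = c' → h (e (b (e₂ x))) = h (e (b (e₂ x'))) →
        a (e₂ x) = a (e₂ x') := fun x x' h1 h2 h3 => by
      simpa using hb x x' h1 h2 (by simpa [e1] using h3)
    have hqc : q₂ c = q₂ c' := H.ext hq fun v v' h1 h2 h3 => by
      obtain ⟨x, h4, h5⟩ := H₂.1.exists h1
      obtain ⟨x', h4', h5'⟩ := H₂.1.exists h2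
      simp only [MulActionHom.comp_apply] at h4 h4'
      rw [← h4, ← h4', ← e1, ← e1, key x x' h5 h5' (by rw [h4, h4', h3])]
    exact H₂.ext hqc fun x x' h1 h2 h3 => H₁.ext (key x x' h1 h2 (by rw [h3])) h3

/-- The comparison map between two dependent products. -/
theorem IsExp.exists_map {P' B' : GSet G} {h : A →[G] X} {f : X →[G] Y}
    {e : P →[G] A} {g : P →[G] B} {q : B →[G] Y} (H : IsExp h f e g q)
    {e' : P' →[G] A} {g' : P' →[G] B'} {q' : B' →[G] Y} (H' : IsExp h f e' g' q') :
    ∃ c : B →[G] B', (∀ b, q' (c b) = q b) ∧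
      ∀ w w', g' w' = c (g w) → h (e w) = h (e' w') → e w = e' w' := by
  have e0 : ∀ w, f (h (e w)) = q (g w) := H.1.1
  have e0' : ∀ w, f (h (e' w)) = q' (g' w) := H'.1.1
  have : ∀ b, ∃ b', q' b' = q b ∧
      ∀ w w', g w = b → g' w' = b' → h (e w) = h (e' w') → e w = e' w' := by
    intro b
    choose w hw1 hw2 using fun (x : X) (hx : f x = q b) => H.1.exists hx
    obtain ⟨b', ⟨h1, h2⟩, -⟩ := H'.2 (q b) (fun x hx => e (w x hx)) hw1
    refine ⟨b', h1, fun v v' hv hv' hvv => ?_⟩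
    have hx : f (h (e v)) = q b := by rw [e0, hv]
    obtain ⟨v₀, h3, h4⟩ := h2 _ hx
    have e1 : v = w _ hx := H.1.ext (hw1 _ hx).symm (hv.trans (hw2 _ hx).symm)
    have e2 : v' = v₀ := H'.1.ext
      (hvv.symm.trans (by rw [MulActionHom.comp_apply, h4]; exact (hw1 _ hx).symm))
      (hv'.trans h3.symm)
    rw [e2, h4, ← e1]
  choose c hc1 hc2 using this
  refine ⟨⟨c, fun γ b => H'.ext ?_ fun w w' h1 h2 h3 => ?_⟩, hc1,
    fun w w' h1 h2 => hc2 _ w w' rfl h1 h2⟩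
  · simp [hc1]
  · obtain ⟨v, hv1, hv2⟩ := H.1.exists (x := h (e' w)) (y := γ • b) (by rw [e0', h1, hc1])
    have e1 := hc2 _ v w hv2 h1 hv1
    have e2 := hc2 b (γ⁻¹ • v) (γ⁻¹ • w') (by simp [hv2]) (by simp [h2]) (by
      rw [map_smul, map_smul, map_smul, map_smul]
      exact congrArg _ (hv1.trans h3))
    rw [map_smul, map_smul] at e2
    exact e1.symm.trans (smul_left_cancel _ e2)

/-- Dependent products are unique up to isomorphism. -/
theorem IsExp.exists_iso {P' B' : GSet G} {h : A →[G] X} {f : X →[G] Y}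
    {e : P →[G] A} {g : P →[G] B} {q : B →[G] Y} (H : IsExp h f e g q)
    {e' : P' →[G] A} {g' : P' →[G] B'} {q' : B' →[G] Y} (H' : IsExp h f e' g' q') :
    ∃ (c : B →[G] B') (d : P →[G] P'), Function.Bijective c ∧ (∀ b, q' (c b) = q b) ∧
      (∀ w, e' (d w) = e w) ∧ IsPullback d g g' c := by
  have e0 : ∀ w, f (h (e w)) = q (g w) := H.1.1
  have e0' : ∀ w, f (h (e' w)) = q' (g' w) := H'.1.1
  obtain ⟨c, h1, h2⟩ := H.exists_map H'
  obtain ⟨c', h1', h2'⟩ := H'.exists_map H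
  have hcc : ∀ b, c (c' b) = b := fun b => H'.ext (by rw [h1, h1']) fun w w' h3 h4 h5 => by
    obtain ⟨v, hv1, hv2⟩ := H.1.exists (x := h (e' w)) (y := c' b) (by rw [e0', h3, h1])
    rw [← h2 v w (by rw [hv2, h3]) hv1]
    exact (h2' w' v (by rw [hv2, h4]) (h5.symm.trans hv1.symm)).symm
  have hcc' : ∀ b, c' (c b) = b := fun b => H.ext (by rw [h1', h1]) fun w w' h3 h4 h5 => by
    obtain ⟨v, hv1, hv2⟩ := H'.1.exists (x := h (e w)) (y := c b) (by rw [e0, h3, h1'])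
    rw [← h2' v w (by rw [hv2, h3]) hv1]
    exact (h2 w' v (by rw [hv2, h4]) (h5.symm.trans hv1.symm)).symm
  obtain ⟨d, hd1, hd2⟩ := H'.1.exists_lift (h.comp e) (c.comp g) (fun t => by simp [e0, h1])
  have hd : ∀ w, e' (d w) = e w := fun w => (h2 w (d w) (hd2 w) (hd1 w).symm).symm
  refine ⟨c, d, ⟨fun x y hxy => by rw [← hcc' x, ← hcc' y, hxy], fun x => ⟨_, hcc x⟩⟩, h1, hd,
    .mk' hd2 (fun x b hb => ?_) fun w w' h3 h4 => H.1.ext ?_ h4⟩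
  · obtain ⟨w, h3, h4⟩ := H.1.exists (x := h (e' x)) (y := b) (by rw [e0', hb, h1])
    refine ⟨w, H'.1.ext ((hd1 w).trans h3) ?_, h4⟩
    rw [hd2, hb, MulActionHom.comp_apply, h4]
  · rw [← hd1, ← hd1, h3]

end constructions

end GSet

/-- A functor of finite `G`-sets with restrictions `res` and covariant maps `push`, subject to base
change along cartesian squares, that takes disjoint unions to products. The monoid operation on
values that the folding maps induce is `SemiMackey.op`. -/
structure SemiMackey (G : Type) [Group G] where
  obj : GSet G → Type u
  res : ∀ {X Y : GSet G}, (X →[G] Y) → obj Y → obj X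
  push : ∀ {X Y : GSet G}, (X →[G] Y) → obj X → obj Y
  res_id : ∀ {X : GSet G} (a : obj X), res (MulActionHom.id G) a = a
  res_comp : ∀ {X Y Z : GSet G} (f : X →[G] Y) (g : Y →[G] Z) (a : obj Z),
    res (g.comp f) a = res f (res g a)
  push_id : ∀ {X : GSet G} (a : obj X), push (MulActionHom.id G) a = a
  push_comp : ∀ {X Y Z : GSet G} (f : X →[G] Y) (g : Y →[G] Z) (a : obj X),
    push (g.comp f) a = push g (push f a)
  push_res : ∀ {P X Y Z : GSet G} {u : P →[G] X} {v : P →[G] Y} {f : X →[G] Z} {g : Y →[G] Z},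
    GSet.IsPullback u v f g → ∀ a : obj X, res g (push f a) = push v (res u a)
  empty : ∀ X : GSet G, IsEmpty X → Nonempty (Unique (obj X))
  coprod : ∀ {X Y Z : GSet G} {i : X →[G] Z} {j : Y →[G] Z}, GSet.IsCoprod i j →
    Function.Bijective fun z : obj Z => (res i z, res j z)

namespace SemiMackey

variable {G : Type} [Group G] (M : SemiMackey.{u} G) {X Y Z W P : GSet G}

theorem ext {i : X →[G] Z} {j : Y →[G] Z} (H : GSet.IsCoprod i j) {a b : M.obj Z}
    (h1 : M.res i a = M.res i b) (h2 : M.res j a = M.res j b) : a = b :=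
  (M.coprod H).1 (Prod.ext h1 h2)

/-- The element of the value at a disjoint union with given components. -/
noncomputable def pair (a : M.obj X) (b : M.obj Y) : M.obj (X.sum Y) :=
  ((M.coprod GSet.isCoprod_sum).2 (a, b)).choose

@[simp] theorem res_inl_pair (a : M.obj X) (b : M.obj Y) : M.res GSet.inl (M.pair a b) = a :=
  congrArg Prod.fst ((M.coprod GSet.isCoprod_sum).2 (a, b)).choose_spec

@[simp] theorem res_inr_pair (a : M.obj X) (b : M.obj Y) : M.res GSet.inr (M.pair a b) = b :=
  congrArg Prod.snd ((M.coprod GSet.isCoprod_sum).2 (a, b)).choose_spec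

/-- The operation induced by the folding map `X ⊔ X → X`. -/
noncomputable def op (a b : M.obj X) : M.obj X := M.push (GSet.fold X) (M.pair a b)

/-- The element induced by the map `∅ → X`. -/
noncomputable def unit (X : GSet G) : M.obj X :=
  M.push (GSet.fromEmpty X) (M.empty (GSet.empty G) inferInstance).some.default

theorem subsingleton [h : IsEmpty X] (a b : M.obj X) : a = b := by
  obtain ⟨i⟩ := M.empty X h
  rw [Unique.eq_default a, Unique.eq_default b]

theorem res_comp' {f : X →[G] Y} {g : Y →[G] Z} {h : X →[G] Z} (H : ∀ x, g (f x) = h x)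
    (a : M.obj Z) : M.res f (M.res g a) = M.res h a := by
  rw [← M.res_comp]; congr 1; exact MulActionHom.ext H

theorem push_comp' {f : X →[G] Y} {g : Y →[G] Z} {h : X →[G] Z} (H : ∀ x, g (f x) = h x)
    (a : M.obj X) : M.push g (M.push f a) = M.push h a := by
  rw [← M.push_comp]; congr 1; exact MulActionHom.ext H

theorem res_id' {f : X →[G] X} (H : ∀ x, f x = x) (a : M.obj X) : M.res f a = a := by
  obtain rfl : f = MulActionHom.id G := MulActionHom.ext H
  exact M.res_id a

theorem push_id' {f : X →[G] X} (H : ∀ x, f x = x) (a : M.obj X) : M.push f a = a := by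
  obtain rfl : f = MulActionHom.id G := MulActionHom.ext H
  exact M.push_id a

theorem push_eq_op {i : X →[G] Z} {j : Y →[G] Z} (H : GSet.IsCoprod i j) (f : Z →[G] W)
    (z : M.obj Z) :
    M.push f z = M.op (M.push (f.comp i) (M.res i z)) (M.push (f.comp j) (M.res j z)) := by
  obtain ⟨s, hs1, hs2⟩ := H.exists_desc (GSet.inl.comp (f.comp i)) (GSet.inr.comp (f.comp j))
  simp only [MulActionHom.comp_apply] at hs1 hs2
  have K := GSet.isCoprod_sum (X := W) (Y := W)
  have hf : ∀ x, GSet.fold W (s x) = f x := by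
    intro x
    rcases H.cases x with ⟨x, rfl⟩ | ⟨x, rfl⟩
    · simp [hs1]
    · simp [hs2]
  rw [← M.push_comp' hf, op]
  congr 1
  refine M.ext K ?_ ?_
  · rw [res_inl_pair]
    refine M.push_res (.mk' (fun w => by simp [hs1]) (fun x y h => ?_)
      fun w w' h1 _ => H.inl_inj h1) z
    rcases H.cases x with ⟨x, rfl⟩ | ⟨x, rfl⟩
    · rw [hs1] at h
      exact ⟨x, rfl, K.inl_inj h⟩
    · rw [hs2] at h
      exact (K.ne h.symm).elim
  · rw [res_inr_pair]
    refine M.push_res (.mk' (fun w => by simp [hs2]) (fun x y h => ?_)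
      fun w w' h1 _ => H.inr_inj h1) z
    rcases H.cases x with ⟨x, rfl⟩ | ⟨x, rfl⟩
    · rw [hs1] at h
      exact (K.ne h).elim
    · rw [hs2] at h
      exact ⟨x, rfl, K.inr_inj h⟩

theorem push_op (f : X →[G] Y) (a b : M.obj X) :
    M.push f (M.op a b) = M.op (M.push f a) (M.push f b) := by
  have h1 : (f.comp (GSet.fold X)).comp GSet.inl = f := MulActionHom.ext fun x => by simp
  have h2 : (f.comp (GSet.fold X)).comp GSet.inr = f := MulActionHom.ext fun x => by simp
  rw [op, ← M.push_comp, M.push_eq_op GSet.isCoprod_sum, h1, h2, res_inl_pair, res_inr_pair]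

theorem op_comm (a b : M.obj X) : M.op a b = M.op b a := by
  have h1 : (GSet.fold X).comp GSet.inl = MulActionHom.id G := MulActionHom.ext fun x => by simp
  have h2 : (GSet.fold X).comp GSet.inr = MulActionHom.id G := MulActionHom.ext fun x => by simp
  rw [op, M.push_eq_op GSet.isCoprod_sum.symm, h1, h2, res_inl_pair, res_inr_pair, push_id, push_id]

theorem unit_op (a : M.obj X) : M.op (M.unit X) a = a := by
  have H : GSet.IsCoprod (GSet.fromEmpty X) (MulActionHom.id G : X →[G] X) :=
    .mk' (fun z => .inr ⟨z, rfl⟩) (fun x => isEmptyElim x) (fun _ _ h => h)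
      (fun x => isEmptyElim x)
  have := M.push_eq_op H (MulActionHom.id G) a
  rw [M.push_id] at this
  conv_rhs => rw [this]
  rw [M.push_id' (fun _ => rfl), M.res_id, unit]
  congr 2
  exact M.subsingleton _ _

theorem op_assoc (a b c : M.obj X) : M.op (M.op a b) c = M.op a (M.op b c) := by
  let z := M.pair a (M.pair b c)
  let f : X.sum (X.sum X) →[G] X := GSet.elim (MulActionHom.id G) (GSet.fold X)
  have K := GSet.isCoprod_sum (X := X) (Y := X.sum X)
  have K' := GSet.isCoprod_sum (X := X) (Y := X)
  have E1 : M.push f z = M.op a (M.op b c) := by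
    have hf : f.comp GSet.inr = GSet.fold X := MulActionHom.ext fun x => by simp [f]
    rw [M.push_eq_op K, M.push_id' (by simp [f]), res_inl_pair, res_inr_pair, hf]
    rfl
  let i : X.sum X →[G] X.sum (X.sum X) := GSet.elim GSet.inl (GSet.inr.comp GSet.inl)
  let j : X →[G] X.sum (X.sum X) := GSet.inr.comp GSet.inr
  have H : GSet.IsCoprod i j := by
    refine .mk' (fun z => ?_) (fun x x' h => ?_) (fun x x' h => ?_) (fun x y h => ?_)
    · rcases K.cases z with ⟨x, rfl⟩ | ⟨x, rfl⟩
      · exact .inl ⟨GSet.inl x, by simp [i]⟩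
      · rcases K'.cases x with ⟨x, rfl⟩ | ⟨x, rfl⟩
        · exact .inl ⟨GSet.inr x, by simp [i]⟩
        · exact .inr ⟨x, rfl⟩
    · rcases K'.cases x with ⟨x, rfl⟩ | ⟨x, rfl⟩ <;> rcases K'.cases x' with ⟨x', rfl⟩ | ⟨x', rfl⟩ <;>
        simp only [i, GSet.elim_inl, GSet.elim_inr, MulActionHom.comp_apply] at h
      · rw [K.inl_inj h]
      · exact (K.ne h).elim
      · exact (K.ne h.symm).elim
      · rw [K'.inl_inj (K.inr_inj h)]
    · exact K'.inr_inj (K.inr_inj h)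
    · rcases K'.cases x with ⟨x, rfl⟩ | ⟨x, rfl⟩ <;>
        simp only [i, j, GSet.elim_inl, GSet.elim_inr, MulActionHom.comp_apply] at h
      · exact K.ne h
      · exact K'.ne (K.inr_inj h)
  rw [← E1, M.push_eq_op H, M.push_id' (by simp [f, j])]
  congr 1
  · rw [op]
    have h1 : f.comp i = GSet.fold X := MulActionHom.ext fun x => by
      rcases K'.cases x with ⟨x, rfl⟩ | ⟨x, rfl⟩ <;> simp [f, i]
    rw [h1]
    congr 1
    refine M.ext K' ?_ ?_
    · rw [M.res_comp' (h := GSet.inl) (by simp [i])]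
      simp [z]
    · rw [M.res_comp' (h := GSet.inr.comp GSet.inl) (by simp [i]), M.res_comp]
      simp [z]
  · simp only [j, M.res_comp, z, res_inr_pair]

theorem res_op (f : Y →[G] X) (a b : M.obj X) :
    M.res f (M.op a b) = M.op (M.res f a) (M.res f b) := by
  have K := GSet.isCoprod_sum (X := X) (Y := X)
  have K' := GSet.isCoprod_sum (X := Y) (Y := Y)
  let F : Y.sum Y →[G] X.sum X := GSet.elim (GSet.inl.comp f) (GSet.inr.comp f)
  have H : GSet.IsPullback F (GSet.fold Y) (GSet.fold X) f := by
    refine .mk' (fun w => ?_) (fun x y h => ?_) (fun w w' h1 h2 => ?_)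
    · rcases K'.cases w with ⟨x, rfl⟩ | ⟨x, rfl⟩ <;> simp [F]
    · rcases K.cases x with ⟨x, rfl⟩ | ⟨x, rfl⟩
      · exact ⟨GSet.inl y, by simpa [F] using congrArg _ h.symm, by simp⟩
      · exact ⟨GSet.inr y, by simpa [F] using congrArg _ h.symm, by simp⟩
    · rcases K'.cases w with ⟨x, rfl⟩ | ⟨x, rfl⟩ <;> rcases K'.cases w' with ⟨x', rfl⟩ | ⟨x', rfl⟩ <;>
        simp only [F, GSet.elim_inl, GSet.elim_inr, MulActionHom.comp_apply, GSet.fold_inl,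
          GSet.fold_inr] at h1 h2
      · rw [h2]
      · exact (K.ne h1).elim
      · exact (K.ne h1.symm).elim
      · rw [h2]
  rw [op, M.push_res H, op]
  congr 1
  refine M.ext K' ?_ ?_
  · rw [M.res_comp' (h := GSet.inl.comp f) (by simp [F]), M.res_comp]
    simp
  · rw [M.res_comp' (h := GSet.inr.comp f) (by simp [F]), M.res_comp]
    simp

theorem res_unit (f : Y →[G] X) : M.res f (M.unit X) = M.unit Y := by
  rw [unit, M.push_res (u := MulActionHom.id G) (v := GSet.fromEmpty Y)
    (.mk' (fun w => isEmptyElim w) (fun w => isEmptyElim w) (fun w => isEmptyElim w)), unit]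
  congr 1
  exact M.subsingleton _ _

theorem push_unit (f : X →[G] Y) : M.push f (M.unit X) = M.unit Y :=
  M.push_comp' (fun x => isEmptyElim x) _

/-- Covariant maps on pairs: `(f ⊔ g)_! (a, b) = (f_! a, g_! b)`. -/
theorem push_pair {X' Y' : GSet G} (f : X →[G] X') (g : Y →[G] Y') (a : M.obj X) (b : M.obj Y) :
    M.push (GSet.elim (GSet.inl.comp f) (GSet.inr.comp g)) (M.pair a b) =
      M.pair (M.push f a) (M.push g b) := by
  have K := GSet.isCoprod_sum (X := X) (Y := Y)
  have K' := GSet.isCoprod_sum (X := X') (Y := Y')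
  refine M.ext K' ?_ ?_
  · rw [M.push_res (u := GSet.inl) (v := f) (.mk' (by simp) (fun x y h => ?_)
      fun w w' h1 _ => K.inl_inj h1)]
    · simp
    · rcases K.cases x with ⟨x, rfl⟩ | ⟨x, rfl⟩
      · exact ⟨x, rfl, K'.inl_inj (by simpa using h)⟩
      · exact (K'.ne (by simpa using h.symm)).elim
  · rw [M.push_res (u := GSet.inr) (v := g) (.mk' (by simp) (fun x y h => ?_)
      fun w w' h1 _ => K.inr_inj h1)]
    · simp
    · rcases K.cases x with ⟨x, rfl⟩ | ⟨x, rfl⟩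
      · exact (K'.ne (by simpa using h)).elim
      · exact ⟨x, rfl, K'.inr_inj (by simpa using h)⟩

theorem res_pair {X' Y' : GSet G} (f : X' →[G] X) (g : Y' →[G] Y) (a : M.obj X) (b : M.obj Y) :
    M.res (GSet.elim (GSet.inl.comp f) (GSet.inr.comp g)) (M.pair a b) =
      M.pair (M.res f a) (M.res g b) := by
  refine M.ext GSet.isCoprod_sum ?_ ?_
  · rw [M.res_comp' (h := GSet.inl.comp f) (by simp), M.res_comp]
    simp
  · rw [M.res_comp' (h := GSet.inr.comp g) (by simp), M.res_comp]
    simp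

theorem push_res_bij (g : X →[G] Y) (hg : Function.Bijective g) (a : M.obj Y) :
    M.push g (M.res g a) = a := by
  rw [← M.push_res (f := MulActionHom.id G) (g := MulActionHom.id G) (u := g) (v := g)
    (.mk' (fun _ => rfl) (fun x y h => ?_) fun w w' h _ => hg.1 h), M.push_id, M.res_id]
  obtain ⟨w, rfl⟩ := hg.2 x
  exact ⟨w, rfl, h⟩

/-- The additive monoid structure given by the folding maps. -/
noncomputable abbrev addCommMonoid (X : GSet G) : AddCommMonoid (M.obj X) where
  add := M.op
  zero := M.unit X
  add_assoc := M.op_assoc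
  zero_add := M.unit_op
  add_zero a := (M.op_comm _ _).trans (M.unit_op a)
  add_comm := M.op_comm
  nsmul := @nsmulRec _ ⟨M.unit X⟩ ⟨M.op⟩

end SemiMackey

/-- A semi-Tambara functor: restrictions, transfers and norms along all maps of finite `G`-sets, with
base change along cartesian squares, distributivity of norms over transfers along exponential
diagrams, and disjoint unions taken to products. -/
structure SemiTambaraFunctor (G : Type) [Group G] where
  obj : GSet G → Type u
  res : ∀ {X Y : GSet G}, (X →[G] Y) → obj Y → obj X
  tr : ∀ {X Y : GSet G}, (X →[G] Y) → obj X → obj Y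
  nm : ∀ {X Y : GSet G}, (X →[G] Y) → obj X → obj Y
  res_id : ∀ {X : GSet G} (a : obj X), res (MulActionHom.id G) a = a
  res_comp : ∀ {X Y Z : GSet G} (f : X →[G] Y) (g : Y →[G] Z) (a : obj Z),
    res (g.comp f) a = res f (res g a)
  tr_id : ∀ {X : GSet G} (a : obj X), tr (MulActionHom.id G) a = a
  tr_comp : ∀ {X Y Z : GSet G} (f : X →[G] Y) (g : Y →[G] Z) (a : obj X),
    tr (g.comp f) a = tr g (tr f a)
  nm_id : ∀ {X : GSet G} (a : obj X), nm (MulActionHom.id G) a = a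
  nm_comp : ∀ {X Y Z : GSet G} (f : X →[G] Y) (g : Y →[G] Z) (a : obj X),
    nm (g.comp f) a = nm g (nm f a)
  tr_res : ∀ {P X Y Z : GSet G} {u : P →[G] X} {v : P →[G] Y} {f : X →[G] Z} {g : Y →[G] Z},
    GSet.IsPullback u v f g → ∀ a : obj X, res g (tr f a) = tr v (res u a)
  nm_res : ∀ {P X Y Z : GSet G} {u : P →[G] X} {v : P →[G] Y} {f : X →[G] Z} {g : Y →[G] Z},
    GSet.IsPullback u v f g → ∀ a : obj X, res g (nm f a) = nm v (res u a)
  nm_tr : ∀ {A X Y P B : GSet G} {h : A →[G] X} {f : X →[G] Y}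
    {e : P →[G] A} {g : P →[G] B} {q : B →[G] Y},
    GSet.IsExp h f e g q → ∀ a : obj A, nm f (tr h a) = tr q (nm g (res e a))
  empty : ∀ X : GSet G, IsEmpty X → Nonempty (Unique (obj X))
  coprod : ∀ {X Y Z : GSet G} {i : X →[G] Z} {j : Y →[G] Z}, GSet.IsCoprod i j →
    Function.Bijective fun z : obj Z => (res i z, res j z)

namespace SemiTambaraFunctor

variable {G : Type} [Group G] (T : SemiTambaraFunctor.{u} G) {X Y Z W P : GSet G}

/-- Restrictions and transfers. -/
abbrev addPart : SemiMackey.{u} G where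
  obj := T.obj
  res := T.res
  push := T.tr
  res_id := T.res_id
  res_comp := T.res_comp
  push_id := T.tr_id
  push_comp := T.tr_comp
  push_res := T.tr_res
  empty := T.empty
  coprod := T.coprod

/-- Restrictions and norms. -/
abbrev mulPart : SemiMackey.{u} G where
  obj := T.obj
  res := T.res
  push := T.nm
  res_id := T.res_id
  res_comp := T.res_comp
  push_id := T.nm_id
  push_comp := T.nm_comp
  push_res := T.nm_res
  empty := T.empty
  coprod := T.coprod

theorem frobenius_aux (f : X →[G] Y) (b : T.obj Y) (a : T.obj X) :
    T.mulPart.op b (T.tr f a) = T.tr f (T.mulPart.op (T.res f b) a) := by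
  have K := GSet.isCoprod_sum (X := Y) (Y := X)
  have K' := GSet.isCoprod_sum (X := X) (Y := X)
  have K'' := GSet.isCoprod_sum (X := Y) (Y := Y)
  have h1 : T.mulPart.pair b (T.tr f a) =
      T.tr (GSet.elim (GSet.inl.comp (MulActionHom.id G)) (GSet.inr.comp f))
        (T.addPart.pair b a) := by
    have := T.addPart.push_pair (MulActionHom.id G) f b a
    rw [T.addPart.push_id] at this
    exact this.symm
  have H : GSet.IsExp (GSet.elim (GSet.inl.comp (MulActionHom.id G)) (GSet.inr.comp f))
      (GSet.fold Y) (GSet.elim (GSet.inl.comp f) (GSet.inr.comp (MulActionHom.id G)))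
      (GSet.fold X) f := by
    refine .mk' (.mk' (fun w => ?_) (fun x b hb => ?_) (fun w w' h1 h2 => ?_)) (fun y s hs => ?_)
      (fun b b' hq hb => ?_)
    · rcases K'.cases w with ⟨x, rfl⟩ | ⟨x, rfl⟩ <;> simp
    · rcases K''.cases x with ⟨x, rfl⟩ | ⟨x, rfl⟩
      · exact ⟨GSet.inl b, by simpa using congrArg _ hb.symm, by simp⟩
      · exact ⟨GSet.inr b, by simpa using congrArg _ hb.symm, by simp⟩
    · rcases K'.cases w with ⟨x, rfl⟩ | ⟨x, rfl⟩ <;> rcases K'.cases w' with ⟨x', rfl⟩ | ⟨x', rfl⟩ <;>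
        simp only [GSet.elim_inl, GSet.elim_inr, MulActionHom.comp_apply, GSet.fold_inl,
          GSet.fold_inr, MulActionHom.id_apply] at h1 h2
      · rw [h2]
      · exact (K''.ne h1).elim
      · exact (K''.ne h1.symm).elim
      · rw [h2]
    · have h2 := hs (GSet.inr y) (by simp)
      rcases K.cases (s (GSet.inr y) (by simp)) with ⟨x, hx⟩ | ⟨x, hx⟩
      · rw [← hx] at h2
        exact (K''.ne (by simpa using h2)).elim
      · have hxy : f x = y := by
          rw [← hx] at h2
          exact K''.inr_inj (by simpa using h2)
        refine ⟨x, hxy, fun z hz => ?_⟩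
        rcases K''.cases z with ⟨z, rfl⟩ | ⟨z, rfl⟩
        · obtain rfl : z = y := by simpa using hz
          refine ⟨GSet.inl x, by simp, ?_⟩
          have h3 := hs (GSet.inl z) (by simp)
          rcases K.cases (s (GSet.inl z) (by simp)) with ⟨x', hx'⟩ | ⟨x', hx'⟩
          · rw [← hx'] at h3 ⊢
            have : x' = z := K''.inl_inj (by simpa using h3)
            simp [hxy, this]
          · rw [← hx'] at h3
            exact (K''.ne (by simpa using h3.symm)).elim
        · obtain rfl : z = y := by simpa using hz
          exact ⟨GSet.inr x, by simp, by simpa using hx⟩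
    · have := hb (GSet.inr b) (GSet.inr b') (by simp) (by simp) (by simpa using congrArg _ hq)
      exact K.inr_inj (by simpa using this)
  have h2 : T.res (GSet.elim (GSet.inl.comp f) (GSet.inr.comp (MulActionHom.id G)))
      (T.addPart.pair b a) = T.mulPart.pair (T.res f b) a := by
    have := T.addPart.res_pair f (MulActionHom.id G) b a
    rw [T.addPart.res_id] at this
    exact this
  change T.nm _ _ = T.tr _ (T.nm _ _)
  rw [h1, T.nm_tr H, h2]

theorem distrib_aux (a b c : T.obj X) : T.mulPart.op a (T.addPart.op b c) =
    T.addPart.op (T.mulPart.op a b) (T.mulPart.op a c) := by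
  have K := GSet.isCoprod_sum (X := X) (Y := X)
  have h1 : (GSet.fold X).comp GSet.inl = MulActionHom.id G := MulActionHom.ext fun x => by simp
  have h2 : (GSet.fold X).comp GSet.inr = MulActionHom.id G := MulActionHom.ext fun x => by simp
  change T.mulPart.op a (T.tr (GSet.fold X) (T.addPart.pair b c)) = _
  rw [T.frobenius_aux]
  refine (T.addPart.push_eq_op K _ _).trans ?_
  rw [h1, h2, T.addPart.push_id, T.addPart.push_id]
  have e1 := T.mulPart.res_op GSet.inl (T.res (GSet.fold X) a) (T.addPart.pair b c)
  have e2 := T.mulPart.res_op GSet.inr (T.res (GSet.fold X) a) (T.addPart.pair b c)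
  have e3 := T.addPart.res_comp GSet.inl (GSet.fold X) a
  have e4 := T.addPart.res_comp GSet.inr (GSet.fold X) a
  rw [h1, T.addPart.res_id] at e3
  rw [h2, T.addPart.res_id] at e4
  have e5 := T.addPart.res_inl_pair b c
  have e6 := T.addPart.res_inr_pair b c
  exact congrArg₂ _ (e1.trans (congrArg₂ _ e3.symm e5)) (e2.trans (congrArg₂ _ e4.symm e6))

/-- The values of a semi-Tambara functor are commutative semirings: the sum of `a` and `b` is the
transfer, and their product is the norm, of `(a, b)` along the folding map `X ⊔ X → X`. -/
noncomputable instance commSemiring (X : GSet G) : CommSemiring (T.obj X) where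
  __ := T.addPart.addCommMonoid X
  mul := T.mulPart.op
  one := T.mulPart.unit X
  mul_assoc := T.mulPart.op_assoc
  one_mul := T.mulPart.unit_op
  mul_one a := (T.mulPart.op_comm _ _).trans (T.mulPart.unit_op a)
  mul_comm := T.mulPart.op_comm
  left_distrib := T.distrib_aux
  right_distrib a b c := by
    change T.mulPart.op (T.addPart.op a b) c =
      T.addPart.op (T.mulPart.op a c) (T.mulPart.op b c)
    rw [T.mulPart.op_comm, T.mulPart.op_comm a c, T.mulPart.op_comm b c, T.distrib_aux]
  zero_mul a := by
    change T.mulPart.op (T.tr _ _) a = T.tr _ _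
    rw [T.mulPart.op_comm, T.frobenius_aux]
    congr 1
    exact T.mulPart.subsingleton _ _
  mul_zero a := by
    change T.mulPart.op a (T.tr _ _) = T.tr _ _
    rw [T.frobenius_aux]
    congr 1
    exact T.mulPart.subsingleton _ _

theorem res_add (f : X →[G] Y) (a b : T.obj Y) : T.res f (a + b) = T.res f a + T.res f b :=
  T.addPart.res_op f a b

theorem res_zero (f : X →[G] Y) : T.res f 0 = 0 := T.addPart.res_unit f

theorem res_mul (f : X →[G] Y) (a b : T.obj Y) : T.res f (a * b) = T.res f a * T.res f b :=
  T.mulPart.res_op f a b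

theorem res_one (f : X →[G] Y) : T.res f 1 = 1 := T.mulPart.res_unit f

theorem tr_add (f : X →[G] Y) (a b : T.obj X) : T.tr f (a + b) = T.tr f a + T.tr f b :=
  T.addPart.push_op f a b

theorem tr_zero (f : X →[G] Y) : T.tr f 0 = 0 := T.addPart.push_unit f

theorem nm_mul (f : X →[G] Y) (a b : T.obj X) : T.nm f (a * b) = T.nm f a * T.nm f b :=
  T.mulPart.push_op f a b

theorem nm_one (f : X →[G] Y) : T.nm f 1 = 1 := T.mulPart.push_unit f

/-- Frobenius reciprocity. -/
theorem tr_res_mul (f : X →[G] Y) (b : T.obj Y) (a : T.obj X) :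
    T.tr f (T.res f b * a) = b * T.tr f a := (T.frobenius_aux f b a).symm

/-- The product of two semi-Tambara functors, formed levelwise. -/
def prod (S T : SemiTambaraFunctor.{u} G) : SemiTambaraFunctor.{u} G where
  obj X := S.obj X × T.obj X
  res f a := (S.res f a.1, T.res f a.2)
  tr f a := (S.tr f a.1, T.tr f a.2)
  nm f a := (S.nm f a.1, T.nm f a.2)
  res_id a := by simp [S.res_id, T.res_id]
  res_comp f g a := by simp [S.res_comp, T.res_comp]
  tr_id a := by simp [S.tr_id, T.tr_id]
  tr_comp f g a := by simp [S.tr_comp, T.tr_comp]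
  nm_id a := by simp [S.nm_id, T.nm_id]
  nm_comp f g a := by simp [S.nm_comp, T.nm_comp]
  tr_res H a := by simp [S.tr_res H, T.tr_res H]
  nm_res H a := by simp [S.nm_res H, T.nm_res H]
  nm_tr H a := by simp [S.nm_tr H, T.nm_tr H]
  empty X h := by
    obtain ⟨i⟩ := S.empty X h
    obtain ⟨j⟩ := T.empty X h
    exact ⟨⟨⟨(i.default, j.default)⟩, fun _ =>
      Prod.ext (S.addPart.subsingleton _ _) (T.addPart.subsingleton _ _)⟩⟩
  coprod H := by
    refine ⟨fun a b h => ?_, fun ⟨a, b⟩ => ?_⟩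
    · simp only [Prod.mk.injEq] at h
      exact Prod.ext (S.addPart.ext H h.1.1 h.2.1) (T.addPart.ext H h.1.2 h.2.2)
    · obtain ⟨x, hx⟩ := (S.coprod H).2 (a.1, b.1)
      obtain ⟨y, hy⟩ := (T.coprod H).2 (a.2, b.2)
      simp only [Prod.mk.injEq] at hx hy
      exact ⟨(x, y), by simp [hx, hy]⟩

theorem prod_pair (S T : SemiTambaraFunctor.{u} G) (a : (S.prod T).obj X) (b : (S.prod T).obj Y) :
    (S.prod T).addPart.pair a b = (S.addPart.pair a.1 b.1, T.addPart.pair a.2 b.2) := by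
  have h1 := (S.prod T).addPart.res_inl_pair a b
  have h2 := (S.prod T).addPart.res_inr_pair a b
  refine Prod.ext (S.addPart.ext GSet.isCoprod_sum ?_ ?_) (T.addPart.ext GSet.isCoprod_sum ?_ ?_)
  · rw [S.addPart.res_inl_pair]; exact congrArg Prod.fst h1
  · rw [S.addPart.res_inr_pair]; exact congrArg Prod.fst h2
  · rw [T.addPart.res_inl_pair]; exact congrArg Prod.snd h1
  · rw [T.addPart.res_inr_pair]; exact congrArg Prod.snd h2

theorem prod_add (S T : SemiTambaraFunctor.{u} G) (a b : (S.prod T).obj X) :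
    a + b = (a.1 + b.1, a.2 + b.2) :=
  congrArg ((S.prod T).tr (GSet.fold X)) (prod_pair S T a b)

theorem prod_zero (S T : SemiTambaraFunctor.{u} G) : (0 : (S.prod T).obj X) = (0, 0) :=
  Prod.ext (congrArg (S.tr (GSet.fromEmpty X)) (S.addPart.subsingleton _ _))
    (congrArg (T.tr (GSet.fromEmpty X)) (T.addPart.subsingleton _ _))

theorem prod_mul (S T : SemiTambaraFunctor.{u} G) (a b : (S.prod T).obj X) :
    a * b = (a.1 * b.1, a.2 * b.2) :=
  congrArg ((S.prod T).nm (GSet.fold X)) (prod_pair S T a b)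

theorem prod_one (S T : SemiTambaraFunctor.{u} G) : (1 : (S.prod T).obj X) = (1, 1) :=
  Prod.ext (congrArg (S.nm (GSet.fromEmpty X)) (S.addPart.subsingleton _ _))
    (congrArg (T.nm (GSet.fromEmpty X)) (T.addPart.subsingleton _ _))

/-- Every element of every value has an additive inverse. -/
def HasNeg (T : SemiTambaraFunctor.{u} G) : Prop :=
  ∀ (X : GSet G) (a : T.obj X), ∃ b, a + b = 0

end SemiTambaraFunctor

/-- A Tambara functor: a semi-Tambara functor in whose values every element has an additive
inverse. -/
structure TambaraFunctor (G : Type) [Group G] extends SemiTambaraFunctor.{u} G where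
  hasNeg : toSemiTambaraFunctor.HasNeg

namespace TambaraFunctor

variable {G : Type} [Group G] (T : TambaraFunctor.{u} G) {X Y Z W P : GSet G}

noncomputable instance commRing (X : GSet G) : CommRing (T.obj X) where
  __ := T.toSemiTambaraFunctor.commSemiring X
  neg a := (T.hasNeg X a).choose
  zsmul := @zsmulRec _ ⟨0⟩ ⟨(· + ·)⟩ ⟨fun a => (T.hasNeg X a).choose⟩
    (@nsmulRec _ ⟨0⟩ ⟨(· + ·)⟩)
  neg_add_cancel a := (add_comm _ a).trans (T.hasNeg X a).choose_spec

/-- A morphism of Tambara functors: maps compatible with restrictions, transfers and norms. They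
are ring homomorphisms by `Hom.map_add`, `Hom.map_zero`, `Hom.map_mul`, `Hom.map_one`. -/
@[ext] structure Hom (S T : TambaraFunctor.{u} G) where
  app : ∀ X : GSet G, S.obj X → T.obj X
  map_res : ∀ {X Y : GSet G} (f : X →[G] Y) (a : S.obj Y), app X (S.res f a) = T.res f (app Y a)
  map_tr : ∀ {X Y : GSet G} (f : X →[G] Y) (a : S.obj X), app Y (S.tr f a) = T.tr f (app X a)
  map_nm : ∀ {X Y : GSet G} (f : X →[G] Y) (a : S.obj X), app Y (S.nm f a) = T.nm f (app X a)

namespace Hom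

variable {R S T : TambaraFunctor.{u} G} (φ : Hom S T)

theorem map_pair (a : S.obj X) (b : S.obj Y) :
    φ.app _ (S.addPart.pair a b) = T.addPart.pair (φ.app X a) (φ.app Y b) := by
  refine T.addPart.ext GSet.isCoprod_sum ?_ ?_
  · rw [T.addPart.res_inl_pair]
    change T.res _ _ = _
    rw [← φ.map_res]
    exact congrArg _ (S.addPart.res_inl_pair a b)
  · rw [T.addPart.res_inr_pair]
    change T.res _ _ = _
    rw [← φ.map_res]
    exact congrArg _ (S.addPart.res_inr_pair a b)

theorem map_add (a b : S.obj X) : φ.app X (a + b) = φ.app X a + φ.app X b :=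
  (φ.map_tr _ _).trans (congrArg _ (φ.map_pair a b))

theorem map_mul (a b : S.obj X) : φ.app X (a * b) = φ.app X a * φ.app X b :=
  (φ.map_nm _ _).trans (congrArg _ (φ.map_pair a b))

theorem map_zero : φ.app X 0 = 0 :=
  (φ.map_tr _ _).trans (congrArg _ (T.addPart.subsingleton _ _))

theorem map_one : φ.app X 1 = 1 :=
  (φ.map_nm _ _).trans (congrArg _ (T.addPart.subsingleton _ _))

/-- The ring homomorphism at level `X`. -/
def ringHom (X : GSet G) : S.obj X →+* T.obj X where
  toFun := φ.app X
  map_one' := φ.map_one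
  map_mul' := φ.map_mul
  map_zero' := φ.map_zero
  map_add' := φ.map_add

/-- Composition of morphisms. -/
def comp (ψ : Hom S T) (φ : Hom R S) : Hom R T where
  app X a := ψ.app X (φ.app X a)
  map_res f a := by rw [φ.map_res, ψ.map_res]
  map_tr f a := by rw [φ.map_tr, ψ.map_tr]
  map_nm f a := by rw [φ.map_nm, ψ.map_nm]

end Hom

/-- The product of two Tambara functors, formed levelwise. -/
def prod (S T : TambaraFunctor.{u} G) : TambaraFunctor.{u} G where
  __ := S.toSemiTambaraFunctor.prod T.toSemiTambaraFunctor
  hasNeg X a := by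
    obtain ⟨b, hb⟩ := S.hasNeg X a.1
    obtain ⟨c, hc⟩ := T.hasNeg X a.2
    exact ⟨(b, c), (SemiTambaraFunctor.prod_add _ _ a (b, c)).trans
      ((Prod.ext hb hc).trans (SemiTambaraFunctor.prod_zero _ _).symm)⟩

end TambaraFunctor

/-- A module over a Tambara functor `k`, that is, over its underlying Green functor: a Mackey
functor whose values are modules over the values of `k`, compatibly with restrictions and subject to
Frobenius reciprocity. -/
structure TambaraModule {G : Type} [Group G] (k : TambaraFunctor.{u} G) where
  obj : GSet G → Type u
  [addCommGroup : ∀ X, AddCommGroup (obj X)]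
  [module : ∀ X, Module (k.obj X) (obj X)]
  res : ∀ {X Y : GSet G}, (X →[G] Y) → obj Y →+ obj X
  tr : ∀ {X Y : GSet G}, (X →[G] Y) → obj X →+ obj Y
  res_id : ∀ {X : GSet G} (a : obj X), res (MulActionHom.id G) a = a
  res_comp : ∀ {X Y Z : GSet G} (f : X →[G] Y) (g : Y →[G] Z) (a : obj Z),
    res (g.comp f) a = res f (res g a)
  tr_id : ∀ {X : GSet G} (a : obj X), tr (MulActionHom.id G) a = a
  tr_comp : ∀ {X Y Z : GSet G} (f : X →[G] Y) (g : Y →[G] Z) (a : obj X),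
    tr (g.comp f) a = tr g (tr f a)
  tr_res : ∀ {P X Y Z : GSet G} {u : P →[G] X} {v : P →[G] Y} {f : X →[G] Z} {g : Y →[G] Z},
    GSet.IsPullback u v f g → ∀ a : obj X, res g (tr f a) = tr v (res u a)
  empty : ∀ X : GSet G, IsEmpty X → Nonempty (Unique (obj X))
  coprod : ∀ {X Y Z : GSet G} {i : X →[G] Z} {j : Y →[G] Z}, GSet.IsCoprod i j →
    Function.Bijective fun z : obj Z => (res i z, res j z)
  res_smul : ∀ {X Y : GSet G} (f : X →[G] Y) (a : k.obj Y) (m : obj Y),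
    res f (a • m) = k.res f a • res f m
  tr_res_smul : ∀ {X Y : GSet G} (f : X →[G] Y) (a : k.obj Y) (m : obj X),
    tr f (k.res f a • m) = a • tr f m
  tr_smul_res : ∀ {X Y : GSet G} (f : X →[G] Y) (a : k.obj X) (m : obj Y),
    tr f (a • res f m) = k.tr f a • m

/-- An algebra over a Tambara functor `k`: a Tambara functor with a morphism from `k`. -/
structure TambaraAlgebra {G : Type} [Group G] (k : TambaraFunctor.{u} G) extends
    TambaraFunctor.{u} G where
  unit : TambaraFunctor.Hom k toTambaraFunctor

namespace TambaraModule

variable {G : Type} [Group G] {k : TambaraFunctor.{u} G}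

instance (M : TambaraModule k) (X : GSet G) : AddCommGroup (M.obj X) := M.addCommGroup X
instance (M : TambaraModule k) (X : GSet G) : Module (k.obj X) (M.obj X) := M.module X

/-- The underlying restrictions and transfers. -/
abbrev toSemiMackey (M : TambaraModule k) : SemiMackey.{u} G where
  obj := M.obj
  res f := M.res f
  push f := M.tr f
  res_id := M.res_id
  res_comp := M.res_comp
  push_id := M.tr_id
  push_comp := M.tr_comp
  push_res := M.tr_res
  empty := M.empty
  coprod := M.coprod

/-- A morphism of modules. -/
structure Hom (M N : TambaraModule k) where
  app : ∀ X : GSet G, M.obj X →ₗ[k.obj X] N.obj X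
  map_res : ∀ {X Y : GSet G} (f : X →[G] Y) (a : M.obj Y), app X (M.res f a) = N.res f (app Y a)
  map_tr : ∀ {X Y : GSet G} (f : X →[G] Y) (a : M.obj X), app Y (M.tr f a) = N.tr f (app X a)

/-- The sequence `0 → A → B → C → 0` is exact. Kernels and images of morphisms of modules are
formed levelwise, so this is a levelwise condition. -/
def ShortExact {A B C : TambaraModule k} (f : Hom A B) (g : Hom B C) : Prop :=
  ∀ X : GSet G, Function.Injective (f.app X) ∧ Function.Exact (f.app X) (g.app X) ∧
    Function.Surjective (g.app X)

/-- The sum of two elements is the transfer of the pair along the folding map. -/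
theorem add_eq_op (M : TambaraModule k) {X : GSet G} (a b : M.obj X) :
    a + b = M.toSemiMackey.op a b := by
  have K := GSet.isCoprod_sum (X := X) (Y := X)
  have hl : ∀ a : M.obj X, M.res GSet.inl (M.tr (GSet.inl (X := X) (Y := X)) a) = a := fun a => by
    rw [M.tr_res (u := MulActionHom.id G) (v := MulActionHom.id G)
      (.mk' (fun _ => rfl) (fun x y h => ⟨x, rfl, K.inl_inj h⟩) fun w w' h _ => h), M.res_id, M.tr_id]
  have hr : ∀ a : M.obj X, M.res GSet.inr (M.tr (GSet.inr (X := X) (Y := X)) a) = a := fun a => by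
    rw [M.tr_res (u := MulActionHom.id G) (v := MulActionHom.id G)
      (.mk' (fun _ => rfl) (fun x y h => ⟨x, rfl, K.inr_inj h⟩) fun w w' h _ => h), M.res_id, M.tr_id]
  have hrl : ∀ a : M.obj X, M.res GSet.inr (M.tr (GSet.inl (X := X) (Y := X)) a) = 0 := fun a => by
    rw [M.tr_res (u := GSet.fromEmpty X) (v := GSet.fromEmpty X)
      (.mk' (fun w => isEmptyElim w) (fun x y h => (K.ne h).elim) fun w => isEmptyElim w)]
    rw [M.toSemiMackey.subsingleton (X := GSet.empty G) (M.res (GSet.fromEmpty X) a) 0, map_zero]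
  have hlr : ∀ a : M.obj X, M.res GSet.inl (M.tr (GSet.inr (X := X) (Y := X)) a) = 0 := fun a => by
    rw [M.tr_res (u := GSet.fromEmpty X) (v := GSet.fromEmpty X)
      (.mk' (fun w => isEmptyElim w) (fun x y h => (K.ne h.symm).elim) fun w => isEmptyElim w)]
    rw [M.toSemiMackey.subsingleton (X := GSet.empty G) (M.res (GSet.fromEmpty X) a) 0, map_zero]
  have h : M.toSemiMackey.pair a b = M.tr GSet.inl a + M.tr GSet.inr b := by
    refine M.toSemiMackey.ext K ?_ ?_
    · rw [M.toSemiMackey.res_inl_pair]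
      change _ = M.res _ _
      rw [map_add, hl, hlr, add_zero]
    · rw [M.toSemiMackey.res_inr_pair]
      change _ = M.res _ _
      rw [map_add, hr, hrl, zero_add]
  change _ = M.tr _ _
  rw [h, map_add]
  congr 1
  · exact (M.toSemiMackey.push_comp' (h := MulActionHom.id G) (by simp) a).trans (M.tr_id a) |>.symm
  · exact (M.toSemiMackey.push_comp' (h := MulActionHom.id G) (by simp) b).trans (M.tr_id b) |>.symm

theorem pair_smul (M : TambaraModule k) {X Y : GSet G} (a : k.obj X) (b : k.obj Y) (m : M.obj X)
    (n : M.obj Y) : M.toSemiMackey.pair (a • m) (b • n) =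
      k.addPart.pair a b • M.toSemiMackey.pair m n := by
  refine M.toSemiMackey.ext GSet.isCoprod_sum ?_ ?_
  · rw [M.toSemiMackey.res_inl_pair]
    refine (M.res_smul _ _ _).trans ?_ |>.symm
    exact congrArg₂ _ (k.addPart.res_inl_pair a b) (M.toSemiMackey.res_inl_pair m n)
  · rw [M.toSemiMackey.res_inr_pair]
    refine (M.res_smul _ _ _).trans ?_ |>.symm
    exact congrArg₂ _ (k.addPart.res_inr_pair a b) (M.toSemiMackey.res_inr_pair m n)

/-! ### The relative box product -/

/-- A symbol `[Y → X, m ⊗ n]` with `m ∈ M(Y)` and `n ∈ N(Y)`. -/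
structure BoxSymbol (M N : TambaraModule k) (X : GSet G) where
  space : GSet G
  map : space →[G] X
  left : M.obj space
  right : N.obj space

/-- The relations between symbols: Frobenius reciprocity in both variables, and `k`-balancedness. -/
inductive BoxRel (M N : TambaraModule k) (X : GSet G) : BoxSymbol M N X → BoxSymbol M N X → Prop
  | left {Y Y' : GSet G} (g : Y →[G] Y') (p : Y' →[G] X) (m : M.obj Y) (n : N.obj Y') :
      BoxRel M N X ⟨Y', p, M.tr g m, n⟩ ⟨Y, p.comp g, m, N.res g n⟩
  | right {Y Y' : GSet G} (g : Y →[G] Y') (p : Y' →[G] X) (m : M.obj Y') (n : N.obj Y) :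
      BoxRel M N X ⟨Y', p, m, N.tr g n⟩ ⟨Y, p.comp g, M.res g m, n⟩
  | smul {Y : GSet G} (p : Y →[G] X) (a : k.obj Y) (m : M.obj Y) (n : N.obj Y) :
      BoxRel M N X ⟨Y, p, a • m, n⟩ ⟨Y, p, m, a • n⟩

/-- The value at `X` of the relative box product `M ⊠_k N`, that is, of the coend of
`M(Y) ⊗_{k(Y)} N(Y)` over all `Y → X`. Every element is represented by a single symbol, as a sum of
symbols is the symbol of a disjoint union; the relations imply that symbols are biadditive
(`mk_add_left`, `mk_add_right`). -/
def BoxObj (M N : TambaraModule k) (X : GSet G) : Type u := Quot (BoxRel M N X)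

section Box

variable {M N : TambaraModule k} {X Y Z W P : GSet G}

/-- The class of the symbol `[p : Y → X, m ⊗ n]`. -/
def boxMk (p : Y →[G] X) (m : M.obj Y) (n : N.obj Y) : BoxObj M N X := Quot.mk _ ⟨Y, p, m, n⟩

theorem boxMk_congr {p p' : Y →[G] X} (h : ∀ y, p y = p' y) (m : M.obj Y) (n : N.obj Y) :
    boxMk p m n = boxMk p' m n := by rw [MulActionHom.ext h]

theorem box_ind {C : BoxObj M N X → Prop}
    (h : ∀ (Y : GSet G) (p : Y →[G] X) (m : M.obj Y) (n : N.obj Y), C (boxMk p m n)) (z) : C z :=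
  Quot.ind (fun s => h s.space s.map s.left s.right) z

theorem boxMk_tr_left {q : Y →[G] X} (g : Y →[G] W) (p : W →[G] X) (H : ∀ y, p (g y) = q y)
    (m : M.obj Y) (n : N.obj W) : boxMk p (M.tr g m) n = boxMk q m (N.res g n) := by
  rw [show q = p.comp g from MulActionHom.ext fun y => (H y).symm]
  exact Quot.sound (.left g p m n)

theorem boxMk_tr_right {q : Y →[G] X} (g : Y →[G] W) (p : W →[G] X) (H : ∀ y, p (g y) = q y)
    (m : M.obj W) (n : N.obj Y) : boxMk p m (N.tr g n) = boxMk q (M.res g m) n := by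
  rw [show q = p.comp g from MulActionHom.ext fun y => (H y).symm]
  exact Quot.sound (.right g p m n)

theorem boxMk_smul (p : Y →[G] X) (a : k.obj Y) (m : M.obj Y) (n : N.obj Y) :
    boxMk p (a • m) n = boxMk p m (a • n) := Quot.sound (.smul p a m n)

/-- Functions out of the box product. -/
def boxLift {γ : Type*} (F : ∀ (Y : GSet G), (Y →[G] X) → M.obj Y → N.obj Y → γ)
    (hl : ∀ {Y Y' : GSet G} (g : Y →[G] Y') (p : Y' →[G] X) (m : M.obj Y) (n : N.obj Y'),
      F Y' p (M.tr g m) n = F Y (p.comp g) m (N.res g n))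
    (hr : ∀ {Y Y' : GSet G} (g : Y →[G] Y') (p : Y' →[G] X) (m : M.obj Y') (n : N.obj Y),
      F Y' p m (N.tr g n) = F Y (p.comp g) (M.res g m) n)
    (hs : ∀ {Y : GSet G} (p : Y →[G] X) (a : k.obj Y) (m : M.obj Y) (n : N.obj Y),
      F Y p (a • m) n = F Y p m (a • n)) : BoxObj M N X → γ :=
  Quot.lift (fun s => F s.space s.map s.left s.right) (by
    rintro _ _ (⟨g, p, m, n⟩ | ⟨g, p, m, n⟩ | ⟨p, a, m, n⟩)
    exacts [hl g p m n, hr g p m n, hs p a m n])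

theorem boxMk_bij {q : Y →[G] X} (g : Y →[G] W) (hg : Function.Bijective g) (p : W →[G] X)
    (H : ∀ y, p (g y) = q y) (m : M.obj W) (n : N.obj W) :
    boxMk p m n = boxMk q (M.res g m) (N.res g n) := by
  rw [← boxMk_tr_left g p H]
  congr 1
  exact (M.toSemiMackey.push_res_bij g hg m).symm

theorem boxMk_pullback {P' : GSet G} {u : P →[G] Y} {v : P →[G] Z} {p : Y →[G] X} {f : Z →[G] X}
    (H : GSet.IsPullback u v p f) {u' : P' →[G] Y} {v' : P' →[G] Z} (H' : GSet.IsPullback u' v' p f)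
    (m : M.obj Y) (n : N.obj Y) :
    boxMk v (M.res u m) (N.res u n) = boxMk v' (M.res u' m) (N.res u' n) := by
  obtain ⟨c, h1, h2⟩ := H.exists_lift u' v' H'.1
  have hc : Function.Bijective c := by
    refine ⟨fun x y h => H'.ext ?_ ?_, fun x => ?_⟩
    · rw [← h1, ← h1, h]
    · rw [← h2, ← h2, h]
    · obtain ⟨w, h3, h4⟩ := H'.exists (H.1 x)
      exact ⟨w, H.ext (by rw [h1, h3]) (by rw [h2, h4])⟩
  rw [boxMk_bij c hc v h2]
  congr 1
  · exact M.toSemiMackey.res_comp' h1 m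
  · exact N.toSemiMackey.res_comp' h1 n

/-- Transfers of the box product. -/
def boxTr (f : X →[G] Z) : BoxObj M N X → BoxObj M N Z :=
  boxLift (fun _ p m n => boxMk (f.comp p) m n)
    (fun g p m n => boxMk_tr_left g (f.comp p) (fun _ => rfl) m n)
    (fun g p m n => boxMk_tr_right g (f.comp p) (fun _ => rfl) m n)
    (fun p a m n => boxMk_smul (f.comp p) a m n)

@[simp] theorem boxTr_mk (f : X →[G] Z) (p : Y →[G] X) (m : M.obj Y) (n : N.obj Y) :
    boxTr f (boxMk p m n) = boxMk (f.comp p) m n := rfl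

/-- Restrictions of symbols of the box product, along a chosen fibre product. -/
noncomputable def boxResSymbol (f : Z →[G] X) {Y : GSet G} (p : Y →[G] X) (m : M.obj Y)
    (n : N.obj Y) : BoxObj M N Z :=
  boxMk (GSet.exists_isPullback p f).choose_spec.choose_spec.choose
    (M.res (GSet.exists_isPullback p f).choose_spec.choose m)
    (N.res (GSet.exists_isPullback p f).choose_spec.choose n)

theorem boxResSymbol_eq {u : P →[G] Y} {v : P →[G] Z} {p : Y →[G] X} {f : Z →[G] X}
    (H : GSet.IsPullback u v p f) (m : M.obj Y) (n : N.obj Y) :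
    boxResSymbol f p m n = boxMk v (M.res u m) (N.res u n) :=
  boxMk_pullback (GSet.exists_isPullback p f).choose_spec.choose_spec.choose_spec H m n

/-- Restrictions of the box product: `[Y → X, m ⊗ n]` is sent to the symbol of the fibre product
of `Y` with `Z` over `X`, see `boxRes_mk`. -/
noncomputable def boxRes (f : Z →[G] X) : BoxObj M N X → BoxObj M N Z :=
  boxLift (fun _ p m n => boxResSymbol f p m n)
    (fun g p m n => by
      obtain ⟨P, u, v, H⟩ := GSet.exists_isPullback p f
      obtain ⟨Q, a, b, H'⟩ := GSet.exists_isPullback g u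
      rw [boxResSymbol_eq H, boxResSymbol_eq (H.paste H'), M.tr_res H',
        boxMk_tr_left b v (q := v.comp b) (fun _ => rfl)]
      congr 1
      exact (N.toSemiMackey.res_comp' (fun x => (H'.1 x).symm) n).trans (N.res_comp a g n))
    (fun g p m n => by
      obtain ⟨P, u, v, H⟩ := GSet.exists_isPullback p f
      obtain ⟨Q, a, b, H'⟩ := GSet.exists_isPullback g u
      rw [boxResSymbol_eq H, boxResSymbol_eq (H.paste H'), N.tr_res H',
        boxMk_tr_right b v (q := v.comp b) (fun _ => rfl)]
      congr 1
      exact (M.toSemiMackey.res_comp' (fun x => (H'.1 x).symm) m).trans (M.res_comp a g m))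
    (fun p a m n => by
      obtain ⟨P, u, v, H⟩ := GSet.exists_isPullback p f
      rw [boxResSymbol_eq H, boxResSymbol_eq H, M.res_smul, N.res_smul, boxMk_smul])

theorem boxRes_mk {u : P →[G] Y} {v : P →[G] Z} {p : Y →[G] X} {f : Z →[G] X}
    (H : GSet.IsPullback u v p f) (m : M.obj Y) (n : N.obj Y) :
    boxRes f (boxMk p m n) = boxMk v (M.res u m) (N.res u n) := boxResSymbol_eq H m n

theorem boxMk_pair_left {X₁ X₂ Y₁ Y₂ : GSet G} (f : X₁ →[G] Y₁) (g : X₂ →[G] Y₂)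
    (p : Y₁ →[G] X) (q : Y₂ →[G] X) (m : M.obj X₁) (m' : M.obj X₂) (n : N.obj Y₁) (n' : N.obj Y₂) :
    boxMk (GSet.elim p q) (M.toSemiMackey.pair (M.tr f m) (M.tr g m')) (N.toSemiMackey.pair n n') =
    boxMk (GSet.elim (p.comp f) (q.comp g)) (M.toSemiMackey.pair m m')
      (N.toSemiMackey.pair (N.res f n) (N.res g n')) := by
  rw [← M.toSemiMackey.push_pair, ← N.toSemiMackey.res_pair]
  refine boxMk_tr_left _ _ (fun y => ?_) _ _
  rcases GSet.isCoprod_sum.cases y with ⟨x, rfl⟩ | ⟨x, rfl⟩ <;> simp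

theorem boxMk_pair_right {X₁ X₂ Y₁ Y₂ : GSet G} (f : X₁ →[G] Y₁) (g : X₂ →[G] Y₂)
    (p : Y₁ →[G] X) (q : Y₂ →[G] X) (m : M.obj Y₁) (m' : M.obj Y₂) (n : N.obj X₁) (n' : N.obj X₂) :
    boxMk (GSet.elim p q) (M.toSemiMackey.pair m m') (N.toSemiMackey.pair (N.tr f n) (N.tr g n')) =
    boxMk (GSet.elim (p.comp f) (q.comp g))
      (M.toSemiMackey.pair (M.res f m) (M.res g m')) (N.toSemiMackey.pair n n') := by
  rw [← N.toSemiMackey.push_pair, ← M.toSemiMackey.res_pair]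
  refine boxMk_tr_right _ _ (fun y => ?_) _ _
  rcases GSet.isCoprod_sum.cases y with ⟨x, rfl⟩ | ⟨x, rfl⟩ <;> simp

theorem boxMk_pair_smul {Y₁ Y₂ : GSet G} (p : Y₁ →[G] X) (q : Y₂ →[G] X) (a : k.obj Y₁)
    (b : k.obj Y₂) (m : M.obj Y₁) (m' : M.obj Y₂) (n : N.obj Y₁) (n' : N.obj Y₂) :
    boxMk (GSet.elim p q) (M.toSemiMackey.pair (a • m) (b • m')) (N.toSemiMackey.pair n n') =
    boxMk (GSet.elim p q) (M.toSemiMackey.pair m m')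
      (N.toSemiMackey.pair (a • n) (b • n')) := by
  rw [pair_smul, pair_smul, boxMk_smul]

/-- The element with given restrictions to the two parts of a disjoint union. -/
noncomputable def boxGlue (i : X →[G] Z) (j : Y →[G] Z) (x : BoxObj M N X) (y : BoxObj M N Y) :
    BoxObj M N Z :=
  boxLift (fun _ p m n => boxLift (fun _ q m' n' => boxMk (GSet.elim (i.comp p) (j.comp q))
      (M.toSemiMackey.pair m m') (N.toSemiMackey.pair n n'))
    (fun g q m' n' => by
      have h := boxMk_pair_left (MulActionHom.id G) g (i.comp p) (j.comp q) m m' n n'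
      rw [M.tr_id, N.res_id] at h
      exact h)
    (fun g q m' n' => by
      have h := boxMk_pair_right (MulActionHom.id G) g (i.comp p) (j.comp q) m m' n n'
      rw [N.tr_id, M.res_id] at h
      exact h)
    (fun q a m' n' => by
      simpa only [one_smul] using boxMk_pair_smul (i.comp p) (j.comp q) 1 a m m' n n') y)
    (fun g p m n => by
      revert y
      refine box_ind fun _ q m' n' => ?_
      have h := boxMk_pair_left g (MulActionHom.id G) (i.comp p) (j.comp q) m m' n n'
      rw [M.tr_id, N.res_id] at h
      exact h)
    (fun g p m n => by
      revert y
      refine box_ind fun _ q m' n' => ?_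
      have h := boxMk_pair_right g (MulActionHom.id G) (i.comp p) (j.comp q) m m' n n'
      rw [N.tr_id, M.res_id] at h
      exact h)
    (fun p a m n => by
      revert y
      refine box_ind fun _ q m' n' => ?_
      have h := boxMk_pair_smul (i.comp p) (j.comp q) a 1 m m' n n'
      rw [one_smul, one_smul] at h
      exact h) x

theorem boxGlue_mk {A B : GSet G} (i : X →[G] Z) (j : Y →[G] Z) (p : A →[G] X) (q : B →[G] Y)
    (m : M.obj A) (m' : M.obj B) (n : N.obj A) (n' : N.obj B) :
    boxGlue i j (boxMk p m n) (boxMk q m' n') = boxMk (GSet.elim (i.comp p) (j.comp q))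
      (M.toSemiMackey.pair m m') (N.toSemiMackey.pair n n') := rfl

theorem boxCoprod {i : X →[G] Z} {j : Y →[G] Z} (H : GSet.IsCoprod i j) :
    Function.Bijective fun z : BoxObj M N Z => (boxRes i z, boxRes j z) := by
  constructor
  · have key : ∀ z : BoxObj M N Z, boxGlue i j (boxRes i z) (boxRes j z) = z := by
      refine box_ind fun A p m n => ?_
      obtain ⟨P, u, v, H1⟩ := GSet.exists_isPullback p i
      obtain ⟨Q, a, b, H2⟩ := GSet.exists_isPullback p j
      rw [boxRes_mk H1, boxRes_mk H2, boxGlue_mk]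
      let c : P.sum Q →[G] A := GSet.elim u a
      have K := GSet.isCoprod_sum (X := P) (Y := Q)
      have hc : Function.Bijective c := by
        constructor
        · intro x y h
          rcases K.cases x with ⟨x, rfl⟩ | ⟨x, rfl⟩ <;> rcases K.cases y with ⟨y, rfl⟩ | ⟨y, rfl⟩ <;>
            simp only [c, GSet.elim_inl, GSet.elim_inr] at h
          · exact congrArg _ (H1.ext h (H.inl_inj (by rw [← H1.1, ← H1.1, h])))
          · exact (H.ne (by rw [← H1.1, ← H2.1, h])).elim
          · exact (H.ne (by rw [← H1.1, ← H2.1, h])).elim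
          · exact congrArg _ (H2.ext h (H.inr_inj (by rw [← H2.1, ← H2.1, h])))
        · intro x
          rcases H.cases (p x) with ⟨y, hy⟩ | ⟨y, hy⟩
          · obtain ⟨w, hw, -⟩ := H1.exists hy.symm
            exact ⟨GSet.inl w, by simp [c, hw]⟩
          · obtain ⟨w, hw, -⟩ := H2.exists hy.symm
            exact ⟨GSet.inr w, by simp [c, hw]⟩
      rw [boxMk_bij c hc p (q := GSet.elim (i.comp v) (j.comp b)) fun y => by
        rcases K.cases y with ⟨x, rfl⟩ | ⟨x, rfl⟩ <;> simp [c, H1.1, H2.1]]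
      congr 1
      · refine M.toSemiMackey.ext K ?_ ?_
        · rw [M.toSemiMackey.res_inl_pair]
          exact (M.toSemiMackey.res_comp' (by simp [c]) m).symm
        · rw [M.toSemiMackey.res_inr_pair]
          exact (M.toSemiMackey.res_comp' (by simp [c]) m).symm
      · refine N.toSemiMackey.ext K ?_ ?_
        · rw [N.toSemiMackey.res_inl_pair]
          exact (N.toSemiMackey.res_comp' (by simp [c]) n).symm
        · rw [N.toSemiMackey.res_inr_pair]
          exact (N.toSemiMackey.res_comp' (by simp [c]) n).symm
    intro z z' h
    simp only [Prod.mk.injEq] at h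
    rw [← key z, ← key z', h.1, h.2]
  · rintro ⟨x, y⟩
    refine ⟨boxGlue i j x y, ?_⟩
    revert y
    revert x
    refine box_ind fun A p m n => box_ind fun B q m' n' => ?_
    have K := GSet.isCoprod_sum (X := A) (Y := B)
    have H1 : GSet.IsPullback GSet.inl p (GSet.elim (i.comp p) (j.comp q)) i := by
      refine .mk' (by simp) (fun x y h => ?_) fun w w' h _ => K.inl_inj h
      rcases K.cases x with ⟨x, rfl⟩ | ⟨x, rfl⟩
      · exact ⟨x, rfl, H.inl_inj (by simpa using h)⟩
      · exact (H.ne (by simpa using h.symm)).elim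
    have H2 : GSet.IsPullback GSet.inr q (GSet.elim (i.comp p) (j.comp q)) j := by
      refine .mk' (by simp) (fun x y h => ?_) fun w w' h _ => K.inr_inj h
      rcases K.cases x with ⟨x, rfl⟩ | ⟨x, rfl⟩
      · exact (H.ne (by simpa using h)).elim
      · exact ⟨x, rfl, H.inr_inj (by simpa using h)⟩
    change (boxRes _ (boxGlue _ _ _ _), boxRes _ (boxGlue _ _ _ _)) = _
    rw [boxGlue_mk, boxRes_mk H1, boxRes_mk H2]
    refine Prod.ext ?_ ?_
    · exact congrArg₂ (boxMk p) (M.toSemiMackey.res_inl_pair m m') (N.toSemiMackey.res_inl_pair n n')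
    · exact congrArg₂ (boxMk q) (M.toSemiMackey.res_inr_pair m m') (N.toSemiMackey.res_inr_pair n n')

end Box

/-- The relative box product `M ⊠_k N` with its restrictions and transfers. -/
noncomputable abbrev box (M N : TambaraModule k) : SemiMackey.{u} G where
  obj := BoxObj M N
  res := boxRes
  push := boxTr
  res_id := box_ind fun Y p m n => by
    rw [boxRes_mk (u := MulActionHom.id G) (v := p)
      (.mk' (fun _ => rfl) (fun x y h => ⟨x, rfl, h⟩) fun w w' h _ => h), M.res_id, N.res_id]
  res_comp f g := box_ind fun Y p m n => by
    obtain ⟨P, u, v, H⟩ := GSet.exists_isPullback p g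
    obtain ⟨Q, a, b, H'⟩ := GSet.exists_isPullback v f
    rw [boxRes_mk H, boxRes_mk H', ← M.res_comp, ← N.res_comp, boxRes_mk (H.symm.paste H'.symm).symm]
  push_id := box_ind fun Y p m n => rfl
  push_comp f g := box_ind fun Y p m n => rfl
  push_res H := box_ind fun Y p m n => by
    obtain ⟨P, u, v, H'⟩ := GSet.exists_isPullback p _
    rw [boxRes_mk H', boxTr_mk, boxTr_mk, boxRes_mk (H.paste H')]
  empty X h := by
    refine ⟨⟨⟨boxMk (MulActionHom.id G) 0 0⟩, box_ind fun Y p m n => ?_⟩⟩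
    have hY : IsEmpty Y := ⟨fun y => h.false (p y)⟩
    change boxMk p m n = boxMk (MulActionHom.id G) 0 0
    rw [boxMk_bij p ⟨fun x => isEmptyElim x, fun x => isEmptyElim x⟩ (MulActionHom.id G)
      (fun _ => rfl)]
    congr 1
    · exact M.toSemiMackey.subsingleton _ _
    · exact N.toSemiMackey.subsingleton _ _
  coprod := boxCoprod

section BoxGroup

variable {M N : TambaraModule k} {X Y : GSet G}

theorem box_push (f : X →[G] Y) (z : BoxObj M N X) : (box M N).push f z = boxTr f z := rfl

theorem box_res (f : X →[G] Y) (z : BoxObj M N Y) : (box M N).res f z = boxRes f z := rfl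

theorem mk_add_left (p : Y →[G] X) (m m' : M.obj Y) (n : N.obj Y) :
    boxMk p (m + m') n = (box M N).op (boxMk p m n) (boxMk p m' n) := by
  have K := GSet.isCoprod_sum (X := Y) (Y := Y)
  rw [M.add_eq_op]
  change boxMk p (M.tr _ _) n = _
  rw [boxMk_tr_left (q := p.comp (GSet.fold Y)) (GSet.fold Y) p (fun _ => rfl)]
  change (box M N).push (p.comp (GSet.fold Y)) (boxMk (MulActionHom.id G) _ _) = _
  have hi : GSet.IsPullback (GSet.inl (X := Y) (Y := Y)) (MulActionHom.id G)
      (MulActionHom.id G) GSet.inl := .mk' (fun _ => rfl) (fun x y h => ⟨y, h.symm, rfl⟩)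
      fun w w' _ h => h
  have hj : GSet.IsPullback (GSet.inr (X := Y) (Y := Y)) (MulActionHom.id G)
      (MulActionHom.id G) GSet.inr := .mk' (fun _ => rfl) (fun x y h => ⟨y, h.symm, rfl⟩)
      fun w w' _ h => h
  rw [(box M N).push_eq_op K]
  rw [box_push, box_push, box_res, box_res, boxRes_mk hi, boxRes_mk hj, boxTr_mk, boxTr_mk]
  have e1 : N.res GSet.inl (N.res (GSet.fold Y) n) = n :=
    (N.toSemiMackey.res_comp' (h := MulActionHom.id G) (by simp) n).trans (N.res_id n)
  have e2 : N.res GSet.inr (N.res (GSet.fold Y) n) = n :=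
    (N.toSemiMackey.res_comp' (h := MulActionHom.id G) (by simp) n).trans (N.res_id n)
  rw [e1, e2]
  congr 1
  · rw [boxMk_congr (p' := p) (by simp)]
    exact congrArg (fun t => boxMk p t n) (M.toSemiMackey.res_inl_pair m m')
  · rw [boxMk_congr (p' := p) (by simp)]
    exact congrArg (fun t => boxMk p t n) (M.toSemiMackey.res_inr_pair m m')

theorem mk_add_right (p : Y →[G] X) (m : M.obj Y) (n n' : N.obj Y) :
    boxMk p m (n + n') = (box M N).op (boxMk p m n) (boxMk p m n') := by
  have K := GSet.isCoprod_sum (X := Y) (Y := Y)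
  rw [N.add_eq_op]
  change boxMk p m (N.tr _ _) = _
  rw [boxMk_tr_right (q := p.comp (GSet.fold Y)) (GSet.fold Y) p (fun _ => rfl)]
  change (box M N).push (p.comp (GSet.fold Y)) (boxMk (MulActionHom.id G) _ _) = _
  have hi : GSet.IsPullback (GSet.inl (X := Y) (Y := Y)) (MulActionHom.id G)
      (MulActionHom.id G) GSet.inl := .mk' (fun _ => rfl) (fun x y h => ⟨y, h.symm, rfl⟩)
      fun w w' _ h => h
  have hj : GSet.IsPullback (GSet.inr (X := Y) (Y := Y)) (MulActionHom.id G)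
      (MulActionHom.id G) GSet.inr := .mk' (fun _ => rfl) (fun x y h => ⟨y, h.symm, rfl⟩)
      fun w w' _ h => h
  rw [(box M N).push_eq_op K]
  rw [box_push, box_push, box_res, box_res, boxRes_mk hi, boxRes_mk hj, boxTr_mk, boxTr_mk]
  have e1 : M.res GSet.inl (M.res (GSet.fold Y) m) = m :=
    (M.toSemiMackey.res_comp' (h := MulActionHom.id G) (by simp) m).trans (M.res_id m)
  have e2 : M.res GSet.inr (M.res (GSet.fold Y) m) = m :=
    (M.toSemiMackey.res_comp' (h := MulActionHom.id G) (by simp) m).trans (M.res_id m)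
  rw [e1, e2]
  congr 1
  · rw [boxMk_congr (p' := p) (by simp)]
    exact congrArg (fun t => boxMk p m t) (N.toSemiMackey.res_inl_pair n n')
  · rw [boxMk_congr (p' := p) (by simp)]
    exact congrArg (fun t => boxMk p m t) (N.toSemiMackey.res_inr_pair n n')

theorem mk_zero_left (p : Y →[G] X) (n : N.obj Y) :
    boxMk p (0 : M.obj Y) n = (box M N).unit X := by
  rw [← map_zero (M.tr (GSet.fromEmpty Y)), boxMk_tr_left (q := GSet.fromEmpty X) _ _
    (fun x => isEmptyElim x)]
  change (box M N).push (GSet.fromEmpty X) (boxMk (MulActionHom.id G) _ _) = _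
  rw [SemiMackey.unit]
  congr 1
  exact (box M N).subsingleton _ _

theorem box_exists_neg (z : BoxObj M N X) : ∃ z', (box M N).op z z' = (box M N).unit X := by
  revert z
  refine box_ind fun Y p m n => ⟨boxMk p (-m) n, ?_⟩
  rw [← mk_add_left, add_neg_cancel, mk_zero_left]

noncomputable instance : AddCommGroup (BoxObj M N X) where
  __ := (box M N).addCommMonoid X
  neg a := (box_exists_neg a).choose
  zsmul := @zsmulRec _ ⟨(box M N).unit X⟩ ⟨(box M N).op⟩ ⟨fun a => (box_exists_neg a).choose⟩
    (@nsmulRec _ ⟨(box M N).unit X⟩ ⟨(box M N).op⟩)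
  neg_add_cancel a := ((box M N).op_comm _ a).trans (box_exists_neg a).choose_spec

end BoxGroup

/-- The map `M ⊠_k A → M ⊠_k B` induced by a morphism `A → B`, sending `[Y → X, m ⊗ a]` to
`[Y → X, m ⊗ f a]`. -/
noncomputable def boxMap (M : TambaraModule k) {A B : TambaraModule k} (f : Hom A B) (X : GSet G) :
    BoxObj M A X → BoxObj M B X :=
  boxLift (fun Y p m a => boxMk p m (f.app Y a))
    (fun g p m a => by rw [f.map_res]; exact boxMk_tr_left g p (fun _ => rfl) _ _)
    (fun g p m a => by rw [f.map_tr]; exact boxMk_tr_right g p (fun _ => rfl) _ _)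
    (fun p c m a => by rw [map_smul, boxMk_smul])

/-- A module `M` is flat if the functor `M ⊠_k -` is exact. -/
def Flat (M : TambaraModule k) : Prop :=
  ∀ (A B C : TambaraModule k) (f : Hom A B) (g : Hom B C), ShortExact f g →
    ∀ X : GSet G, Function.Injective (M.boxMap f X) ∧
      Function.Exact (M.boxMap f X) (M.boxMap g X) ∧ Function.Surjective (M.boxMap g X)

end TambaraModule

namespace TambaraAlgebra

variable {G : Type} [Group G] {k : TambaraFunctor.{u} G} {X Y Z W P Q B : GSet G}

/-- A `k`-algebra as a `k`-module. -/
noncomputable def toModule (R : TambaraAlgebra k) : TambaraModule k where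
  obj := R.obj
  addCommGroup X := inferInstance
  module X := Module.compHom (R.obj X) (R.unit.ringHom X)
  res f := { toFun := R.res f, map_zero' := R.res_zero f, map_add' := R.res_add f }
  tr f := { toFun := R.tr f, map_zero' := R.tr_zero f, map_add' := R.tr_add f }
  res_id := R.res_id
  res_comp := R.res_comp
  tr_id := R.tr_id
  tr_comp := R.tr_comp
  tr_res := R.tr_res
  empty := R.empty
  coprod := R.coprod
  res_smul f a m := by
    change R.res f (R.unit.app _ a * m) = R.unit.app _ (k.res f a) * R.res f m
    rw [R.res_mul, R.unit.map_res]
  tr_res_smul f a m := by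
    change R.tr f (R.unit.app _ (k.res f a) * m) = R.unit.app _ a * R.tr f m
    rw [R.unit.map_res, R.tr_res_mul]
  tr_smul_res f a m := by
    change R.tr f (R.unit.app _ a * R.res f m) = R.unit.app _ (k.tr f a) * m
    rw [mul_comm, R.tr_res_mul, mul_comm, R.unit.map_tr]

/-- A morphism of `k`-algebras. -/
structure Hom (R S : TambaraAlgebra k) extends
    TambaraFunctor.Hom R.toTambaraFunctor S.toTambaraFunctor where
  comm : ∀ (X : GSet G) (a : k.obj X), app X (R.unit.app X a) = S.unit.app X a

/-- The product of two `k`-algebras. -/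
def prod (R S : TambaraAlgebra k) : TambaraAlgebra k where
  __ := R.toTambaraFunctor.prod S.toTambaraFunctor
  unit :=
    { app := fun X a => (R.unit.app X a, S.unit.app X a)
      map_res := fun f a => Prod.ext (R.unit.map_res f a) (S.unit.map_res f a)
      map_tr := fun f a => Prod.ext (R.unit.map_tr f a) (S.unit.map_tr f a)
      map_nm := fun f a => Prod.ext (R.unit.map_nm f a) (S.unit.map_nm f a) }

/-! ### The box product of algebras -/

section Box

variable (R S : TambaraAlgebra k)

/-- The values of `R ⊠_k S`. -/
abbrev BoxObj (X : GSet G) : Type u := R.toModule.BoxObj S.toModule X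

/-- The class of the symbol `[p : Y → X, r ⊗ s]`. -/
noncomputable abbrev boxMk (p : Y →[G] X) (r : R.obj Y) (s : S.obj Y) : BoxObj R S X :=
  TambaraModule.boxMk (M := R.toModule) (N := S.toModule) p r s

variable {R S}

theorem boxMk_tr_left {q : Y →[G] X} (g : Y →[G] W) (p : W →[G] X) (H : ∀ y, p (g y) = q y)
    (m : R.obj Y) (n : S.obj W) : boxMk R S p (R.tr g m) n = boxMk R S q m (S.res g n) :=
  TambaraModule.boxMk_tr_left (M := R.toModule) (N := S.toModule) g p H m n

theorem boxMk_tr_right {q : Y →[G] X} (g : Y →[G] W) (p : W →[G] X) (H : ∀ y, p (g y) = q y)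
    (m : R.obj W) (n : S.obj Y) : boxMk R S p m (S.tr g n) = boxMk R S q (R.res g m) n :=
  TambaraModule.boxMk_tr_right (M := R.toModule) (N := S.toModule) g p H m n

theorem boxMk_smul (p : Y →[G] X) (a : k.obj Y) (m : R.obj Y) (n : S.obj Y) :
    boxMk R S p (R.unit.app Y a * m) n = boxMk R S p m (S.unit.app Y a * n) :=
  TambaraModule.boxMk_smul (M := R.toModule) (N := S.toModule) p a m n

theorem boxMk_bij {q : Y →[G] X} (g : Y →[G] W) (hg : Function.Bijective g) (p : W →[G] X)
    (H : ∀ y, p (g y) = q y) (m : R.obj W) (n : S.obj W) :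
    boxMk R S p m n = boxMk R S q (R.res g m) (S.res g n) :=
  TambaraModule.boxMk_bij (M := R.toModule) (N := S.toModule) g hg p H m n

theorem boxRes_mk {u : P →[G] Y} {v : P →[G] Z} {p : Y →[G] X} {f : Z →[G] X}
    (H : GSet.IsPullback u v p f) (m : R.obj Y) (n : S.obj Y) :
    TambaraModule.boxRes f (boxMk R S p m n) = boxMk R S v (R.res u m) (S.res u n) :=
  TambaraModule.boxRes_mk (M := R.toModule) (N := S.toModule) H m n

theorem boxTr_mk (f : X →[G] Z) (p : Y →[G] X) (m : R.obj Y) (n : S.obj Y) :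
    TambaraModule.boxTr f (boxMk R S p m n) = boxMk R S (f.comp p) m n := rfl

theorem boxMk_exp {p : Y →[G] X} {f : X →[G] Z} {e : P →[G] Y} {g : P →[G] B} {q : B →[G] Z}
    (H : GSet.IsExp p f e g q) {P' B' : GSet G} {e' : P' →[G] Y} {g' : P' →[G] B'} {q' : B' →[G] Z}
    (H' : GSet.IsExp p f e' g' q') (m : R.obj Y) (n : S.obj Y) :
    boxMk R S q (R.nm g (R.res e m)) (S.nm g (S.res e n)) =
      boxMk R S q' (R.nm g' (R.res e' m)) (S.nm g' (S.res e' n)) := by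
  obtain ⟨c, d, hc, h1, h2, H₁⟩ := H.exists_iso H'
  rw [boxMk_bij c hc q' h1, R.nm_res H₁, S.nm_res H₁, ← R.res_comp, ← S.res_comp,
    show e'.comp d = e from MulActionHom.ext h2]

/-- Norms of symbols of the box product, along a chosen exponential diagram. -/
noncomputable def boxNmSymbol (f : X →[G] Z) {Y : GSet G} (p : Y →[G] X) (m : R.obj Y)
    (n : S.obj Y) : BoxObj R S Z :=
  let H := (GSet.exists_isExp p f).choose_spec.choose_spec
  boxMk R S H.choose_spec.choose_spec.choose
    (R.nm H.choose_spec.choose (R.res H.choose m))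
    (S.nm H.choose_spec.choose (S.res H.choose n))

theorem boxNmSymbol_eq {p : Y →[G] X} {f : X →[G] Z} {e : P →[G] Y} {g : P →[G] B} {q : B →[G] Z}
    (H : GSet.IsExp p f e g q) (m : R.obj Y) (n : S.obj Y) :
    boxNmSymbol f p m n = boxMk R S q (R.nm g (R.res e m)) (S.nm g (S.res e n)) :=
  boxMk_exp (GSet.exists_isExp p f).choose_spec.choose_spec.choose_spec.choose_spec.choose_spec H m n

/-- Norms of the box product: `[Y → X, r ⊗ s]` is sent to the symbol of the dependent product of
`Y` along `f : X → Z`, see `boxNm_mk`. -/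
noncomputable def boxNm (f : X →[G] Z) : BoxObj R S X → BoxObj R S Z :=
  TambaraModule.boxLift (M := R.toModule) (N := S.toModule)
    (fun _ p m n => boxNmSymbol (R := R) (S := S) f p m n)
    (fun {Y Y'} g p (m : R.obj Y) (n : S.obj Y') => by
      change boxNmSymbol f p (R.tr g m) n = boxNmSymbol f (p.comp g) m (S.res g n)
      obtain ⟨P, B, e, h, q, H⟩ := GSet.exists_isExp p f
      obtain ⟨Q, a, b, H₁⟩ := GSet.exists_isPullback g e
      obtain ⟨P₂, B₂, e₂, g₂, q₂, H₂⟩ := GSet.exists_isExp b h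
      rw [boxNmSymbol_eq H, boxNmSymbol_eq (H.trans H₁ H₂), R.tr_res H₁, R.nm_tr H₂,
        boxMk_tr_left q₂ q (q := q.comp q₂) (fun _ => rfl), S.nm_res H₂.1, ← R.res_comp,
        ← S.res_comp, ← S.res_comp]
      congr 3
      exact MulActionHom.ext fun x => (H₁.1 _).symm)
    (fun {Y Y'} g p (m : R.obj Y') (n : S.obj Y) => by
      change boxNmSymbol f p m (S.tr g n) = boxNmSymbol f (p.comp g) (R.res g m) n
      obtain ⟨P, B, e, h, q, H⟩ := GSet.exists_isExp p f
      obtain ⟨Q, a, b, H₁⟩ := GSet.exists_isPullback g e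
      obtain ⟨P₂, B₂, e₂, g₂, q₂, H₂⟩ := GSet.exists_isExp b h
      rw [boxNmSymbol_eq H, boxNmSymbol_eq (H.trans H₁ H₂), S.tr_res H₁, S.nm_tr H₂,
        boxMk_tr_right q₂ q (q := q.comp q₂) (fun _ => rfl), R.nm_res H₂.1, ← S.res_comp,
        ← R.res_comp, ← R.res_comp]
      congr 3
      exact MulActionHom.ext fun x => (H₁.1 _).symm)
    (fun {Y} p a (m : R.obj Y) (n : S.obj Y) => by
      change boxNmSymbol f p (R.unit.app Y a * m) n = boxNmSymbol f p m (S.unit.app Y a * n)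
      obtain ⟨P, B, e, h, q, H⟩ := GSet.exists_isExp p f
      rw [boxNmSymbol_eq H, boxNmSymbol_eq H, R.res_mul, S.res_mul, R.nm_mul, S.nm_mul,
        ← R.unit.map_res, ← R.unit.map_nm, ← S.unit.map_res, ← S.unit.map_nm, boxMk_smul])

theorem boxNm_mk {p : Y →[G] X} {f : X →[G] Z} {e : P →[G] Y} {g : P →[G] B} {q : B →[G] Z}
    (H : GSet.IsExp p f e g q) (m : R.obj Y) (n : S.obj Y) :
    boxNm f (boxMk R S p m n) = boxMk R S q (R.nm g (R.res e m)) (S.nm g (S.res e n)) :=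
  boxNmSymbol_eq H m n

theorem box_ind {C : BoxObj R S X → Prop}
    (h : ∀ (Y : GSet G) (p : Y →[G] X) (m : R.obj Y) (n : S.obj Y), C (boxMk R S p m n)) (z) :
    C z := TambaraModule.box_ind (M := R.toModule) (N := S.toModule) h z

end Box

/-- The box product `R ⊠_k S` of `k`-algebras, as a semi-Tambara functor. -/
noncomputable def semiBox (R S : TambaraAlgebra k) : SemiTambaraFunctor.{u} G where
  obj := BoxObj R S
  res := TambaraModule.boxRes
  tr := TambaraModule.boxTr
  nm := boxNm
  res_id := (TambaraModule.box R.toModule S.toModule).res_id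
  res_comp := (TambaraModule.box R.toModule S.toModule).res_comp
  tr_id := (TambaraModule.box R.toModule S.toModule).push_id
  tr_comp := (TambaraModule.box R.toModule S.toModule).push_comp
  tr_res := (TambaraModule.box R.toModule S.toModule).push_res
  empty := (TambaraModule.box R.toModule S.toModule).empty
  coprod := (TambaraModule.box R.toModule S.toModule).coprod
  nm_id := box_ind fun Y p m n => by
    have H : GSet.IsExp p (MulActionHom.id G) (MulActionHom.id G) (MulActionHom.id G) p := by
      refine .mk' (.mk' (fun _ => rfl) (fun x y h => ⟨y, h.symm, rfl⟩) fun w w' _ h => h)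
        (fun y s hs => ⟨s y rfl, hs y rfl, ?_⟩)
        (fun b b' hq hb => hb b b' rfl rfl hq)
      rintro x hx
      obtain rfl : x = y := hx
      exact ⟨_, rfl, rfl⟩
    rw [boxNm_mk H, R.nm_id, R.res_id, S.nm_id, S.res_id]
  nm_comp f g := box_ind fun Y p m n => by
    obtain ⟨P₁, B₁, e₁, g₁, q₁, H₁⟩ := GSet.exists_isExp p f
    obtain ⟨P₂, B₂, e₂, g₂, q₂, H₂⟩ := GSet.exists_isExp q₁ g
    obtain ⟨Q, a, b, H⟩ := GSet.exists_isPullback g₁ e₂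
    rw [boxNm_mk H₁, boxNm_mk H₂, boxNm_mk (H₁.comp H₂ H), R.nm_res H, S.nm_res H, R.nm_comp,
      S.nm_comp, R.res_comp, S.res_comp]
  nm_res {_ _ _ _ u v f g} H := box_ind fun Y p m n => by
    obtain ⟨P₁, B₁, e₁, g₁, q₁, H₁⟩ := GSet.exists_isExp p f
    obtain ⟨W', u', p', H₂⟩ := GSet.exists_isPullback p u
    obtain ⟨B', β, q', H₃⟩ := GSet.exists_isPullback q₁ g
    obtain ⟨Q', κ, g', H₄⟩ := GSet.exists_isPullback g₁ β
    obtain ⟨e', he, H₅⟩ := H₁.baseChange H H₂ H₃ H₄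
    rw [boxNm_mk H₁, boxRes_mk H₃, boxRes_mk H₂, boxNm_mk H₅, R.nm_res H₄, S.nm_res H₄,
      ← R.res_comp, ← R.res_comp, ← S.res_comp, ← S.res_comp,
      show u'.comp e' = e₁.comp κ from MulActionHom.ext he]
  nm_tr H := box_ind fun Y p m n => by
    obtain ⟨Q, a, b, H₁⟩ := GSet.exists_isPullback p _
    obtain ⟨P₂, B₂, e₂, g₂, q₂, H₂⟩ := GSet.exists_isExp b _
    rw [boxTr_mk, boxRes_mk H₁, boxNm_mk H₂, boxTr_mk, boxNm_mk (H.trans H₁ H₂), R.res_comp,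
      S.res_comp]

/-- The box product `R ⊠_k S` of `k`-algebras. -/
noncomputable def box (R S : TambaraAlgebra k) : TambaraFunctor.{u} G where
  __ := semiBox R S
  hasNeg _ := TambaraModule.box_exists_neg (M := R.toModule) (N := S.toModule)

/-- The multiplication map `R ⊠_k R → R`, sending `[p : Y → X, r ⊗ s]` to `tr p (r * s)`. -/
noncomputable def mulMap (R : TambaraAlgebra k) :
    TambaraFunctor.Hom (box R R) R.toTambaraFunctor where
  app X := TambaraModule.boxLift (M := R.toModule) (N := R.toModule)
    (fun Y p (r s : R.obj Y) => R.tr p (r * s))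
    (fun {Y Y'} g p (m : R.obj Y) (n : R.obj Y') => by
      change R.tr p (R.tr g m * n) = R.tr (p.comp g) (m * R.res g n)
      rw [R.tr_comp, mul_comm m, R.tr_res_mul, mul_comm])
    (fun {Y Y'} g p (m : R.obj Y') (n : R.obj Y) => by
      change R.tr p (m * R.tr g n) = R.tr (p.comp g) (R.res g m * n)
      rw [R.tr_comp, R.tr_res_mul])
    (fun {Y} p a (m : R.obj Y) (n : R.obj Y) => by
      change R.tr p (R.unit.app Y a * m * n) = R.tr p (m * (R.unit.app Y a * n))
      congr 1
      ring)
  map_res f := box_ind fun Y p m n => by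
    obtain ⟨P, u, v, H⟩ := GSet.exists_isPullback p f
    refine (congrArg _ (boxRes_mk H m n)).trans ?_
    change R.tr v (R.res u m * R.res u n) = R.res f (R.tr p (m * n))
    rw [R.tr_res H, R.res_mul]
  map_tr f := box_ind fun Y p m n => R.tr_comp p f (m * n)
  map_nm f := box_ind fun Y p m n => by
    obtain ⟨P, B, e, g, q, H⟩ := GSet.exists_isExp p f
    refine (congrArg _ (boxNm_mk H m n)).trans ?_
    change R.tr q (R.nm g (R.res e m) * R.nm g (R.res e n)) = R.nm f (R.tr p (m * n))
    rw [R.nm_tr H, R.res_mul, R.nm_mul]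

end TambaraAlgebra

/-! ### Ideals -/

/-- A Tambara ideal: ideals of all values, closed under restrictions and transfers, and under norms
in the sense that `N_f(I(X)) ⊆ N_f(0) + I(Y)` (note that `N_f(0) = 0` if `f` is surjective). -/
structure TambaraIdeal {G : Type} [Group G] (T : TambaraFunctor.{u} G) where
  carrier : ∀ X : GSet G, Ideal (T.obj X)
  res_mem : ∀ {X Y : GSet G} (f : X →[G] Y) {a : T.obj Y}, a ∈ carrier Y → T.res f a ∈ carrier X
  tr_mem : ∀ {X Y : GSet G} (f : X →[G] Y) {a : T.obj X}, a ∈ carrier X → T.tr f a ∈ carrier Y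
  nm_mem : ∀ {X Y : GSet G} (f : X →[G] Y) {a : T.obj X}, a ∈ carrier X →
    T.nm f a - T.nm f 0 ∈ carrier Y

namespace TambaraIdeal

variable {G : Type} [Group G] {S T : TambaraFunctor.{u} G}

/-- The kernel of a morphism of Tambara functors. -/
noncomputable def ker (φ : TambaraFunctor.Hom S T) : TambaraIdeal S where
  carrier X := RingHom.ker (φ.ringHom X)
  res_mem f a ha := by
    change φ.app _ a = 0 at ha
    change φ.app _ (S.res f a) = 0
    rw [φ.map_res, ha, T.res_zero]
  tr_mem f a ha := by
    change φ.app _ a = 0 at ha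
    change φ.app _ (S.tr f a) = 0
    rw [φ.map_tr, ha, T.tr_zero]
  nm_mem f a ha := by
    change φ.app _ a = 0 at ha
    have h : φ.ringHom _ (S.nm f a - S.nm f 0) = φ.app _ (S.nm f a) - φ.app _ (S.nm f 0) :=
      map_sub (φ.ringHom _) _ _
    rw [RingHom.mem_ker, h, φ.map_nm, φ.map_nm, ha, φ.map_zero, sub_self]

/-- `J` contains all products of two elements of `I`, and the norms of all elements of `I` along
all non-injective maps between transitive `G`-sets, that is, along all `G/K → G/H` with `K` conjugate
to a proper subgroup of `H`. -/
def ContainsNontrivialNorms (I J : TambaraIdeal T) : Prop :=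
  (∀ (X : GSet G) (a b : T.obj X), a ∈ I.carrier X → b ∈ I.carrier X → a * b ∈ J.carrier X) ∧
    ∀ (X Y : GSet G) (f : X →[G] Y), MulAction.IsPretransitive G X → MulAction.IsPretransitive G Y →
      ¬ Function.Injective f → ∀ a ∈ I.carrier X, T.nm f a ∈ J.carrier Y

/-- The ideal `I^{>1}` generated by all products and all nontrivial norms of elements of `I`. -/
noncomputable def higher (I : TambaraIdeal T) : TambaraIdeal T where
  carrier X := ⨅ J : {J : TambaraIdeal T // ContainsNontrivialNorms I J}, J.1.carrier X
  res_mem f a ha := by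
    rw [Submodule.mem_iInf] at ha ⊢
    exact fun J => J.1.res_mem f (ha J)
  tr_mem f a ha := by
    rw [Submodule.mem_iInf] at ha ⊢
    exact fun J => J.1.tr_mem f (ha J)
  nm_mem f a ha := by
    rw [Submodule.mem_iInf] at ha ⊢
    exact fun J => J.1.nm_mem f (ha J)

end TambaraIdeal

namespace TambaraAlgebra

variable {G : Type} [Group G] {k : TambaraFunctor.{u} G}

/-- The kernel `I` of the multiplication map `R ⊠_k R → R`. -/
noncomputable def diagonalIdeal (R : TambaraAlgebra k) : TambaraIdeal (R.box R) :=
  TambaraIdeal.ker R.mulMap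

/-- The value at `X` of the genuine Kähler differentials `I / I^{>1}` of `k → R`. -/
abbrev GenuineDifferentials (R : TambaraAlgebra k) (X : GSet G) : Type u :=
  R.diagonalIdeal.carrier X ⧸
    Submodule.comap (R.diagonalIdeal.carrier X).subtype (R.diagonalIdeal.higher.carrier X)

/-- The genuine Kähler differentials of `k → R` vanish. -/
def DifferentialsVanish (R : TambaraAlgebra k) : Prop :=
  ∀ X : GSet G, Subsingleton (R.GenuineDifferentials X)

/-- `R` is flat as a `k`-module. -/
def IsFlat (R : TambaraAlgebra k) : Prop := R.toModule.Flat

/-- `F` is the free polynomial `k`-algebra on generators `x i` in levels `X i`: it represents the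
functor that sends a `k`-algebra `S` to the families of elements `s i ∈ S(X i)`. -/
def IsFreeOn (F : TambaraAlgebra k) {ι : Type} (X : ι → GSet G) (x : ∀ i, F.obj (X i)) : Prop :=
  ∀ (S : TambaraAlgebra k) (s : ∀ i, S.obj (X i)), ∃! φ : Hom F S, ∀ i, φ.app (X i) (x i) = s i

/-- `π : F → R` is a coequalizer of `a, b : E → F` in the category of `k`-algebras. -/
def IsCoequalizer {E F R : TambaraAlgebra k} (a b : Hom E F) (π : Hom F R) : Prop :=
  (∀ X z, π.app X (a.app X z) = π.app X (b.app X z)) ∧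
    ∀ (S : TambaraAlgebra k) (ψ : Hom F S), (∀ X z, ψ.app X (a.app X z) = ψ.app X (b.app X z)) →
      ∃! θ : Hom R S, ∀ X z, θ.app X (π.app X z) = ψ.app X z

/-- `R` is a finitely presented `k`-algebra: a coequalizer of two maps between free polynomial
`k`-algebras on finitely many generators. -/
def IsFinitelyPresented (R : TambaraAlgebra k) : Prop :=
  ∃ (ι κ : Type) (_ : Finite ι) (_ : Finite κ) (X : ι → GSet G) (Y : κ → GSet G)
    (E F : TambaraAlgebra k) (x : ∀ i, E.obj (X i)) (y : ∀ j, F.obj (Y j))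
    (a b : Hom E F) (π : Hom F R), E.IsFreeOn X x ∧ F.IsFreeOn Y y ∧ IsCoequalizer a b π

/-- `k → R` is formally étale. -/
def IsFormallyEtale (R : TambaraAlgebra k) : Prop := R.DifferentialsVanish ∧ R.IsFlat

/-- `k → R` is étale. -/
def IsEtale (R : TambaraAlgebra k) : Prop := R.IsFormallyEtale ∧ R.IsFinitelyPresented

end TambaraAlgebra

/-! Everything is governed by the complementary idempotents `(1, 0)` and `(0, 1)` of the product.
They are compatible with restrictions, so by Frobenius reciprocity transfers respect the
decomposition as well. As a module, the product is therefore the direct sum of `R₁` and `R₂`, and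
flatness passes to retracts and to direct sums (`Flat.retract`, `Flat.biproduct`).

Norms respect the decomposition only partly: the norm of `(a, 0)` along `f` is `(N_f a, N_f 0)`, and
`N_f 0` need not vanish if `f` is not surjective. `IdempotentSplitting` isolates what survives: the
section of a projection commutes with restrictions, transfers, sums and products, and with norms
after multiplication by the idempotent. This is enough to compare Tambara ideals in both directions.

For the differentials, a splitting of `R → R'` induces one of `R ⊠ R → R' ⊠ R'`, and `1` is the sum
of the four elements `eᵢ ⊗ eⱼ`. The part of the diagonal ideal `I` under `eᵢ ⊗ eᵢ` is controlled by
the diagonal ideal of `Rᵢ` (`DifferentialsVanish.idem_mul_mem`). For `i ≠ j` the element `eᵢ ⊗ eⱼ`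
is an idempotent of `I`, because `eᵢ eⱼ = 0`; being its own square, it lies in the ideal generated
by products.

For finite presentation, a coequalizer of maps from a free algebra is the same as a quotient by a
finite list of relations (`isFinitelyPresented_iff`). A factor of a finitely presented algebra needs
one extra relation `e = 1` at the one-point `G`-set. Conversely, the two presentations are combined
with two new generators `e₁, e₂` at the point. For the universal property, an algebra `S` with
elements satisfying the relations must split as an algebra along the images of `e₁` and `e₂`, which
requires `e_Y * N_f(e_X) = e_Y` for all `f : X → Y`. These infinitely many conditions follow from
the single relation that `e` equals the norm along `G → pt` of its restriction (`idem_mul_nm`):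
multiplying by `G` makes all `G`-sets free, and a map to a free `G`-set is injective on each orbit,
where the condition is automatic. -/

namespace TambaraModule

/-! ### Functoriality of the relative box product in both variables. -/

variable {G : Type} [Group G] {k : TambaraFunctor.{u} G} {M M' N N' A B : TambaraModule k}

/-- The map `M ⊠_k N → M' ⊠_k N'` induced by morphisms `M → M'` and `N → N'`. -/
noncomputable def boxBimap (f : Hom M M') (g : Hom N N') (X : GSet G) :
    BoxObj M N X → BoxObj M' N' X :=
  boxLift (fun Y p m n => boxMk p (f.app Y m) (g.app Y n))
    (fun h p m n => by
      rw [f.map_tr, g.map_res]; exact boxMk_tr_left h p (fun _ => rfl) _ _)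
    (fun h p m n => by
      rw [f.map_res, g.map_tr]; exact boxMk_tr_right h p (fun _ => rfl) _ _)
    (fun p c m n => by rw [map_smul, map_smul, boxMk_smul])

@[simp] theorem boxBimap_mk (f : Hom M M') (g : Hom N N') {X Y : GSet G} (p : Y →[G] X)
    (m : M.obj Y) (n : N.obj Y) :
    boxBimap f g X (boxMk p m n) = boxMk p (f.app Y m) (g.app Y n) := rfl

@[simp] theorem boxMap_mk (M : TambaraModule k) (g : Hom N N') {X Y : GSet G} (p : Y →[G] X)
    (m : M.obj Y) (n : N.obj Y) :
    M.boxMap g X (boxMk p m n) = boxMk p m (g.app Y n) := rfl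

theorem boxBimap_res (f : Hom M M') (g : Hom N N') {X Z : GSet G} (h : Z →[G] X)
    (z : BoxObj M N X) : boxBimap f g Z (boxRes h z) = boxRes h (boxBimap f g X z) := by
  revert z
  refine box_ind fun Y p m n => ?_
  obtain ⟨P, u, v, H⟩ := GSet.exists_isPullback p h
  rw [boxRes_mk H, boxBimap_mk, boxBimap_mk, boxRes_mk H, f.map_res, g.map_res]

theorem boxBimap_tr (f : Hom M M') (g : Hom N N') {X Z : GSet G} (h : X →[G] Z)
    (z : BoxObj M N X) : boxBimap f g Z (boxTr h z) = boxTr h (boxBimap f g X z) := by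
  revert z
  exact box_ind fun Y p m n => rfl

end TambaraModule

/-- A map of semi-Mackey functors preserves the induced operations. -/
theorem SemiMackey.map_op {G : Type} [Group G] {M N : SemiMackey.{u} G}
    (φ : ∀ X, M.obj X → N.obj X)
    (hr : ∀ {X Y : GSet G} (f : X →[G] Y) (a : M.obj Y), φ X (M.res f a) = N.res f (φ Y a))
    (hp : ∀ {X Y : GSet G} (f : X →[G] Y) (a : M.obj X), φ Y (M.push f a) = N.push f (φ X a))
    {X : GSet G} (a b : M.obj X) : φ X (M.op a b) = N.op (φ X a) (φ X b) := by
  rw [op, hp, op]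
  congr 1
  refine N.ext GSet.isCoprod_sum ?_ ?_
  · rw [← hr, res_inl_pair, res_inl_pair]
  · rw [← hr, res_inr_pair, res_inr_pair]

namespace TambaraModule

variable {G : Type} [Group G] {k : TambaraFunctor.{u} G} {M M' M₁ M₂ N N' A B : TambaraModule k}

/-- Addition in a box product is by construction the transfer along the folding map, so
compatibility with restrictions and transfers already forces additivity. -/
theorem boxBimap_add (f : Hom M M') (g : Hom N N') {X : GSet G} (z w : BoxObj M N X) :
    boxBimap f g X (z + w) = boxBimap f g X z + boxBimap f g X w :=
  SemiMackey.map_op (M := box M N) (N := box M' N') (fun X => boxBimap f g X)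
    (fun h z => boxBimap_res f g h z) (fun h z => boxBimap_tr f g h z) z w

theorem boxMk_add_left {X Y : GSet G} (p : Y →[G] X) (m m' : M.obj Y) (n : N.obj Y) :
    boxMk p (m + m') n = boxMk p m n + boxMk p m' n := mk_add_left p m m' n

/-- The identity morphism. -/
noncomputable def Hom.id (M : TambaraModule k) : Hom M M where
  app _ := LinearMap.id
  map_res _ _ := rfl
  map_tr _ _ := rfl

/-- The additive map `M ⊠_k N → M' ⊠_k N` induced by a morphism `M → M'`. -/
noncomputable def boxMapLeft (f : Hom M M') (N : TambaraModule k) (X : GSet G) :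
    BoxObj M N X →+ BoxObj M' N X :=
  AddMonoidHom.mk' (boxBimap f (Hom.id N) X) (boxBimap_add f (Hom.id N))

@[simp] theorem boxMapLeft_mk (f : Hom M M') {X Y : GSet G} (p : Y →[G] X)
    (m : M.obj Y) (n : N.obj Y) :
    boxMapLeft f N X (boxMk p m n) = boxMk p (f.app Y m) n := rfl

theorem boxMap_add (M : TambaraModule k) (g : Hom A B) {X : GSet G} (z w : BoxObj M A X) :
    M.boxMap g X (z + w) = M.boxMap g X z + M.boxMap g X w :=
  boxBimap_add (Hom.id M) g z w

/-- The two variables of the box product are independent. This square carries exactness statements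
from one left factor to another. -/
theorem boxMapLeft_boxMap (f : Hom M M') (g : Hom A B) {X : GSet G} (z : BoxObj M A X) :
    boxMapLeft f B X (M.boxMap g X z) = M'.boxMap g X (boxMapLeft f A X z) := by
  revert z
  exact box_ind fun Y p m n => rfl

theorem boxMapLeft_leftInverse {i : Hom M₁ M} {p : Hom M M₁}
    (h : ∀ X m, p.app X (i.app X m) = m) {X : GSet G} (z : BoxObj M₁ N X) :
    boxMapLeft p N X (boxMapLeft i N X z) = z := by
  revert z
  exact box_ind fun Y q m n => by rw [boxMapLeft_mk, boxMapLeft_mk, h]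

/-! ### Flatness of retracts and direct sums. -/

/-- A retract of a flat module is flat. -/
theorem Flat.retract (hM : M.Flat) {i : Hom M₁ M} {p : Hom M M₁}
    (h : ∀ X m, p.app X (i.app X m) = m) : M₁.Flat := by
  intro A B C f g hfg X
  obtain ⟨h1, h2, h3⟩ := hM A B C f g hfg X
  -- Each claim is moved to `M` by `i`, settled there by flatness of `M`, and brought back by `p`.
  refine ⟨fun a b hab => ?_, fun b => ⟨fun hb => ?_, ?_⟩, fun c => ?_⟩
  · rw [← boxMapLeft_leftInverse h a, ← boxMapLeft_leftInverse h b]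
    congr 1
    apply h1
    rw [← boxMapLeft_boxMap, ← boxMapLeft_boxMap, hab]
  · obtain ⟨a, ha⟩ := (h2 (boxMapLeft i B X b)).1 (by rw [← boxMapLeft_boxMap, hb, map_zero])
    refine ⟨boxMapLeft p A X a, ?_⟩
    rw [← boxMapLeft_boxMap, ha, boxMapLeft_leftInverse h]
  · rintro ⟨a, rfl⟩
    rw [← boxMapLeft_leftInverse h (M₁.boxMap g X _)]
    simp only [boxMapLeft_boxMap (M := M₁) (M' := M)]
    rw [(h2 _).2 ⟨_, rfl⟩, map_zero]
  · obtain ⟨b, hb⟩ := h3 (boxMapLeft i C X c)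
    refine ⟨boxMapLeft p B X b, ?_⟩
    rw [← boxMapLeft_boxMap, hb, boxMapLeft_leftInverse h]

/-- A biproduct of two flat modules is flat. -/
theorem Flat.biproduct (h₁ : M₁.Flat) (h₂ : M₂.Flat) {i₁ : Hom M₁ M} {p₁ : Hom M M₁}
    {i₂ : Hom M₂ M} {p₂ : Hom M M₂}
    (h : ∀ X m, i₁.app X (p₁.app X m) + i₂.app X (p₂.app X m) = m) : M.Flat := by
  -- The identity `i₁ p₁ + i₂ p₂ = 1` survives the box product because symbols are additive on the
  -- left. No other relation between the four maps is used.
  have key : ∀ {N : TambaraModule k} {X : GSet G} (z : BoxObj M N X),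
      boxMapLeft i₁ N X (boxMapLeft p₁ N X z) + boxMapLeft i₂ N X (boxMapLeft p₂ N X z) = z := by
    intro N X
    refine box_ind fun Y q m n => ?_
    simp only [boxMapLeft_mk]
    rw [← boxMk_add_left, h]
  intro A B C f g hfg X
  obtain ⟨a1, a2, a3⟩ := h₁ A B C f g hfg X
  obtain ⟨b1, b2, b3⟩ := h₂ A B C f g hfg X
  refine ⟨fun a b hab => ?_, fun b => ⟨fun hb => ?_, ?_⟩, fun c => ?_⟩
  · have e1 : boxMapLeft p₁ A X a = boxMapLeft p₁ A X b := a1 (by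
      rw [← boxMapLeft_boxMap, hab, boxMapLeft_boxMap])
    have e2 : boxMapLeft p₂ A X a = boxMapLeft p₂ A X b := b1 (by
      rw [← boxMapLeft_boxMap, hab, boxMapLeft_boxMap])
    rw [← key a, ← key b, e1, e2]
  · obtain ⟨x, hx⟩ := (a2 (boxMapLeft p₁ B X b)).1 (by rw [← boxMapLeft_boxMap, hb, map_zero])
    obtain ⟨y, hy⟩ := (b2 (boxMapLeft p₂ B X b)).1 (by rw [← boxMapLeft_boxMap, hb, map_zero])
    refine ⟨boxMapLeft i₁ A X x + boxMapLeft i₂ A X y, ?_⟩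
    rw [boxMap_add, ← boxMapLeft_boxMap, ← boxMapLeft_boxMap, hx, hy, key]
  · rintro ⟨a, rfl⟩
    rw [← key (M.boxMap g X _)]
    simp only [boxMapLeft_boxMap (M := M)]
    rw [(a2 _).2 ⟨_, rfl⟩, (b2 _).2 ⟨_, rfl⟩, map_zero, map_zero, add_zero]
  · obtain ⟨x, hx⟩ := a3 (boxMapLeft p₁ C X c)
    obtain ⟨y, hy⟩ := b3 (boxMapLeft p₂ C X c)
    refine ⟨boxMapLeft i₁ B X x + boxMapLeft i₂ B X y, ?_⟩
    rw [boxMap_add, ← boxMapLeft_boxMap, ← boxMapLeft_boxMap, hx, hy, key]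

end TambaraModule

/-! ### Projections and inclusions of a product algebra, and its flatness. -/

namespace TambaraAlgebra

variable {G : Type} [Group G] {k : TambaraFunctor.{u} G} (R S R₁ R₂ : TambaraAlgebra k)
  {X : GSet G}

variable {R S} in
/-- A morphism of algebras as a morphism of modules. -/
noncomputable def Hom.toModuleHom (φ : Hom R S) :
    TambaraModule.Hom R.toModule S.toModule where
  app X :=
    { toFun := φ.app X
      map_add' := φ.map_add
      map_smul' := fun a m => (φ.map_mul _ _).trans (congrArg (· * φ.app X m) (φ.comm X a)) }
  map_res := φ.map_res
  map_tr := φ.map_tr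

theorem prod_add (a b : (R₁.prod R₂).obj X) : a + b = (a.1 + b.1, a.2 + b.2) :=
  SemiTambaraFunctor.prod_add _ _ a b

theorem prod_mul (a b : (R₁.prod R₂).obj X) : a * b = (a.1 * b.1, a.2 * b.2) :=
  SemiTambaraFunctor.prod_mul _ _ a b

theorem prod_one : (1 : (R₁.prod R₂).obj X) = (1, 1) := SemiTambaraFunctor.prod_one _ _

theorem prod_zero : (0 : (R₁.prod R₂).obj X) = (0, 0) := SemiTambaraFunctor.prod_zero _ _

/-- The first projection. -/
def fst : Hom (R₁.prod R₂) R₁ where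
  app _ a := a.1
  map_res _ _ := rfl
  map_tr _ _ := rfl
  map_nm _ _ := rfl
  comm _ _ := rfl

/-- The second projection. -/
def snd : Hom (R₁.prod R₂) R₂ where
  app _ a := a.2
  map_res _ _ := rfl
  map_tr _ _ := rfl
  map_nm _ _ := rfl
  comm _ _ := rfl

/-- The inclusion of the first factor, as a morphism of modules. -/
noncomputable def inlModule : TambaraModule.Hom R₁.toModule (R₁.prod R₂).toModule where
  app X :=
    { toFun := fun a => ((a, 0) : R₁.obj X × R₂.obj X)
      map_add' := fun (a b : R₁.obj X) => by
        refine Eq.trans ?_ (prod_add R₁ R₂ (a, 0) (b, 0)).symm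
        exact Prod.ext rfl (add_zero (0 : R₂.obj X)).symm
      map_smul' := fun c (a : R₁.obj X) => by
        refine Eq.trans ?_ (prod_mul R₁ R₂ ((R₁.prod R₂).unit.app X c) (a, 0)).symm
        exact Prod.ext rfl (mul_zero (R₂.unit.app X c)).symm }
  map_res f a := Prod.ext rfl (R₂.res_zero f).symm
  map_tr f a := Prod.ext rfl (R₂.tr_zero f).symm

/-- The inclusion of the second factor, as a morphism of modules. -/
noncomputable def inrModule : TambaraModule.Hom R₂.toModule (R₁.prod R₂).toModule where
  app X :=
    { toFun := fun a => ((0, a) : R₁.obj X × R₂.obj X)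
      map_add' := fun (a b : R₂.obj X) => by
        refine Eq.trans ?_ (prod_add R₁ R₂ (0, a) (0, b)).symm
        exact Prod.ext (add_zero (0 : R₁.obj X)).symm rfl
      map_smul' := fun c (a : R₂.obj X) => by
        refine Eq.trans ?_ (prod_mul R₁ R₂ ((R₁.prod R₂).unit.app X c) (0, a)).symm
        exact Prod.ext (mul_zero (R₁.unit.app X c)).symm rfl }
  map_res f a := Prod.ext (R₁.res_zero f).symm rfl
  map_tr f a := Prod.ext (R₁.tr_zero f).symm rfl

/-- The inclusions of the factors are not algebra morphisms, but flatness only sees modules, and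
there the product is a direct sum. -/
theorem isFlat_prod_iff : (R₁.prod R₂).IsFlat ↔ R₁.IsFlat ∧ R₂.IsFlat := by
  refine ⟨fun h => ⟨?_, ?_⟩, fun ⟨h₁, h₂⟩ => ?_⟩
  · exact TambaraModule.Flat.retract h (i := inlModule R₁ R₂) (p := (fst R₁ R₂).toModuleHom)
      fun _ _ => rfl
  · exact TambaraModule.Flat.retract h (i := inrModule R₁ R₂) (p := (snd R₁ R₂).toModuleHom)
      fun _ _ => rfl
  · refine TambaraModule.Flat.biproduct h₁ h₂ (i₁ := inlModule R₁ R₂) (i₂ := inrModule R₁ R₂)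
      (p₁ := (fst R₁ R₂).toModuleHom) (p₂ := (snd R₁ R₂).toModuleHom) fun X m => ?_
    exact (prod_add R₁ R₂ (m.1, 0) (0, m.2)).trans
      (Prod.ext (add_zero (m.1 : R₁.obj X)) (zero_add (m.2 : R₂.obj X)))

end TambaraAlgebra

/-! ### Factors of Tambara functors cut out by idempotents. -/

namespace TambaraFunctor

variable {G : Type} [Group G] {T U : TambaraFunctor.{u} G} {X Y : GSet G}

/-- A morphism `q : T → U` that exhibits `U` as the factor of `T` cut out by idempotents:
`U` is identified with the multiples of `idem` by means of the section `sec`. -/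
structure IdempotentSplitting (q : Hom T U) where
  idem : ∀ X : GSet G, T.obj X
  sec : ∀ X : GSet G, U.obj X → T.obj X
  res_idem : ∀ {X Y : GSet G} (f : X →[G] Y), T.res f (idem Y) = idem X
  app_sec : ∀ {X : GSet G} (z : U.obj X), q.app X (sec X z) = z
  sec_app : ∀ {X : GSet G} (w : T.obj X), sec X (q.app X w) = idem X * w

namespace IdempotentSplitting

variable {q : Hom T U} (σ : IdempotentSplitting q)

/-- Multiplication by the idempotent fixes the image of the section. The formulas for `sec` that
follow share one argument: `sec_app` is applied to the expected value `w`, giving `sec (q w) = idem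
* w`, and the factor `idem` is then absorbed by this lemma where possible. -/
theorem idem_mul_sec (z : U.obj X) : σ.idem X * σ.sec X z = σ.sec X z := by
  rw [← σ.sec_app, σ.app_sec]

theorem sec_one : σ.sec X 1 = σ.idem X := by
  rw [← q.map_one, σ.sec_app, mul_one]

theorem sec_zero : σ.sec X 0 = 0 := by
  rw [← q.map_zero, σ.sec_app, mul_zero]

theorem idem_mul_idem : σ.idem X * σ.idem X = σ.idem X := by
  have h := σ.idem_mul_sec (X := X) 1
  rwa [σ.sec_one] at h

theorem app_idem : q.app X (σ.idem X) = 1 := by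
  rw [← σ.sec_one, σ.app_sec]

theorem sec_add (z w : U.obj X) : σ.sec X (z + w) = σ.sec X z + σ.sec X w := by
  have h := σ.sec_app (σ.sec X z + σ.sec X w)
  rwa [q.map_add, σ.app_sec, σ.app_sec, mul_add, σ.idem_mul_sec, σ.idem_mul_sec] at h

theorem sec_mul (z w : U.obj X) : σ.sec X (z * w) = σ.sec X z * σ.sec X w := by
  have h := σ.sec_app (σ.sec X z * σ.sec X w)
  rwa [q.map_mul, σ.app_sec, σ.app_sec, ← mul_assoc, σ.idem_mul_sec] at h

theorem sec_app_mul (w : T.obj X) (z : U.obj X) : σ.sec X (q.app X w * z) = w * σ.sec X z := by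
  have h := σ.sec_app (w * σ.sec X z)
  rwa [q.map_mul, σ.app_sec, mul_left_comm, σ.idem_mul_sec] at h

theorem sec_res (f : X →[G] Y) (z : U.obj Y) : σ.sec X (U.res f z) = T.res f (σ.sec Y z) := by
  have h := σ.sec_app (T.res f (σ.sec Y z))
  rwa [q.map_res, σ.app_sec, ← σ.res_idem f, ← T.res_mul, σ.idem_mul_sec] at h

theorem sec_tr (f : X →[G] Y) (z : U.obj X) : σ.sec Y (U.tr f z) = T.tr f (σ.sec X z) := by
  have h := σ.sec_app (T.tr f (σ.sec X z))
  rwa [q.map_tr, σ.app_sec, ← T.tr_res_mul, σ.res_idem f, σ.idem_mul_sec] at h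

/-- The factor `idem Y` cannot be dropped: in a product, the norm of `(1, 0)` is `(1, N_f 0)`, and
`N_f 0` may be nonzero when `f` is not surjective. -/
theorem sec_nm (f : X →[G] Y) (z : U.obj X) :
    σ.sec Y (U.nm f z) = σ.idem Y * T.nm f (σ.sec X z) := by
  have h := σ.sec_app (T.nm f (σ.sec X z))
  rwa [q.map_nm, σ.app_sec] at h

end IdempotentSplitting

end TambaraFunctor

/-! ### Preimages of Tambara ideals under projections and sections. -/

namespace TambaraIdeal

variable {G : Type} [Group G] {T U : TambaraFunctor.{u} G}

/-- The preimage of a Tambara ideal. -/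
noncomputable def comap (q : TambaraFunctor.Hom T U) (J : TambaraIdeal U) : TambaraIdeal T where
  carrier X := (J.carrier X).comap (q.ringHom X)
  res_mem {X Y} f a ha := by
    change q.app _ (T.res f a) ∈ J.carrier X
    rw [q.map_res]
    exact J.res_mem f ha
  tr_mem {X Y} f a ha := by
    change q.app _ (T.tr f a) ∈ J.carrier Y
    rw [q.map_tr]
    exact J.tr_mem f ha
  nm_mem {X Y} f a ha := by
    rw [Ideal.mem_comap, map_sub]
    change q.app _ (T.nm f a) - q.app _ (T.nm f 0) ∈ J.carrier Y
    rw [q.map_nm, q.map_nm, q.map_zero]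
    exact J.nm_mem f ha

theorem mem_comap {q : TambaraFunctor.Hom T U} {J : TambaraIdeal U} {X : GSet G} {a : T.obj X} :
    a ∈ (comap q J).carrier X ↔ q.app X a ∈ J.carrier X := Iff.rfl

theorem mem_ker {q : TambaraFunctor.Hom T U} {X : GSet G} {a : T.obj X} :
    a ∈ (ker q).carrier X ↔ q.app X a = 0 := Iff.rfl

/-- The preimage of a Tambara ideal under the section of an idempotent splitting. -/
noncomputable def comapSec {q : TambaraFunctor.Hom T U}
    (σ : TambaraFunctor.IdempotentSplitting q) (J : TambaraIdeal T) : TambaraIdeal U where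
  carrier X :=
    { carrier := {z | σ.sec X z ∈ J.carrier X}
      add_mem' := fun {a b} ha hb => by
        change σ.sec X (a + b) ∈ J.carrier X
        rw [σ.sec_add]
        exact add_mem ha hb
      zero_mem' := by
        change σ.sec X 0 ∈ J.carrier X
        rw [σ.sec_zero]
        exact zero_mem _
      smul_mem' := fun c a ha => by
        change σ.sec X (c * a) ∈ J.carrier X
        rw [σ.sec_mul]
        exact Ideal.mul_mem_left _ _ ha }
  res_mem {X Y} f a ha := by
    change σ.sec _ (U.res f a) ∈ J.carrier X
    rw [σ.sec_res]
    exact J.res_mem f ha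
  tr_mem {X Y} f a ha := by
    change σ.sec _ (U.tr f a) ∈ J.carrier Y
    rw [σ.sec_tr]
    exact J.tr_mem f ha
  nm_mem {X Y} f a ha := by
    -- `sec_nm` puts the same factor `idem Y` on both norms, so it can be taken out of the
    -- difference. The subtraction is handled through sums, which `sec` is known to preserve.
    have h : σ.sec Y (U.nm f a - U.nm f 0) = σ.idem Y * (T.nm f (σ.sec X a) - T.nm f 0) := by
      rw [mul_sub, eq_sub_iff_add_eq, ← σ.sec_nm, ← σ.sec_zero, ← σ.sec_nm, ← σ.sec_add,
        sub_add_cancel]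
    change σ.sec Y (U.nm f a - U.nm f 0) ∈ J.carrier Y
    rw [h]
    exact Ideal.mul_mem_left _ _ (J.nm_mem f ha)

theorem mem_comapSec {q : TambaraFunctor.Hom T U} {σ : TambaraFunctor.IdempotentSplitting q}
    {J : TambaraIdeal T} {X : GSet G} {a : U.obj X} :
    a ∈ (comapSec σ J).carrier X ↔ σ.sec X a ∈ J.carrier X := Iff.rfl

end TambaraIdeal

/-! ### Multiplication of symbols, and splittings of box products of algebras. -/

namespace TambaraAlgebra

variable {G : Type} [Group G] {k : TambaraFunctor.{u} G} {R S R' S' R₁ R₂ : TambaraAlgebra k}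
  {X Y Z : GSet G}

/-- The class of the symbol `[p : Y → X, r ⊗ s]` as an element of the Tambara functor `R ⊠_k S`. -/
noncomputable def symbol (R S : TambaraAlgebra k) (p : Y →[G] X) (r : R.obj Y) (s : S.obj Y) :
    (R.box S).obj X := boxMk R S p r s

theorem symbol_ind {C : (R.box S).obj X → Prop}
    (h : ∀ (Y : GSet G) (p : Y →[G] X) (m : R.obj Y) (n : S.obj Y), C (symbol R S p m n)) (z) :
    C z := box_ind h z

theorem symbol_res {P : GSet G} {u : P →[G] Y} {v : P →[G] Z} {p : Y →[G] X} {f : Z →[G] X}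
    (H : GSet.IsPullback u v p f) (m : R.obj Y) (n : S.obj Y) :
    (R.box S).res f (symbol R S p m n) = symbol R S v (R.res u m) (S.res u n) :=
  boxRes_mk H m n

theorem symbol_nm {P B : GSet G} {p : Y →[G] X} {f : X →[G] Z} {e : P →[G] Y} {g : P →[G] B}
    {q : B →[G] Z} (H : GSet.IsExp p f e g q) (m : R.obj Y) (n : S.obj Y) :
    (R.box S).nm f (symbol R S p m n) = symbol R S q (R.nm g (R.res e m)) (S.nm g (S.res e n)) :=
  boxNm_mk H m n

theorem symbol_id_res (f : Y →[G] X) (m : R.obj X) (n : S.obj X) :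
    (R.box S).res f (symbol R S (MulActionHom.id G) m n) =
      symbol R S (MulActionHom.id G) (R.res f m) (S.res f n) :=
  symbol_res (u := f) (v := MulActionHom.id G)
    (.mk' (fun _ => rfl) (fun _ y h => ⟨y, h.symm, rfl⟩) fun _ _ _ h => h) m n

/-- A product is the norm of a pair along the folding map. The dependent product of an identity is
an identity, so on symbols over identity maps the norm is computed separately in `R` and in `S`. -/
theorem symbol_id_mul_id (a m : R.obj X) (b n : S.obj X) :
    symbol R S (MulActionHom.id G) a b * symbol R S (MulActionHom.id G) m n =
      symbol R S (MulActionHom.id G) (a * m) (b * n) := by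
  have hp : (R.box S).mulPart.pair (symbol R S (MulActionHom.id G) a b)
      (symbol R S (MulActionHom.id G) m n) =
      symbol R S (MulActionHom.id G) (R.mulPart.pair a m) (S.mulPart.pair b n) := by
    refine (R.box S).mulPart.ext GSet.isCoprod_sum ?_ ?_
    · refine ((R.box S).mulPart.res_inl_pair _ _).trans (Eq.trans ?_ (symbol_id_res _ _ _).symm)
      exact congrArg₂ (symbol R S _) (R.mulPart.res_inl_pair a m).symm
        (S.mulPart.res_inl_pair b n).symm
    · refine ((R.box S).mulPart.res_inr_pair _ _).trans (Eq.trans ?_ (symbol_id_res _ _ _).symm)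
      exact congrArg₂ (symbol R S _) (R.mulPart.res_inr_pair a m).symm
        (S.mulPart.res_inr_pair b n).symm
  have H : GSet.IsExp (MulActionHom.id G) (GSet.fold X) (MulActionHom.id G) (GSet.fold X)
      (MulActionHom.id G) :=
    .mk' (.mk' (fun _ => rfl) (fun x y h => ⟨x, rfl, h⟩) fun w w' h _ => h)
      (fun y s hs => ⟨y, rfl, fun x hx => ⟨x, hx, (hs x hx).symm⟩⟩) (fun b b' hq _ => hq)
  refine (congrArg ((R.box S).nm (GSet.fold X)) hp).trans ?_
  refine (symbol_nm H _ _).trans ?_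
  rw [R.res_id, S.res_id]
  rfl

/-- A general symbol over `p` is the transfer along `p` of a symbol over an identity, so Frobenius
reciprocity reduces this to `symbol_id_mul_id`. -/
theorem symbol_id_mul (a : R.obj X) (b : S.obj X) (p : Y →[G] X) (m : R.obj Y) (n : S.obj Y) :
    symbol R S (MulActionHom.id G) a b * symbol R S p m n =
      symbol R S p (R.res p a * m) (S.res p b * n) := by
  have h := (R.box S).tr_res_mul p (symbol R S (MulActionHom.id G) a b)
    (symbol R S (MulActionHom.id G) m n)
  refine h.symm.trans ?_
  rw [symbol_id_res]
  exact congrArg _ (symbol_id_mul_id _ _ _ _)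

/-- The symbol is neutral for multiplication on all symbols, and a neutral element is unique. -/
theorem symbol_id_one : symbol R S (MulActionHom.id G) 1 1 = (1 : (R.box S).obj X) := by
  have h : ∀ z : (R.box S).obj X, symbol R S (MulActionHom.id G) 1 1 * z = z := symbol_ind
    fun Y p m n => by rw [symbol_id_mul, R.res_one, S.res_one, one_mul, one_mul]
  rw [← h 1, mul_one]

theorem symbol_add_left (p : Y →[G] X) (m m' : R.obj Y) (n : S.obj Y) :
    symbol R S p (m + m') n = symbol R S p m n + symbol R S p m' n :=
  TambaraModule.mk_add_left (M := R.toModule) (N := S.toModule) p m m' n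

theorem symbol_add_right (p : Y →[G] X) (m : R.obj Y) (n n' : S.obj Y) :
    symbol R S p m (n + n') = symbol R S p m n + symbol R S p m n' :=
  TambaraModule.mk_add_right (M := R.toModule) (N := S.toModule) p m n n'

/-- The morphism `R ⊠_k S → R' ⊠_k S'` induced by morphisms `R → R'` and `S → S'`. -/
noncomputable def boxHom (φ : Hom R R') (ψ : Hom S S') :
    TambaraFunctor.Hom (R.box S) (R'.box S') where
  app X := TambaraModule.boxBimap φ.toModuleHom ψ.toModuleHom X
  map_res f a := TambaraModule.boxBimap_res _ _ f a
  map_tr f a := TambaraModule.boxBimap_tr _ _ f a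
  map_nm f := symbol_ind fun Y p m n => by
    obtain ⟨P, B, e, g, q, H⟩ := GSet.exists_isExp p f
    refine (congrArg _ (symbol_nm H m n)).trans ?_
    refine Eq.trans ?_ (symbol_nm H (φ.app _ m) (ψ.app _ n)).symm
    rw [← φ.map_res, ← φ.map_nm, ← ψ.map_res, ← ψ.map_nm]
    rfl

@[simp] theorem boxHom_mk (φ : Hom R R') (ψ : Hom S S') (p : Y →[G] X) (m : R.obj Y)
    (n : S.obj Y) : (boxHom φ ψ).app X (symbol R S p m n) =
      symbol R' S' p (φ.app Y m) (ψ.app Y n) :=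
  rfl

/-- The section of an idempotent splitting of algebras as a morphism of modules. -/
noncomputable def _root_.TambaraFunctor.IdempotentSplitting.moduleHom {q : Hom R R'}
    (σ : TambaraFunctor.IdempotentSplitting q.toHom) :
    TambaraModule.Hom R'.toModule R.toModule where
  app X :=
    { toFun := σ.sec X
      map_add' := σ.sec_add
      map_smul' := fun c (a : R'.obj X) => by
        change σ.sec X (R'.unit.app X c * a) = R.unit.app X c * σ.sec X a
        rw [← q.comm, σ.sec_app_mul] }
  map_res f a := σ.sec_res f a
  map_tr f a := σ.sec_tr f a

/-- The box product of two idempotent splittings. -/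
noncomputable def boxSplitting {q : Hom R R'} (σ : TambaraFunctor.IdempotentSplitting q.toHom)
    {r : Hom S S'} (τ : TambaraFunctor.IdempotentSplitting r.toHom) :
    TambaraFunctor.IdempotentSplitting (boxHom q r) where
  idem X := symbol R S (MulActionHom.id G) (σ.idem X) (τ.idem X)
  sec X := TambaraModule.boxBimap σ.moduleHom τ.moduleHom X
  res_idem f := by
    rw [symbol_id_res, σ.res_idem, τ.res_idem]
  app_sec := symbol_ind fun Y p m n =>
    congrArg₂ (symbol R' S' p) (σ.app_sec m) (τ.app_sec n)
  sec_app := symbol_ind fun Y p m n => by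
    rw [symbol_id_mul, σ.res_idem, τ.res_idem, ← σ.sec_app, ← τ.sec_app]
    rfl

/-! ### Diagonal ideals and the vanishing of differentials. -/

theorem mulMap_mk (p : Y →[G] X) (r s : R.obj Y) :
    R.mulMap.app X (symbol R R p r s) = R.tr p (r * s) := rfl

theorem mulMap_boxHom (q : Hom R R') (z : (R.box R).obj X) :
    R'.mulMap.app X ((boxHom q q).app X z) = q.app X (R.mulMap.app X z) := by
  revert z
  refine symbol_ind fun Y p m n => ?_
  rw [boxHom_mk, mulMap_mk, mulMap_mk, q.map_tr, q.map_mul]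

/-- Together with `mulMap_boxHom`: the projection `R ⊠ R → R' ⊠ R'` and its section each carry one
diagonal ideal into the other. -/
theorem mulMap_boxSplitting_sec {q : Hom R R'} (σ : TambaraFunctor.IdempotentSplitting q.toHom)
    (z : (R'.box R').obj X) :
    R.mulMap.app X ((boxSplitting σ σ).sec X z) = σ.sec X (R'.mulMap.app X z) := by
  revert z
  refine symbol_ind fun Y p m n => ?_
  rw [mulMap_mk, σ.sec_tr, σ.sec_mul]
  rfl

/-- The higher ideal is an intersection, so `I / I^{>1} = 0` can be tested against one ideal `J` at
a time, with no need to describe its elements. -/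
theorem differentialsVanish_iff : R.DifferentialsVanish ↔ ∀ J : TambaraIdeal (R.box R),
    TambaraIdeal.ContainsNontrivialNorms R.diagonalIdeal J →
      ∀ (X : GSet G), R.diagonalIdeal.carrier X ≤ J.carrier X := by
  have h : R.DifferentialsVanish ↔ ∀ X : GSet G,
      R.diagonalIdeal.carrier X ≤ R.diagonalIdeal.higher.carrier X := by
    refine forall_congr' fun X => ?_
    rw [Submodule.Quotient.subsingleton_iff, Submodule.comap_subtype_eq_top]
  rw [h]
  simp only [TambaraIdeal.higher, le_iInf_iff, Subtype.forall]
  exact ⟨fun h J hJ X => h X J hJ, fun h X J hJ => h J hJ X⟩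

/-- An ideal `J` for `R'` pulls back along `boxHom q q` to an admissible ideal for `R`, which then
contains the diagonal ideal of `R`. -/
theorem DifferentialsVanish.of_splitting (h : R.DifferentialsVanish) {q : Hom R R'}
    (σ : TambaraFunctor.IdempotentSplitting q.toHom) : R'.DifferentialsVanish := by
  rw [differentialsVanish_iff] at h ⊢
  intro J ⟨hJ1, hJ2⟩ X a ha
  have hI : ∀ {X : GSet G} {a : (R.box R).obj X}, a ∈ R.diagonalIdeal.carrier X →
      (boxHom q q).app X a ∈ R'.diagonalIdeal.carrier X := fun {X a} ha => by
    refine TambaraIdeal.mem_ker.2 ?_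
    rw [mulMap_boxHom, TambaraIdeal.mem_ker.1 ha, q.map_zero]
  -- The element `a` is recovered by lifting it along the section, which stays in the diagonal
  -- ideal, and projecting back.
  have := h (TambaraIdeal.comap (boxHom q q) J)
    ⟨fun X a b ha hb => ?_, fun X Y f hX hY hf a ha => ?_⟩
    X (x := (boxSplitting σ σ).sec X a) ?_
  · rwa [TambaraIdeal.mem_comap, (boxSplitting σ σ).app_sec] at this
  · rw [TambaraIdeal.mem_comap, (boxHom q q).map_mul]
    exact hJ1 _ _ _ (hI ha) (hI hb)
  · rw [TambaraIdeal.mem_comap, (boxHom q q).map_nm]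
    exact hJ2 _ _ f hX hY hf _ (hI ha)
  · refine TambaraIdeal.mem_ker.2 ?_
    rw [mulMap_boxSplitting_sec, TambaraIdeal.mem_ker.1 ha, σ.sec_zero]

/-- The reverse comparison: `J` is pulled back along the section. The correction factor in `sec_nm`
does no harm because `J` is an ideal, and going down and up again multiplies `z` by the idempotent.
-/
theorem DifferentialsVanish.idem_mul_mem (h : R'.DifferentialsVanish) {q : Hom R R'}
    (σ : TambaraFunctor.IdempotentSplitting q.toHom) {J : TambaraIdeal (R.box R)}
    (hJ : TambaraIdeal.ContainsNontrivialNorms R.diagonalIdeal J) {z : (R.box R).obj X}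
    (hz : z ∈ R.diagonalIdeal.carrier X) : (boxSplitting σ σ).idem X * z ∈ J.carrier X := by
  rw [differentialsVanish_iff] at h
  have hI : ∀ {X : GSet G} {a : (R'.box R').obj X}, a ∈ R'.diagonalIdeal.carrier X →
      (boxSplitting σ σ).sec X a ∈ R.diagonalIdeal.carrier X := fun {X a} ha => by
    refine TambaraIdeal.mem_ker.2 ?_
    rw [mulMap_boxSplitting_sec, TambaraIdeal.mem_ker.1 ha, σ.sec_zero]
  rw [← (boxSplitting σ σ).sec_app]
  refine h (TambaraIdeal.comapSec (boxSplitting σ σ) J)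
    ⟨fun X a b ha hb => ?_, fun X Y f hX hY hf a ha => ?_⟩ X ?_
  · rw [TambaraIdeal.mem_comapSec, (boxSplitting σ σ).sec_mul]
    exact hJ.1 _ _ _ (hI ha) (hI hb)
  · rw [TambaraIdeal.mem_comapSec, (boxSplitting σ σ).sec_nm]
    exact Ideal.mul_mem_left _ _ (hJ.2 _ _ f hX hY hf _ (hI ha))
  · refine TambaraIdeal.mem_ker.2 ?_
    rw [mulMap_boxHom, TambaraIdeal.mem_ker.1 hz, q.map_zero]

/-- Orthogonality puts `a ⊗ b` into the kernel of multiplication, and idempotency makes it a product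
of two elements of that kernel, namely its own square. -/
theorem symbol_id_mem_of_mul_eq_zero {J : TambaraIdeal (R.box R)}
    (hJ : TambaraIdeal.ContainsNontrivialNorms R.diagonalIdeal J) {a b : R.obj X}
    (ha : a * a = a) (hb : b * b = b) (hab : a * b = 0) :
    symbol R R (MulActionHom.id G) a b ∈ J.carrier X := by
  have h : symbol R R (MulActionHom.id G) a b ∈ R.diagonalIdeal.carrier X := by
    refine TambaraIdeal.mem_ker.2 ?_
    rw [mulMap_mk, hab, R.tr_zero]
  have h2 := hJ.1 X _ _ h h
  rwa [symbol_id_mul_id, ha, hb] at h2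

/-- The unit is cut into four pieces: the diagonal ones are handled by the hypotheses on `R₁` and
`R₂`, the mixed ones by orthogonality. -/
theorem DifferentialsVanish.of_splittings (h₁ : R₁.DifferentialsVanish)
    (h₂ : R₂.DifferentialsVanish) {q₁ : Hom R R₁} {q₂ : Hom R R₂}
    (σ₁ : TambaraFunctor.IdempotentSplitting q₁.toHom)
    (σ₂ : TambaraFunctor.IdempotentSplitting q₂.toHom)
    (hadd : ∀ X, σ₁.idem X + σ₂.idem X = 1) (hmul : ∀ X, σ₁.idem X * σ₂.idem X = 0) :
    R.DifferentialsVanish := by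
  rw [differentialsVanish_iff]
  intro J hJ X z hz
  have e1 := h₁.idem_mul_mem σ₁ hJ hz
  have e2 := h₂.idem_mul_mem σ₂ hJ hz
  have e3 := Ideal.mul_mem_right z _
    (symbol_id_mem_of_mul_eq_zero hJ σ₁.idem_mul_idem σ₂.idem_mul_idem (hmul X))
  have e4 := Ideal.mul_mem_right z _
    (symbol_id_mem_of_mul_eq_zero hJ σ₂.idem_mul_idem σ₁.idem_mul_idem
      ((mul_comm _ _).trans (hmul X)))
  -- This is `1 ⊗ 1 = (e₁ + e₂) ⊗ (e₁ + e₂)`, expanded and multiplied by `z`.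
  have h : z = (boxSplitting σ₁ σ₁).idem X * z + symbol R R (MulActionHom.id G) (σ₁.idem X)
      (σ₂.idem X) * z + (symbol R R (MulActionHom.id G) (σ₂.idem X) (σ₁.idem X) * z +
      (boxSplitting σ₂ σ₂).idem X * z) := by
    change z = symbol R R (MulActionHom.id G) (σ₁.idem X) (σ₁.idem X) * z +
      symbol R R (MulActionHom.id G) (σ₁.idem X) (σ₂.idem X) * z +
      (symbol R R (MulActionHom.id G) (σ₂.idem X) (σ₁.idem X) * z +
      symbol R R (MulActionHom.id G) (σ₂.idem X) (σ₂.idem X) * z)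
    rw [← add_mul, ← add_mul, ← add_mul, ← symbol_add_right, ← symbol_add_right, ← symbol_add_left,
      hadd, symbol_id_one, one_mul]
  rw [h]
  exact add_mem (add_mem e1 e3) (add_mem e4 e2)

/-! ### The two splittings of a product and the differentials of a product. -/

/-- The first projection of a product splits. -/
noncomputable def fstSplitting (R₁ R₂ : TambaraAlgebra k) :
    TambaraFunctor.IdempotentSplitting (fst R₁ R₂).toHom where
  idem _ := ((1, 0) : R₁.obj _ × R₂.obj _)
  sec _ a := ((a, 0) : R₁.obj _ × R₂.obj _)
  res_idem f := Prod.ext (R₁.res_one f) (R₂.res_zero f)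
  app_sec _ := rfl
  sec_app w := by
    refine Eq.trans ?_ (prod_mul R₁ R₂ (1, 0) w).symm
    exact Prod.ext (one_mul (w.1 : R₁.obj _)).symm (zero_mul (w.2 : R₂.obj _)).symm

/-- The second projection of a product splits. -/
noncomputable def sndSplitting (R₁ R₂ : TambaraAlgebra k) :
    TambaraFunctor.IdempotentSplitting (snd R₁ R₂).toHom where
  idem _ := ((0, 1) : R₁.obj _ × R₂.obj _)
  sec _ a := ((0, a) : R₁.obj _ × R₂.obj _)
  res_idem f := Prod.ext (R₁.res_zero f) (R₂.res_one f)
  app_sec _ := rfl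
  sec_app w := by
    refine Eq.trans ?_ (prod_mul R₁ R₂ (0, 1) w).symm
    exact Prod.ext (zero_mul (w.1 : R₁.obj _)).symm (one_mul (w.2 : R₂.obj _)).symm

theorem prod_idem_add_idem (R₁ R₂ : TambaraAlgebra k) (X : GSet G) :
    (fstSplitting R₁ R₂).idem X + (sndSplitting R₁ R₂).idem X = 1 := by
  refine (prod_add R₁ R₂ (1, 0) (0, 1)).trans (Eq.trans ?_ (prod_one R₁ R₂).symm)
  exact Prod.ext (add_zero (1 : R₁.obj X)) (zero_add (1 : R₂.obj X))

theorem prod_idem_mul_idem (R₁ R₂ : TambaraAlgebra k) (X : GSet G) :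
    (fstSplitting R₁ R₂).idem X * (sndSplitting R₁ R₂).idem X = 0 := by
  refine (prod_mul R₁ R₂ (1, 0) (0, 1)).trans (Eq.trans ?_ (prod_zero R₁ R₂).symm)
  exact Prod.ext (mul_zero (1 : R₁.obj X)) (zero_mul (1 : R₂.obj X))

theorem differentialsVanish_prod_iff (R₁ R₂ : TambaraAlgebra k) :
    (R₁.prod R₂).DifferentialsVanish ↔ R₁.DifferentialsVanish ∧ R₂.DifferentialsVanish :=
  ⟨fun h => ⟨h.of_splitting (fstSplitting R₁ R₂), h.of_splitting (sndSplitting R₁ R₂)⟩,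
    fun ⟨h₁, h₂⟩ => h₁.of_splittings h₂ (fstSplitting R₁ R₂) (sndSplitting R₁ R₂)
      (prod_idem_add_idem R₁ R₂) (prod_idem_mul_idem R₁ R₂)⟩

end TambaraAlgebra

/-! ### The category of algebras and images of morphisms. -/

namespace TambaraAlgebra

variable {G : Type} [Group G] {k : TambaraFunctor.{u} G} {R S T : TambaraAlgebra k} {X Y Z : GSet G}

theorem Hom.ext {φ ψ : Hom R S} (h : ∀ X z, φ.app X z = ψ.app X z) : φ = ψ := by
  obtain ⟨⟨φ, _, _, _⟩, _⟩ := φ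
  obtain ⟨⟨ψ, _, _, _⟩, _⟩ := ψ
  obtain rfl : φ = ψ := funext fun X => funext fun z => h X z
  rfl

/-- The identity morphism. -/
def Hom.id (R : TambaraAlgebra k) : Hom R R where
  app _ a := a
  map_res _ _ := rfl
  map_tr _ _ := rfl
  map_nm _ _ := rfl
  comm _ _ := rfl

/-- Composition of morphisms. -/
def Hom.comp (ψ : Hom S T) (φ : Hom R S) : Hom R T where
  __ := TambaraFunctor.Hom.comp ψ.toHom φ.toHom
  comm X a := (congrArg (ψ.app X) (φ.comm X a)).trans (ψ.comm X a)

@[simp] theorem Hom.comp_app (ψ : Hom S T) (φ : Hom R S) (z : R.obj X) :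
    (ψ.comp φ).app X z = ψ.app X (φ.app X z) := rfl

@[simp] theorem Hom.id_app (z : R.obj X) : (Hom.id R).app X z = z := rfl

theorem Hom.map_neg (φ : Hom R S) (z : R.obj X) : φ.app X (-z) = -φ.app X z :=
  _root_.map_neg (φ.ringHom X) z

/-- The image of a morphism of algebras as a semi-Tambara functor. -/
noncomputable def rangeSemi (φ : Hom R S) : SemiTambaraFunctor.{u} G where
  obj X := Set.range (φ.app X)
  res f a := ⟨S.res f a, by
    obtain ⟨_, b, rfl⟩ := a
    exact ⟨R.res f b, φ.map_res f b⟩⟩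
  tr f a := ⟨S.tr f a, by
    obtain ⟨_, b, rfl⟩ := a
    exact ⟨R.tr f b, φ.map_tr f b⟩⟩
  nm f a := ⟨S.nm f a, by
    obtain ⟨_, b, rfl⟩ := a
    exact ⟨R.nm f b, φ.map_nm f b⟩⟩
  res_id a := Subtype.ext (S.res_id _)
  res_comp f g a := Subtype.ext (S.res_comp f g _)
  tr_id a := Subtype.ext (S.tr_id _)
  tr_comp f g a := Subtype.ext (S.tr_comp f g _)
  nm_id a := Subtype.ext (S.nm_id _)
  nm_comp f g a := Subtype.ext (S.nm_comp f g _)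
  tr_res H a := Subtype.ext (S.tr_res H _)
  nm_res H a := Subtype.ext (S.nm_res H _)
  nm_tr H a := Subtype.ext (S.nm_tr H _)
  empty X h := ⟨⟨⟨⟨φ.app X 0, 0, rfl⟩⟩, fun _ => Subtype.ext (S.addPart.subsingleton _ _)⟩⟩
  coprod {X Y Z i j} H := by
    refine ⟨fun a b h => ?_, fun ⟨⟨_, a, rfl⟩, ⟨_, b, rfl⟩⟩ => ?_⟩
    · simp only [Prod.mk.injEq, Subtype.mk.injEq] at h
      exact Subtype.ext (S.addPart.ext H h.1 h.2)
    -- Gluing takes place in the source: preimages of the two components are glued in `R`, and the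
    -- result is mapped to `S`.
    · obtain ⟨z, hz⟩ := (R.coprod H).2 (a, b)
      simp only [Prod.mk.injEq] at hz
      refine ⟨⟨φ.app Z z, z, rfl⟩, Prod.ext (Subtype.ext ?_) (Subtype.ext ?_)⟩
      · exact (φ.map_res i z).symm.trans (congrArg _ hz.1)
      · exact (φ.map_res j z).symm.trans (congrArg _ hz.2)

/-- The image of a morphism of algebras. -/
noncomputable def range (φ : Hom R S) : TambaraAlgebra k where
  __ := rangeSemi φ
  hasNeg := fun X ⟨_, a, rfl⟩ => by
    refine ⟨⟨φ.app X (-a), -a, rfl⟩, Subtype.ext ?_⟩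
    refine (SemiMackey.map_op (M := (rangeSemi φ).addPart) (N := S.addPart) (fun _ a => a.1)
      (fun _ _ => rfl) (fun _ _ => rfl) _ _).trans ?_
    refine (φ.map_add a (-a)).symm.trans ?_
    rw [add_neg_cancel, φ.map_zero]
    exact congrArg (S.tr (GSet.fromEmpty X)) (S.addPart.subsingleton _ _)
  unit :=
    { app := fun X a => ⟨S.unit.app X a, R.unit.app X a, φ.comm X a⟩
      map_res := fun f a => Subtype.ext (S.unit.map_res f a)
      map_tr := fun f a => Subtype.ext (S.unit.map_tr f a)
      map_nm := fun f a => Subtype.ext (S.unit.map_nm f a) }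

end TambaraAlgebra

/-! ### Free algebras -/

namespace SemiMackey

variable {G : Type} [Group G] (M : SemiMackey.{u} G) {X Y Z : GSet G} {i : X →[G] Z} {j : Y →[G] Z}

/-- The element with given restrictions to the two parts of a disjoint union. -/
noncomputable def glue (H : GSet.IsCoprod i j) (a : M.obj X) (b : M.obj Y) : M.obj Z :=
  ((M.coprod H).2 (a, b)).choose

theorem res_glue_left (H : GSet.IsCoprod i j) (a : M.obj X) (b : M.obj Y) :
    M.res i (M.glue H a b) = a := congrArg Prod.fst ((M.coprod H).2 (a, b)).choose_spec

theorem res_glue_right (H : GSet.IsCoprod i j) (a : M.obj X) (b : M.obj Y) :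
    M.res j (M.glue H a b) = b := congrArg Prod.snd ((M.coprod H).2 (a, b)).choose_spec

end SemiMackey

/-- Formal expressions in generators in levels `A i`, with coefficients in `k`. -/
inductive FreeTerm {G : Type} [Group G] (k : TambaraFunctor.{u} G) {ι : Type} (A : ι → GSet G) :
    GSet G → Type u
  | var (i : ι) : FreeTerm k A (A i)
  | const {X : GSet G} (a : k.obj X) : FreeTerm k A X
  | res {X Y : GSet G} (f : X →[G] Y) (t : FreeTerm k A Y) : FreeTerm k A X
  | tr {X Y : GSet G} (f : X →[G] Y) (t : FreeTerm k A X) : FreeTerm k A Y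
  | nm {X Y : GSet G} (f : X →[G] Y) (t : FreeTerm k A X) : FreeTerm k A Y
  | glue {X Y Z : GSet G} {i : X →[G] Z} {j : Y →[G] Z} (H : GSet.IsCoprod i j)
      (s : FreeTerm k A X) (t : FreeTerm k A Y) : FreeTerm k A Z
  | neg {X : GSet G} (t : FreeTerm k A X) : FreeTerm k A X

/-- The congruence on formal expressions generated by the axioms of `k`-algebras. -/
inductive FreeRel {G : Type} [Group G] (k : TambaraFunctor.{u} G) {ι : Type} (A : ι → GSet G) :
    ∀ {X : GSet G}, FreeTerm k A X → FreeTerm k A X → Prop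
  | refl {X : GSet G} (t : FreeTerm k A X) : FreeRel k A t t
  | symm {X : GSet G} {s t : FreeTerm k A X} : FreeRel k A s t → FreeRel k A t s
  | trans {X : GSet G} {r s t : FreeTerm k A X} :
      FreeRel k A r s → FreeRel k A s t → FreeRel k A r t
  | res {X Y : GSet G} (f : X →[G] Y) {s t : FreeTerm k A Y} :
      FreeRel k A s t → FreeRel k A (.res f s) (.res f t)
  | tr {X Y : GSet G} (f : X →[G] Y) {s t : FreeTerm k A X} :
      FreeRel k A s t → FreeRel k A (.tr f s) (.tr f t)
  | nm {X Y : GSet G} (f : X →[G] Y) {s t : FreeTerm k A X} :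
      FreeRel k A s t → FreeRel k A (.nm f s) (.nm f t)
  | res_id {X : GSet G} (t : FreeTerm k A X) : FreeRel k A (.res (MulActionHom.id G) t) t
  | res_comp {X Y Z : GSet G} (f : X →[G] Y) (g : Y →[G] Z) (t : FreeTerm k A Z) :
      FreeRel k A (.res (g.comp f) t) (.res f (.res g t))
  | tr_id {X : GSet G} (t : FreeTerm k A X) : FreeRel k A (.tr (MulActionHom.id G) t) t
  | tr_comp {X Y Z : GSet G} (f : X →[G] Y) (g : Y →[G] Z) (t : FreeTerm k A X) :
      FreeRel k A (.tr (g.comp f) t) (.tr g (.tr f t))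
  | nm_id {X : GSet G} (t : FreeTerm k A X) : FreeRel k A (.nm (MulActionHom.id G) t) t
  | nm_comp {X Y Z : GSet G} (f : X →[G] Y) (g : Y →[G] Z) (t : FreeTerm k A X) :
      FreeRel k A (.nm (g.comp f) t) (.nm g (.nm f t))
  | tr_res {P X Y Z : GSet G} {u : P →[G] X} {v : P →[G] Y} {f : X →[G] Z} {g : Y →[G] Z}
      (H : GSet.IsPullback u v f g) (t : FreeTerm k A X) :
      FreeRel k A (.res g (.tr f t)) (.tr v (.res u t))
  | nm_res {P X Y Z : GSet G} {u : P →[G] X} {v : P →[G] Y} {f : X →[G] Z} {g : Y →[G] Z}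
      (H : GSet.IsPullback u v f g) (t : FreeTerm k A X) :
      FreeRel k A (.res g (.nm f t)) (.nm v (.res u t))
  | nm_tr {C X Y P B : GSet G} {h : C →[G] X} {f : X →[G] Y}
      {e : P →[G] C} {g : P →[G] B} {q : B →[G] Y} (H : GSet.IsExp h f e g q)
      (t : FreeTerm k A C) : FreeRel k A (.nm f (.tr h t)) (.tr q (.nm g (.res e t)))
  | empty {X : GSet G} (h : IsEmpty X) (s t : FreeTerm k A X) : FreeRel k A s t
  | glue_left {X Y Z : GSet G} {i : X →[G] Z} {j : Y →[G] Z} (H : GSet.IsCoprod i j)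
      (s : FreeTerm k A X) (t : FreeTerm k A Y) : FreeRel k A (.res i (.glue H s t)) s
  | glue_right {X Y Z : GSet G} {i : X →[G] Z} {j : Y →[G] Z} (H : GSet.IsCoprod i j)
      (s : FreeTerm k A X) (t : FreeTerm k A Y) : FreeRel k A (.res j (.glue H s t)) t
  | glue_ext {X Y Z : GSet G} {i : X →[G] Z} {j : Y →[G] Z} (H : GSet.IsCoprod i j)
      {s t : FreeTerm k A Z} : FreeRel k A (.res i s) (.res i t) →
      FreeRel k A (.res j s) (.res j t) → FreeRel k A s t
  | add_neg {X : GSet G} (t : FreeTerm k A X) :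
      FreeRel k A (.tr (GSet.fold X) (.glue GSet.isCoprod_sum t (.neg t))) (.const 0)
  | const_res {X Y : GSet G} (f : X →[G] Y) (a : k.obj Y) :
      FreeRel k A (.const (k.res f a)) (.res f (.const a))
  | const_tr {X Y : GSet G} (f : X →[G] Y) (a : k.obj X) :
      FreeRel k A (.const (k.tr f a)) (.tr f (.const a))
  | const_nm {X Y : GSet G} (f : X →[G] Y) (a : k.obj X) :
      FreeRel k A (.const (k.nm f a)) (.nm f (.const a))

namespace FreeTerm

variable {G : Type} [Group G] {k : TambaraFunctor.{u} G} {ι : Type} {A : ι → GSet G}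

/-- Evaluation of formal expressions. -/
noncomputable def eval (S : TambaraAlgebra k) (s : ∀ i, S.obj (A i)) :
    ∀ {X : GSet G}, FreeTerm k A X → S.obj X
  | _, var i => s i
  | _, const a => S.unit.app _ a
  | _, res f t => S.res f (eval S s t)
  | _, tr f t => S.tr f (eval S s t)
  | _, nm f t => S.nm f (eval S s t)
  | _, glue H a b => S.addPart.glue H (eval S s a) (eval S s b)
  | _, neg t => -eval S s t

variable (S : TambaraAlgebra k) (s : ∀ i, S.obj (A i))

/-- Soundness of the relations: each of them is an instance of an axiom that holds in every
`k`-algebra. -/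
theorem eval_eq_of_rel {X : GSet G} {a b : FreeTerm k A X} (h : FreeRel k A a b) :
    a.eval S s = b.eval S s := by
  induction h with
  | refl t => rfl
  | symm _ h => exact h.symm
  | trans _ _ h h' => exact h.trans h'
  | res f _ h => exact congrArg (S.res f) h
  | tr f _ h => exact congrArg (S.tr f) h
  | nm f _ h => exact congrArg (S.nm f) h
  | res_id t => exact S.res_id _
  | res_comp f g t => exact S.res_comp f g _
  | tr_id t => exact S.tr_id _
  | tr_comp f g t => exact S.tr_comp f g _
  | nm_id t => exact S.nm_id _
  | nm_comp f g t => exact S.nm_comp f g _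
  | tr_res H t => exact S.tr_res H _
  | nm_res H t => exact S.nm_res H _
  | nm_tr H t => exact S.nm_tr H _
  | empty h a b => exact S.addPart.subsingleton _ _
  | glue_left H a b => exact S.addPart.res_glue_left H _ _
  | glue_right H a b => exact S.addPart.res_glue_right H _ _
  | glue_ext H _ _ h h' => exact S.addPart.ext H h h'
  -- Formal expressions have no addition of their own; the relation spells a sum out as the transfer
  -- of a glued pair along the folding map, which evaluates to the sum in `S`.
  | @add_neg X t =>
    have h0 : (const (A := A) (0 : k.obj X)).eval S s = 0 := S.unit.map_zero
    rw [h0, ← add_neg_cancel (t.eval S s)]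
    refine congrArg (S.tr (GSet.fold X)) (S.addPart.ext GSet.isCoprod_sum ?_ ?_)
    · exact (S.addPart.res_glue_left _ _ _).trans (S.addPart.res_inl_pair _ _).symm
    · exact (S.addPart.res_glue_right _ _ _).trans (S.addPart.res_inr_pair _ _).symm
  | const_res f a => exact S.unit.map_res f a
  | const_tr f a => exact S.unit.map_tr f a
  | const_nm f a => exact S.unit.map_nm f a

end FreeTerm

section Free

variable {G : Type} [Group G] (k : TambaraFunctor.{u} G) {ι : Type} (A : ι → GSet G)

/-- The semi-Tambara functor of formal expressions up to the axioms of `k`-algebras. -/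
noncomputable def freeSemi : SemiTambaraFunctor.{u} G where
  obj X := Quot (FreeRel k A (X := X))
  res f := Quot.map (.res f) fun _ _ h => .res f h
  tr f := Quot.map (.tr f) fun _ _ h => .tr f h
  nm f := Quot.map (.nm f) fun _ _ h => .nm f h
  res_id := Quot.ind fun t => Quot.sound (.res_id t)
  res_comp f g := Quot.ind fun t => Quot.sound (.res_comp f g t)
  tr_id := Quot.ind fun t => Quot.sound (.tr_id t)
  tr_comp f g := Quot.ind fun t => Quot.sound (.tr_comp f g t)
  nm_id := Quot.ind fun t => Quot.sound (.nm_id t)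
  nm_comp f g := Quot.ind fun t => Quot.sound (.nm_comp f g t)
  tr_res H := Quot.ind fun t => Quot.sound (.tr_res H t)
  nm_res H := Quot.ind fun t => Quot.sound (.nm_res H t)
  nm_tr H := Quot.ind fun t => Quot.sound (.nm_tr H t)
  empty X h := ⟨⟨⟨Quot.mk _ (.const 0)⟩, Quot.ind fun t => Quot.sound (.empty h _ _)⟩⟩
  coprod {X Y Z i j} H := by
    -- Since `FreeRel` is already an equivalence relation, equality of classes gives back the
    -- relation itself, as `glue_ext` demands.
    have key : ∀ {W : GSet G} {s t : FreeTerm k A W},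
        Quot.mk (FreeRel k A) s = Quot.mk (FreeRel k A) t → FreeRel k A s t := fun {W s t} h => by
      have := (Quot.eqvGen_exact h)
      exact (Equivalence.eqvGen_iff ⟨.refl, .symm, .trans⟩).1 this
    refine ⟨?_, fun ⟨a, b⟩ => ?_⟩
    · refine Quot.ind fun s => Quot.ind fun t h => ?_
      simp only [Prod.mk.injEq] at h
      exact Quot.sound (.glue_ext H (key h.1) (key h.2))
    · obtain ⟨s, rfl⟩ := Quot.exists_rep a
      obtain ⟨t, rfl⟩ := Quot.exists_rep b
      exact ⟨Quot.mk _ (.glue H s t),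
        Prod.ext (Quot.sound (.glue_left H s t)) (Quot.sound (.glue_right H s t))⟩

variable {k A} in
/-- The class of a formal expression. -/
def FreeTerm.mk {X : GSet G} (t : FreeTerm k A X) : (freeSemi k A).obj X := Quot.mk _ t

/-- The relation `add_neg` speaks of a glued expression and of the constant `0`. Both must be
matched with the pair and the zero that define the semiring structure of `freeSemi`. -/
theorem freeSemi_add_neg {X : GSet G} (t : FreeTerm k A X) : t.mk + t.neg.mk = 0 := by
  have h1 : (freeSemi k A).addPart.pair (Quot.mk _ t) (Quot.mk _ (.neg t)) =
      Quot.mk _ (.glue GSet.isCoprod_sum t (.neg t)) := by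
    refine (freeSemi k A).addPart.ext GSet.isCoprod_sum ?_ ?_
    · exact ((freeSemi k A).addPart.res_inl_pair _ _).trans (Quot.sound (.glue_left _ _ _)).symm
    · exact ((freeSemi k A).addPart.res_inr_pair _ _).trans (Quot.sound (.glue_right _ _ _)).symm
  refine (congrArg ((freeSemi k A).tr (GSet.fold X)) h1).trans ?_
  -- The zero of `k` is itself a transfer from the empty `G`-set, so `const_tr` applies; in the
  -- empty level all elements agree.
  refine (Quot.sound (.add_neg t)).trans ((Quot.sound (.const_tr _ _)).trans ?_)
  refine congrArg ((freeSemi k A).tr (GSet.fromEmpty X)) (a₁ := Quot.mk _ (.const _)) ?_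
  exact (freeSemi k A).addPart.subsingleton _ _

theorem freeSemi_hasNeg : (freeSemi k A).HasNeg :=
  fun _ => Quot.ind fun t => ⟨Quot.mk _ (.neg t), freeSemi_add_neg k A t⟩

/-- The free `k`-algebra on generators in levels `A i`. -/
noncomputable def freeAlgebra : TambaraAlgebra k where
  __ := freeSemi k A
  hasNeg := freeSemi_hasNeg k A
  unit :=
    { app := fun _ a => Quot.mk _ (.const a)
      map_res := fun f a => Quot.sound (.const_res f a)
      map_tr := fun f a => Quot.sound (.const_tr f a)
      map_nm := fun f a => Quot.sound (.const_nm f a) }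

/-- The generators of the free `k`-algebra. -/
def freeGen (i : ι) : (freeAlgebra k A).obj (A i) := Quot.mk _ (.var i)

/-- Evaluation provides the morphism, and induction on expressions shows that it is forced by the
generators. Such algebras turn a finite list of relations into a parallel pair of maps. -/
theorem freeAlgebra_isFreeOn : (freeAlgebra k A).IsFreeOn A (freeGen k A) := by
  intro S s
  refine ⟨
    { app := fun _ => Quot.lift (FreeTerm.eval S s) fun _ _ h => FreeTerm.eval_eq_of_rel S s h
      map_res := fun f => Quot.ind fun t => rfl
      map_tr := fun f => Quot.ind fun t => rfl
      map_nm := fun f => Quot.ind fun t => rfl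
      comm := fun _ _ => rfl }, fun i => rfl, fun φ hφ => TambaraAlgebra.Hom.ext fun X => ?_⟩
  refine Quot.ind fun t => ?_
  change φ.app X (Quot.mk _ t) = t.eval S s
  induction t with
  | var i => exact hφ i
  | const a => exact φ.comm _ a
  | res f t h => exact (φ.map_res f (Quot.mk _ t)).trans (congrArg (S.res f) h)
  | tr f t h => exact (φ.map_tr f (Quot.mk _ t)).trans (congrArg (S.tr f) h)
  | nm f t h => exact (φ.map_nm f (Quot.mk _ t)).trans (congrArg (S.nm f) h)
  | glue H a b ha hb =>
    refine S.addPart.ext H ?_ ?_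
    · refine Eq.trans ?_ (S.addPart.res_glue_left H _ _).symm
      rw [← ha]
      refine (φ.map_res _ _).symm.trans (congrArg (φ.app _) ?_)
      exact Quot.sound (.glue_left H a b)
    · refine Eq.trans ?_ (S.addPart.res_glue_right H _ _).symm
      rw [← hb]
      refine (φ.map_res _ _).symm.trans (congrArg (φ.app _) ?_)
      exact Quot.sound (.glue_right H a b)
  -- A morphism is not required to respect `neg`; it does so because additive inverses are unique.
  | @neg X t h =>
    have h1 (a b : (freeAlgebra k A).obj X) (h : a + b = 0) : b = -a :=
      eq_neg_of_add_eq_zero_right h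
    exact (congrArg _ (h1 t.mk t.neg.mk (freeSemi_add_neg k A t))).trans
      ((φ.map_neg _).trans (congrArg _ h))

end Free

/-! ### Finite presentation by finite lists of relations. -/

namespace TambaraAlgebra

variable {G : Type} [Group G] {k : TambaraFunctor.{u} G} {E F R R' S T : TambaraAlgebra k}
  {X Y Z : GSet G}

theorem IsFreeOn.hom_ext {ι : Type} {A : ι → GSet G} {x : ∀ i, F.obj (A i)} (h : F.IsFreeOn A x)
    {φ ψ : Hom F S} (H : ∀ i, φ.app (A i) (x i) = ψ.app (A i) (x i)) : φ = ψ :=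
  (h S fun i => ψ.app (A i) (x i)).unique H fun _ => rfl

/-- `π : F → R` is the universal morphism from `F` that identifies `l j` with `r j` for all `j`. -/
def IsQuotientBy (π : Hom F R) {κ : Type} {B : κ → GSet G} (l r : ∀ j, F.obj (B j)) : Prop :=
  (∀ j, π.app (B j) (l j) = π.app (B j) (r j)) ∧
    ∀ (S : TambaraAlgebra k) (ψ : Hom F S), (∀ j, ψ.app (B j) (l j) = ψ.app (B j) (r j)) →
      ∃! θ : Hom R S, ∀ X z, θ.app X (π.app X z) = ψ.app X z

/-- The image of `π` already satisfies the relations, so `π` factors through a map `θ : R → range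
π`. By uniqueness, `θ` followed by the inclusion is the identity of `R`, hence the image is
everything. -/
theorem IsQuotientBy.surjective {π : Hom F R} {κ : Type} {B : κ → GSet G} {l r : ∀ j, F.obj (B j)}
    (h : IsQuotientBy π l r) (X : GSet G) : Function.Surjective (π.app X) := by
  let ψ : Hom F (range π) :=
    { app := fun X z => ⟨π.app X z, z, rfl⟩
      map_res := fun f z => Subtype.ext (π.map_res f z)
      map_tr := fun f z => Subtype.ext (π.map_tr f z)
      map_nm := fun f z => Subtype.ext (π.map_nm f z)
      comm := fun X a => Subtype.ext (π.comm X a) }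
  let incl : Hom (range π) R :=
    { app := fun X z => z.1
      map_res := fun f z => rfl
      map_tr := fun f z => rfl
      map_nm := fun f z => rfl
      comm := fun X a => rfl }
  obtain ⟨θ, hθ, -⟩ := h.2 (range π) ψ fun j => Subtype.ext (h.1 j)
  have key : incl.comp θ = Hom.id R := (h.2 R π h.1).unique
    (fun X z => congrArg Subtype.val (hθ X z)) fun X z => rfl
  intro z
  obtain ⟨w, hw⟩ := (θ.app X z).2
  exact ⟨w, hw.trans (congrArg (fun φ : Hom R R => φ.app X z) key)⟩

/-- Two maps out of a free algebra agree after composition as soon as they do on the generators. So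
only the images of these generators matter, and any finite list of pairs arises in this way. -/
theorem isFinitelyPresented_iff : R.IsFinitelyPresented ↔
    ∃ (ι κ : Type) (_ : Finite ι) (_ : Finite κ) (A : ι → GSet G) (B : κ → GSet G)
      (F : TambaraAlgebra k) (x : ∀ i, F.obj (A i)) (l r : ∀ j, F.obj (B j)) (π : Hom F R),
      F.IsFreeOn A x ∧ IsQuotientBy π l r := by
  constructor
  · rintro ⟨ι, κ, hι, hκ, A, B, E, F, x, y, a, b, π, hE, hF, hπ⟩
    refine ⟨κ, ι, hκ, hι, B, A, F, y, fun i => a.app _ (x i), fun i => b.app _ (x i), π, hF,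
      fun j => hπ.1 _ _, fun S ψ hψ => hπ.2 S ψ fun X z => ?_⟩
    have : ψ.comp a = ψ.comp b := hE.hom_ext hψ
    exact congrArg (fun φ : Hom E S => φ.app X z) this
  · rintro ⟨ι, κ, hι, hκ, A, B, F, x, l, r, π, hF, hπ⟩
    obtain ⟨a, ha, -⟩ := freeAlgebra_isFreeOn k B F l
    obtain ⟨b, hb, -⟩ := freeAlgebra_isFreeOn k B F r
    refine ⟨κ, ι, hκ, hι, B, A, freeAlgebra k B, F, freeGen k B, x, a, b, π,
      freeAlgebra_isFreeOn k B, hF, fun X z => ?_, fun S ψ hψ => hπ.2 S ψ fun j => ?_⟩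
    · have : π.comp a = π.comp b := (freeAlgebra_isFreeOn k B).hom_ext fun j => by
        simp only [Hom.comp_app, ha, hb, hπ.1]
      exact congrArg (fun φ : Hom _ R => φ.app X z) this
    · rw [← ha, ← hb, hψ]

end TambaraAlgebra

/-! ### The one-point `G`-set -/

namespace GSet

variable {G : Type} [Group G] {X Y : GSet G}

/-- The one-point `G`-set. -/
noncomputable def point (G : Type) [Group G] : GSet G := of PUnit

instance : Subsingleton (point G) := (ofEquiv (G := G) PUnit).symm.injective.subsingleton

/-- The unique map to the one-point `G`-set. -/
noncomputable def toPoint (X : GSet G) : X →[G] point G :=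
  lift (fun _ => PUnit.unit) fun _ _ => rfl

theorem hom_point_ext (f g : X →[G] point G) : f = g :=
  MulActionHom.ext fun _ => Subsingleton.elim _ _

end GSet

/-! ### Factors of finitely presented algebras. -/

namespace TambaraAlgebra

variable {G : Type} [Group G] {k : TambaraFunctor.{u} G} {R R' S : TambaraAlgebra k}

/-- A morphism of algebras that sends the idempotents of a splitting to `1` factors. -/
noncomputable def Hom.factor {q : Hom R R'} (σ : TambaraFunctor.IdempotentSplitting q.toHom)
    (φ : Hom R S) (h : ∀ X, φ.app X (σ.idem X) = 1) : Hom R' S where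
  app X z := φ.app X (σ.sec X z)
  map_res f z := by rw [σ.sec_res, φ.map_res]
  map_tr f z := by rw [σ.sec_tr, φ.map_tr]
  map_nm f z := by rw [σ.sec_nm, φ.map_mul, h, one_mul, φ.map_nm]
  comm X a := by rw [← q.comm, σ.sec_app, φ.map_mul, h, one_mul, φ.comm]

/-- A map out of `R'` is a map out of `R` that sends the idempotents to `1`. All idempotents are
restricted from the one-point `G`-set, so a single relation is added. -/
theorem IsFinitelyPresented.of_splitting (hR : R.IsFinitelyPresented) {q : Hom R R'}
    (σ : TambaraFunctor.IdempotentSplitting q.toHom) : R'.IsFinitelyPresented := by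
  rw [isFinitelyPresented_iff] at hR ⊢
  obtain ⟨ι, κ, hι, hκ, A, B, F, x, l, r, π, hF, hπ⟩ := hR
  -- Relations live in the free algebra, so the idempotent at the point is first lifted along `π`;
  -- the index `none` will carry the relation `e = 1`.
  obtain ⟨e, he⟩ := hπ.surjective (GSet.point G) (σ.idem _)
  refine ⟨ι, Option κ, hι, inferInstance, A, fun j => j.elim (GSet.point G) B, F, x,
    fun j => match j with | none => e | some j => l j,
    fun j => match j with | none => 1 | some j => r j, q.comp π, hF, ?_, fun S ψ hψ => ?_⟩
  · rintro (_ | j)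
    · change q.app _ (π.app _ e) = q.app _ (π.app _ 1)
      rw [he, σ.app_idem, π.map_one, q.map_one]
    · exact congrArg (q.app _) (hπ.1 j)
  · obtain ⟨θ, hθ, hu⟩ := hπ.2 S ψ fun j => hψ (some j)
    have h : ∀ X, θ.app X (σ.idem X) = 1 := fun X => by
      have h1 : ψ.app _ e = ψ.app _ 1 := hψ none
      rw [← σ.res_idem (GSet.toPoint X), ← he, θ.map_res, hθ, h1, ψ.map_one, S.res_one]
    refine ⟨Hom.factor (q := q) σ θ h, fun X z => ?_, fun θ' hθ' => Hom.ext fun X z => ?_⟩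
    · change θ.app X (σ.sec X (q.app X (π.app X z))) = _
      rw [σ.sec_app, θ.map_mul, h, one_mul, hθ]
    -- Uniqueness descends from `R` to `R'` because `q` has a section.
    · have : θ'.comp q = θ := hu _ hθ'
      change _ = θ.app X (σ.sec X z)
      rw [← this, Hom.comp_app, σ.app_sec]

end TambaraAlgebra

/-! ### Splitting off invariant subsets of finite `G`-sets. -/

namespace GSet

variable {G : Type} [Group G] {X Y Z A B : GSet G}

/-- Both an invariant subset and its complement are finite `G`-sets. The lemma is used for images of
injective maps and for single orbits. -/
theorem exists_isCoprod_of_invariant (s : Set Z) (hs : ∀ (c : G) (z : Z), z ∈ s ↔ c • z ∈ s) :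
    ∃ (X Y : GSet G) (i : X →[G] Z) (j : Y →[G] Z),
      IsCoprod i j ∧ (∀ x, i x ∈ s) ∧ ∀ y, j y ∉ s := by
  let S : SubMulAction G Z := { carrier := s, smul_mem' := fun c z hz => (hs c z).1 hz }
  let T : SubMulAction G Z :=
    { carrier := sᶜ, smul_mem' := fun c z hz h => hz ((hs c z).2 h) }
  have : Finite S := inferInstanceAs (Finite {z // z ∈ s})
  have : Finite T := inferInstanceAs (Finite {z // z ∈ sᶜ})
  have hi : ∀ x, ∃ z : S, (desc (fun z : S => z.1) (fun _ _ => rfl) : of S →[G] Z) x = z.1 ∧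
      ofEquiv (G := G) S z = x := fun x => by
    obtain ⟨z, rfl⟩ := (ofEquiv (G := G) S).surjective x
    exact ⟨z, by simp, rfl⟩
  have hj : ∀ x, ∃ z : T, (desc (fun z : T => z.1) (fun _ _ => rfl) : of T →[G] Z) x = z.1 ∧
      ofEquiv (G := G) T z = x := fun x => by
    obtain ⟨z, rfl⟩ := (ofEquiv (G := G) T).surjective x
    exact ⟨z, by simp, rfl⟩
  refine ⟨of S, of T, desc (fun z => z.1) (fun _ _ => rfl), desc (fun z => z.1) (fun _ _ => rfl),
    .mk' (fun z => ?_) (fun x x' h => ?_) (fun x x' h => ?_) (fun x y h => ?_),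
    fun x => ?_, fun y => ?_⟩
  · by_cases hz : z ∈ s
    · exact .inl ⟨ofEquiv S ⟨z, hz⟩, by simp⟩
    · exact .inr ⟨ofEquiv T ⟨z, hz⟩, by simp⟩
  · obtain ⟨z, hz, rfl⟩ := hi x
    obtain ⟨z', hz', rfl⟩ := hi x'
    rw [hz, hz'] at h
    rw [Subtype.ext h]
  · obtain ⟨z, hz, rfl⟩ := hj x
    obtain ⟨z', hz', rfl⟩ := hj x'
    rw [hz, hz'] at h
    rw [Subtype.ext h]
  · obtain ⟨z, hz, rfl⟩ := hi x
    obtain ⟨z', hz', rfl⟩ := hj y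
    rw [hz, hz'] at h
    exact z'.2 (h ▸ z.2)
  · obtain ⟨z, hz, rfl⟩ := hi x
    rw [hz]
    exact z.2
  · obtain ⟨z, hz, rfl⟩ := hj y
    rw [hz]
    exact z.2

theorem exists_isCoprod_of_injective (m : A →[G] B) (hm : Function.Injective m) :
    ∃ (C : GSet G) (j : C →[G] B), IsCoprod m j := by
  obtain ⟨X, Y, i, j, H, hi, hj⟩ := exists_isCoprod_of_invariant (Set.range m) fun c z =>
    ⟨fun ⟨a, ha⟩ => ⟨c • a, by rw [map_smul, ha]⟩,
      fun ⟨a, ha⟩ => ⟨c⁻¹ • a, by rw [map_smul, ha, inv_smul_smul]⟩⟩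
  refine ⟨Y, j, .mk' (fun z => ?_) (fun _ _ h => hm h) (fun _ _ h => H.inr_inj h)
    fun x y h => hj y ⟨x, h⟩⟩
  rcases H.cases z with ⟨x, rfl⟩ | ⟨y, rfl⟩
  · exact .inl (hi x)
  · exact .inr ⟨y, rfl⟩

end GSet

/-! ### Norms of compatible families of idempotents. -/

namespace TambaraFunctor

variable {G : Type} [Group G] {T : TambaraFunctor.{u} G} {X Y Z A B : GSet G}

theorem nm_of_isEmpty [IsEmpty X] (f : X →[G] Y) (a : T.obj X) : T.nm f a = 1 := by
  rw [T.addPart.subsingleton a 1, T.nm_one]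

/-- Zero is a transfer from the empty `G`-set. Over a surjective map the empty set has no sections
on any fibre, so the dependent product is empty and the norm is again such a transfer. -/
theorem nm_zero_of_surjective (f : X →[G] Y) (hf : Function.Surjective f) : T.nm f 0 = 0 := by
  have H : GSet.IsExp (GSet.fromEmpty X) f (MulActionHom.id G) (MulActionHom.id G)
      (GSet.fromEmpty Y) :=
    .mk' (.mk' (fun w => isEmptyElim w) (fun _ b => isEmptyElim b) fun w => isEmptyElim w)
      (fun y s _ => by
        obtain ⟨x, hx⟩ := hf y
        exact isEmptyElim (s x hx)) (fun b => isEmptyElim b)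
  rw [← T.tr_zero (GSet.fromEmpty X), T.nm_tr H,
    T.addPart.subsingleton (T.nm _ (T.res _ _)) 0, T.tr_zero]

theorem nm_eq_mul {i : X →[G] Z} {j : Y →[G] Z} (H : GSet.IsCoprod i j) (f : Z →[G] A)
    (z : T.obj Z) : T.nm f z = T.nm (f.comp i) (T.res i z) * T.nm (f.comp j) (T.res j z) :=
  T.mulPart.push_eq_op H f z

/-- The target is the disjoint union of the image of `m` and its complement. By base change the norm
restricts to `e` on the image and to an empty norm, that is `1`, on the complement. -/
theorem idem_mul_nm_of_injective {e : ∀ X : GSet G, T.obj X}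
    (he : ∀ {X Y : GSet G} (f : X →[G] Y), T.res f (e Y) = e X) (hmul : ∀ X, e X * e X = e X)
    (m : A →[G] B) (hm : Function.Injective m) :
    e B * T.nm m (e A) = e B := by
  obtain ⟨C, j, H⟩ := GSet.exists_isCoprod_of_injective m hm
  refine T.addPart.ext H ?_ ?_
  · change T.res m _ = T.res m _
    rw [T.res_mul, T.nm_res (u := MulActionHom.id G) (v := MulActionHom.id G)
      (.mk' (fun _ => rfl) (fun x y h => ⟨x, rfl, hm h⟩) fun w w' h _ => h), T.nm_id, T.res_id,
      he, hmul]
  · change T.res j _ = T.res j _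
    rw [T.res_mul, T.nm_res (u := GSet.fromEmpty A) (v := GSet.fromEmpty C)
      (.mk' (fun w => isEmptyElim w) (fun x y h => (H.ne h).elim) fun w => isEmptyElim w),
      nm_of_isEmpty, mul_one]

/-- One orbit of `A` is split off at a time. Norms turn disjoint unions into products, so the
injective case and induction on the cardinality of `A` finish the proof. -/
theorem idem_mul_nm_of_free {e : ∀ X : GSet G, T.obj X}
    (he : ∀ {X Y : GSet G} (f : X →[G] Y), T.res f (e Y) = e X) (hmul : ∀ X, e X * e X = e X)
    (hB : ∀ (c : G) (b : B), c • b = b → c = 1)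
    (h : A →[G] B) :
    e B * T.nm h (e A) = e B := by
  induction hn : Nat.card A using Nat.strong_induction_on generalizing A with
  | _ n ih =>
  rcases isEmpty_or_nonempty A with hA | ⟨⟨a⟩⟩
  · rw [nm_of_isEmpty, mul_one]
  · obtain ⟨X, Y, i, j, H, hi, hj⟩ := GSet.exists_isCoprod_of_invariant (MulAction.orbit G a)
      fun c z => ⟨MulAction.mem_orbit_of_mem_orbit c, fun hz => by
        simpa using MulAction.mem_orbit_of_mem_orbit c⁻¹ hz⟩
    -- If `g • a` and `g' • a` have the same image, then `g⁻¹ * g'` or its inverse fixes `h a`, so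
    -- `g = g'` by freeness of `B`.
    have hinj : Function.Injective (h.comp i) := fun x x' hx => by
      obtain ⟨g, hg⟩ := hi x
      obtain ⟨g', hg'⟩ := hi x'
      refine H.inl_inj ?_
      simp only [MulActionHom.comp_apply] at hx
      change g • a = i x at hg
      change g' • a = i x' at hg'
      rw [← hg, ← hg', map_smul, map_smul, ← inv_smul_eq_iff, smul_smul] at hx
      rw [← hg, ← hg', inv_mul_eq_one.1 (hB _ _ hx)]
    have hcard : Nat.card Y < n := by
      have := Fintype.ofFinite Y
      have := Fintype.ofFinite A
      rw [← hn, Nat.card_eq_fintype_card, Nat.card_eq_fintype_card]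
      refine Fintype.card_lt_of_injective_of_notMem j (fun _ _ h => H.inr_inj h) (b := a) ?_
      rintro ⟨y, hy⟩
      exact hj y (hy.symm ▸ MulAction.mem_orbit_self a)
    rw [nm_eq_mul H, he, he, ← mul_assoc, idem_mul_nm_of_injective he hmul _ hinj,
      ih _ hcard _ rfl]

/-- Products with `G` reduce an arbitrary map to a map between free `G`-sets. Thus one equation at
the point yields infinitely many, which makes a finite list of relations sufficient for products of
algebras. -/
theorem idem_mul_nm [Finite G] {e : ∀ X : GSet G, T.obj X}
    (he : ∀ {X Y : GSet G} (f : X →[G] Y), T.res f (e Y) = e X) (hmul : ∀ X, e X * e X = e X)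
    (hnm : T.nm (GSet.toPoint (GSet.of G)) (e (GSet.of G)) = e (GSet.point G))
    (g : X →[G] Y) :
    e Y * T.nm g (e X) = e Y := by
  -- `P` is `G × X` and `Q` is `G × Y`; `Q` is free because it maps to `G`. Base change of `hnm`
  -- shows that the norms along `P → X` and `Q → Y` preserve `e`.
  obtain ⟨P, u, v, H⟩ := GSet.exists_isPullback (GSet.toPoint (GSet.of G)) (GSet.toPoint X)
  obtain ⟨Q, a, b, K⟩ := GSet.exists_isPullback (GSet.toPoint (GSet.of G)) (GSet.toPoint Y)
  have hX : T.nm v (e P) = e X := by rw [← he u, ← T.nm_res H, hnm, he]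
  have hY : T.nm b (e Q) = e Y := by rw [← he a, ← T.nm_res K, hnm, he]
  obtain ⟨h, -, hh⟩ := K.exists_lift u (g.comp v) fun _ => Subsingleton.elim _ _
  have hfree : ∀ (c : G) (w : Q), c • w = w → c = 1 := fun c w hw => by
    have h1 : c • a w = a w := by rw [← map_smul, hw]
    have h2 := congrArg (GSet.ofEquiv (G := G) G).symm h1
    rw [GSet.ofEquiv_symm_smul] at h2
    exact mul_eq_right.1 h2
  have hcomp : T.nm b (T.nm h (e P)) = T.nm g (e X) := by
    rw [← hX]
    exact (T.mulPart.push_comp' hh _).trans (T.nm_comp v g _)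
  -- Now `e_Y * N_g(e_X)` is the norm along `b` of `e_Q * N_h(e_P)`, and this factor is `e_Q` by the
  -- free case.
  rw [← hcomp, ← hY, ← T.nm_mul, idem_mul_nm_of_free he hmul hfree]

end TambaraFunctor

/-! ### Norm idempotents, their corner algebras, and gluing of morphisms. -/

namespace TambaraAlgebra

variable {G : Type} [Group G] {k : TambaraFunctor.{u} G}

/-- A compatible family of idempotents of `S` below their own norms. -/
structure NormIdempotent (S : TambaraAlgebra k) where
  elt : ∀ X : GSet G, S.obj X
  res_elt : ∀ {X Y : GSet G} (f : X →[G] Y), S.res f (elt Y) = elt X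
  mul_self : ∀ X : GSet G, elt X * elt X = elt X
  mul_nm : ∀ {X Y : GSet G} (f : X →[G] Y), elt Y * S.nm f (elt X) = elt Y

namespace NormIdempotent

variable {S : TambaraAlgebra k} (ε : NormIdempotent S) {X Y : GSet G}

/-- This makes the corrected norm `z ↦ ε * N_f z` on multiples of `ε` functorial and makes
multiplication by `ε` compatible with norms. -/
theorem mul_nm_mul (f : X →[G] Y) (a : S.obj X) :
    ε.elt Y * S.nm f (ε.elt X * a) = ε.elt Y * S.nm f a := by
  rw [S.nm_mul, ← mul_assoc, ε.mul_nm]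

theorem tr_mul (f : X →[G] Y) (a : S.obj X) :
    S.tr f (ε.elt X * a) = ε.elt Y * S.tr f a := by
  rw [← S.tr_res_mul, ε.res_elt]

theorem res_mul (f : X →[G] Y) (a : S.obj Y) :
    S.res f (ε.elt Y * a) = ε.elt X * S.res f a := by
  rw [S.res_mul, ε.res_elt]

/-- The multiples of a norm idempotent, as a semi-Tambara functor. -/
noncomputable def cornerSemi : SemiTambaraFunctor.{u} G where
  obj X := {z : S.obj X // ε.elt X * z = z}
  res f z := ⟨S.res f z.1, by rw [← ε.res_mul, z.2]⟩
  tr f z := ⟨S.tr f z.1, by rw [← ε.tr_mul, z.2]⟩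
  nm {X Y} f z := ⟨ε.elt Y * S.nm f z.1, by rw [← mul_assoc, ε.mul_self]⟩
  res_id a := Subtype.ext (S.res_id _)
  res_comp f g a := Subtype.ext (S.res_comp f g _)
  tr_id a := Subtype.ext (S.tr_id _)
  tr_comp f g a := Subtype.ext (S.tr_comp f g _)
  nm_id a := Subtype.ext ((congrArg _ (S.nm_id _)).trans a.2)
  nm_comp f g a := Subtype.ext ((congrArg _ (S.nm_comp f g _)).trans (ε.mul_nm_mul g _).symm)
  tr_res H a := Subtype.ext (S.tr_res H _)
  nm_res H a := Subtype.ext ((ε.res_mul _ _).trans (congrArg _ (S.nm_res H _)))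
  nm_tr H a := Subtype.ext ((congrArg _ (S.nm_tr H _)).trans (ε.tr_mul _ _).symm)
  empty X h := ⟨⟨⟨⟨0, mul_zero _⟩⟩, fun _ => Subtype.ext (S.addPart.subsingleton _ _)⟩⟩
  coprod {X Y Z i j} H := by
    refine ⟨fun a b h => ?_, fun ⟨a, b⟩ => ?_⟩
    · simp only [Prod.mk.injEq, Subtype.mk.injEq] at h
      exact Subtype.ext (S.addPart.ext H h.1 h.2)
    · have h1 : S.res i (S.addPart.glue H a.1 b.1) = a.1 := S.addPart.res_glue_left H a.1 b.1
      have h2 : S.res j (S.addPart.glue H a.1 b.1) = b.1 := S.addPart.res_glue_right H a.1 b.1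
      refine ⟨⟨S.addPart.glue H a.1 b.1, S.addPart.ext H ?_ ?_⟩,
        Prod.ext (Subtype.ext h1) (Subtype.ext h2)⟩
      · exact (ε.res_mul i _).trans (by rw [h1, a.2]; exact h1.symm)
      · exact (ε.res_mul j _).trans (by rw [h2, b.2]; exact h2.symm)

/-- The `k`-algebra of multiples of a norm idempotent. -/
noncomputable def corner : TambaraAlgebra k where
  __ := ε.cornerSemi
  hasNeg := fun X a => by
    refine ⟨⟨-a.1, by rw [mul_neg, a.2]⟩, Subtype.ext ?_⟩
    refine (SemiMackey.map_op (M := ε.cornerSemi.addPart) (N := S.addPart) (fun _ a => a.1)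
      (fun _ _ => rfl) (fun _ _ => rfl) _ _).trans ?_
    refine (add_neg_cancel a.1).trans ?_
    exact congrArg (S.tr (GSet.fromEmpty X)) (S.addPart.subsingleton _ _)
  unit :=
    { app := fun X a => ⟨ε.elt X * S.unit.app X a, by rw [← mul_assoc, ε.mul_self]⟩
      map_res := fun f a => Subtype.ext
        ((congrArg _ (S.unit.map_res f a)).trans (ε.res_mul f _).symm)
      map_tr := fun f a => Subtype.ext
        ((congrArg _ (S.unit.map_tr f a)).trans (ε.tr_mul f _).symm)
      map_nm := fun f a => Subtype.ext
        ((congrArg _ (S.unit.map_nm f a)).trans (ε.mul_nm_mul f _).symm) }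

/-- Multiplication by a norm idempotent. -/
noncomputable def proj : Hom S ε.corner where
  app X a := ⟨ε.elt X * a, by rw [← mul_assoc, ε.mul_self]⟩
  map_res f a := Subtype.ext (ε.res_mul f a).symm
  map_tr f a := Subtype.ext (ε.tr_mul f a).symm
  map_nm f a := Subtype.ext (ε.mul_nm_mul f a).symm
  comm X a := rfl

/-- The projection to the multiples of a norm idempotent splits. -/
noncomputable def splitting : TambaraFunctor.IdempotentSplitting ε.proj.toHom where
  idem := ε.elt
  sec _ a := a.1
  res_idem f := ε.res_elt f
  app_sec z := Subtype.ext z.2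
  sec_app _ := rfl

/-- Equality is tested in the two corners. This allows compatibility with norms to be checked in
each corner separately, without expanding the norm of a sum. -/
theorem ext_of_add_eq_one {ε₁ ε₂ : NormIdempotent S} (hadd : ε₁.elt X + ε₂.elt X = 1)
    {a b : S.obj X} (h₁ : ε₁.elt X * a = ε₁.elt X * b) (h₂ : ε₂.elt X * a = ε₂.elt X * b) :
    a = b := by
  rw [← one_mul a, ← one_mul b, ← hadd, add_mul, add_mul, h₁, h₂]

theorem mul_add_of_mul_eq_zero {ε₁ ε₂ : NormIdempotent S} (hmul : ε₁.elt X * ε₂.elt X = 0)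
    (a : ε₁.corner.obj X) (b : ε₂.corner.obj X) : ε₁.elt X * (a.1 + b.1) = a.1 := by
  have h : ε₁.elt X * b.1 = 0 := by
    have hb : ε₂.elt X * b.1 = b.1 := b.2
    rw [← hb, ← mul_assoc, hmul, zero_mul]
  rw [mul_add, h, add_zero]
  exact a.2

variable {R R₁ R₂ : TambaraAlgebra k}

/-- The morphism with given components in the multiples of two complementary norm idempotents. -/
noncomputable def glueHom {ε₁ ε₂ : NormIdempotent S} (hadd : ∀ X, ε₁.elt X + ε₂.elt X = 1)
    (hmul : ∀ X, ε₁.elt X * ε₂.elt X = 0) (φ₁ : Hom R ε₁.corner) (φ₂ : Hom R ε₂.corner) :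
    Hom R S where
  app X z := ε₁.splitting.sec X (φ₁.app X z) + ε₂.splitting.sec X (φ₂.app X z)
  map_res f z := by
    rw [φ₁.map_res, φ₂.map_res, ε₁.splitting.sec_res, ε₂.splitting.sec_res, S.res_add]
  map_tr f z := by
    rw [φ₁.map_tr, φ₂.map_tr, ε₁.splitting.sec_tr, ε₂.splitting.sec_tr, S.tr_add]
  map_nm {X Y} f z := by
    have hmul' : ∀ X, ε₂.elt X * ε₁.elt X = 0 := fun X => (mul_comm _ _).trans (hmul X)
    refine ext_of_add_eq_one (hadd Y) ?_ ?_
    -- Under `ε₁` the argument of a norm may be multiplied by `ε₁`, which removes its second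
    -- component.
    · refine (mul_add_of_mul_eq_zero (hmul Y) _ _).trans ?_
      rw [← ε₁.mul_nm_mul]
      have h : ε₁.elt X * (ε₁.splitting.sec X (φ₁.app X z) + ε₂.splitting.sec X (φ₂.app X z)) =
        ε₁.splitting.sec X (φ₁.app X z) := mul_add_of_mul_eq_zero (hmul X) _ _
      rw [h, φ₁.map_nm]
      exact ε₁.splitting.sec_nm f _
    · rw [add_comm]
      refine (mul_add_of_mul_eq_zero (hmul' Y) _ _).trans ?_
      rw [← ε₂.mul_nm_mul]
      have h : ε₂.elt X * (ε₂.splitting.sec X (φ₂.app X z) + ε₁.splitting.sec X (φ₁.app X z)) =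
        ε₂.splitting.sec X (φ₂.app X z) := mul_add_of_mul_eq_zero (hmul' X) _ _
      rw [add_comm (ε₁.splitting.sec X (φ₁.app X z)), h, φ₂.map_nm]
      exact ε₂.splitting.sec_nm f _
  comm X a := by
    rw [φ₁.comm, φ₂.comm]
    change ε₁.elt X * S.unit.app X a + ε₂.elt X * S.unit.app X a = _
    rw [← add_mul, hadd, one_mul]

/-- An idempotent that is fixed by the norm from the trivial subgroup. -/
noncomputable def ofPoint [Finite G] (e : S.obj (GSet.point G)) (hmul : e * e = e)
    (hnm : S.nm (GSet.toPoint (GSet.of G)) (S.res (GSet.toPoint (GSet.of G)) e) = e) :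
    NormIdempotent S :=
  have hres : ∀ {X Y : GSet G} (f : X →[G] Y),
      -- All maps to the one-point `G`-set agree, so restricting one element yields a compatible
      -- family.
      S.res f (S.res (GSet.toPoint Y) e) = S.res (GSet.toPoint X) e := fun f => by
    rw [← S.res_comp, GSet.hom_point_ext ((GSet.toPoint _).comp f)]
  have hself : ∀ X, S.res (GSet.toPoint X) e * S.res (GSet.toPoint X) e =
      S.res (GSet.toPoint X) e := fun X => by rw [← S.res_mul, hmul]
  { elt := fun X => S.res (GSet.toPoint X) e
    res_elt := hres
    mul_self := hself
    mul_nm := fun f => TambaraFunctor.idem_mul_nm (T := S.toTambaraFunctor)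
      (e := fun X => S.res (GSet.toPoint X) e) hres hself (by
        rw [hnm, GSet.hom_point_ext (GSet.toPoint _) (MulActionHom.id G), S.res_id]) f }

end NormIdempotent

end TambaraAlgebra

/-! ### Finite presentation of products. -/

namespace TambaraAlgebra

variable {G : Type} [Group G] {k : TambaraFunctor.{u} G} {F R R₁ R₂ S : TambaraAlgebra k}
  {X Y : GSet G}

/-- Relations in varying levels are collected in one finite set of triples, so that unions of
several families need no common index type. -/
theorem IsFinitelyPresented.of_finite_set {ι : Type} [Finite ι] {A : ι → GSet G}
    {x : ∀ i, F.obj (A i)} (hF : F.IsFreeOn A x) (π : Hom F R)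
    {P : Set (Σ X : GSet G, F.obj X × F.obj X)} (hP : P.Finite)
    (hπ : ∀ p ∈ P, π.app p.1 p.2.1 = π.app p.1 p.2.2)
    (hu : ∀ (S : TambaraAlgebra k) (ψ : Hom F S),
      (∀ p ∈ P, ψ.app p.1 p.2.1 = ψ.app p.1 p.2.2) →
        ∃! θ : Hom R S, ∀ X z, θ.app X (π.app X z) = ψ.app X z) : R.IsFinitelyPresented := by
  have := hP.to_subtype
  let E := Finite.equivFin P
  refine isFinitelyPresented_iff.2 ⟨ι, Fin (Nat.card P), inferInstance, inferInstance, A,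
    fun j => (E.symm j).1.1, F, x, fun j => (E.symm j).1.2.1, fun j => (E.symm j).1.2.2, π, hF,
    fun j => hπ _ (E.symm j).2, fun S ψ hψ => hu S ψ fun p hp => ?_⟩
  have h : ∀ p : P, ψ.app p.1.1 p.1.2.1 = ψ.app p.1.1 p.1.2.2 := fun p => by
    obtain ⟨j, rfl⟩ := E.symm.surjective p
    exact hψ j
  exact h ⟨p, hp⟩

theorem exists_hom_free {ι : Type} (A : ι → GSet G) (s : ∀ i, S.obj (A i)) :
    ∃ φ : Hom (freeAlgebra k A) S, ∀ i, φ.app (A i) (freeGen k A i) = s i :=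
  (freeAlgebra_isFreeOn k A S s).exists

section complement

variable {q₁ : Hom R R₁} {q₂ : Hom R R₂} (σ₁ : TambaraFunctor.IdempotentSplitting q₁.toHom)
  (σ₂ : TambaraFunctor.IdempotentSplitting q₂.toHom)

theorem app_sec_eq_zero (hmul : ∀ X, σ₁.idem X * σ₂.idem X = 0) (z : R₂.obj X) :
    q₁.app X (σ₂.sec X z) = 0 := by
  have h : σ₁.sec X (q₁.app X (σ₂.sec X z)) = 0 := by
    rw [σ₁.sec_app, ← σ₂.idem_mul_sec, ← mul_assoc, hmul, zero_mul]
  rw [← σ₁.app_sec (q₁.app X (σ₂.sec X z)), h, q₁.map_zero]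

/-- In the first component the norm of `1` is `1`; in the second the norm of `0` is `0`, by
surjectivity of `f`. For `G → pt` this is the relation imposed in the presentation below. -/
theorem nm_idem_of_surjective (hadd : ∀ X, σ₁.idem X + σ₂.idem X = 1)
    (hmul : ∀ X, σ₁.idem X * σ₂.idem X = 0) (f : X →[G] Y) (hf : Function.Surjective f) :
    R.nm f (σ₁.idem X) = σ₁.idem Y := by
  have h1 : σ₁.idem Y * R.nm f (σ₁.idem X) = σ₁.idem Y := by
    have h := σ₁.sec_nm f 1
    rw [R₁.nm_one, σ₁.sec_one, σ₁.sec_one] at h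
    exact h.symm
  have h2 : σ₂.idem Y * R.nm f (σ₁.idem X) = 0 := by
    rw [← σ₂.sec_app, q₂.map_nm, ← σ₁.sec_one,
      app_sec_eq_zero σ₂ σ₁ (fun X => (mul_comm _ _).trans (hmul X)),
      TambaraFunctor.nm_zero_of_surjective f hf, σ₂.sec_zero]
  rw [← one_mul (R.nm f _), ← hadd, add_mul, h1, h2, add_zero]

/-- Generators are those of both presentations and the two idempotents at the point. The relations
make the idempotents complementary and fixed by the norm from `G`, place each old generator in its
corner, and impose the old relations there. -/
theorem IsFinitelyPresented.of_splittings [Finite G] (h₁ : R₁.IsFinitelyPresented)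
    (h₂ : R₂.IsFinitelyPresented) (hadd : ∀ X, σ₁.idem X + σ₂.idem X = 1)
    (hmul : ∀ X, σ₁.idem X * σ₂.idem X = 0) : R.IsFinitelyPresented := by
  have hmul' : ∀ X, σ₂.idem X * σ₁.idem X = 0 := fun X => (mul_comm _ _).trans (hmul X)
  rw [isFinitelyPresented_iff] at h₁ h₂
  obtain ⟨ι₁, κ₁, hι₁, hκ₁, A₁, B₁, F₁, x₁, l₁, r₁, π₁, hF₁, hπ₁⟩ := h₁
  obtain ⟨ι₂, κ₂, hι₂, hκ₂, A₂, B₂, F₂, x₂, l₂, r₂, π₂, hF₂, hπ₂⟩ := h₂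
  let A : ι₁ ⊕ ι₂ ⊕ Bool → GSet G := Sum.elim A₁ (Sum.elim A₂ fun _ => GSet.point G)
  let F := freeAlgebra k A
  have hF : F.IsFreeOn A (freeGen k A) := freeAlgebra_isFreeOn k A
  let y₁ (i : ι₁) : F.obj (A₁ i) := freeGen k A (.inl i)
  let y₂ (i : ι₂) : F.obj (A₂ i) := freeGen k A (.inr (.inl i))
  let e₁ : F.obj (GSet.point G) := freeGen k A (.inr (.inr true))
  let e₂ : F.obj (GSet.point G) := freeGen k A (.inr (.inr false))
  -- `j₁` rewrites polynomials of the first presentation in `F`. It preserves `1`, so its values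
  -- need not lie in the first corner, and they are multiplied by `E₁` below.
  obtain ⟨j₁, hj₁, -⟩ := hF₁ F y₁
  obtain ⟨j₂, hj₂, -⟩ := hF₂ F y₂
  obtain ⟨ρ, hρ⟩ := exists_hom_free (k := k) (S := R) A fun i => match i with
    | .inl i => σ₁.sec _ (π₁.app _ (x₁ i))
    | .inr (.inl i) => σ₂.sec _ (π₂.app _ (x₂ i))
    | .inr (.inr true) => σ₁.idem _
    | .inr (.inr false) => σ₂.idem _
  have hy₁ (i : ι₁) : ρ.app _ (y₁ i) = σ₁.sec _ (π₁.app _ (x₁ i)) := hρ (.inl i)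
  have hy₂ (i : ι₂) : ρ.app _ (y₂ i) = σ₂.sec _ (π₂.app _ (x₂ i)) := hρ (.inr (.inl i))
  have he₁ : ρ.app _ e₁ = σ₁.idem _ := hρ (.inr (.inr true))
  have he₂ : ρ.app _ e₂ = σ₂.idem _ := hρ (.inr (.inr false))
  let E₁ (X : GSet G) : F.obj X := F.res (GSet.toPoint X) e₁
  let E₂ (X : GSet G) : F.obj X := F.res (GSet.toPoint X) e₂
  have hE₁ (X : GSet G) : ρ.app X (E₁ X) = σ₁.idem X := by rw [ρ.map_res, he₁, σ₁.res_idem]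
  have hE₂ (X : GSet G) : ρ.app X (E₂ X) = σ₂.idem X := by rw [ρ.map_res, he₂, σ₂.res_idem]
  have hq₁ : q₁.comp (ρ.comp j₁) = π₁ := hF₁.hom_ext fun i => by
    rw [Hom.comp_app, Hom.comp_app, hj₁, hy₁, σ₁.app_sec]
  have hq₂ : q₂.comp (ρ.comp j₂) = π₂ := hF₂.hom_ext fun i => by
    rw [Hom.comp_app, Hom.comp_app, hj₂, hy₂, σ₂.app_sec]
  have hm₁ (X : GSet G) (z : F₁.obj X) :
      ρ.app X (E₁ X * j₁.app X z) = σ₁.sec X (π₁.app X z) := by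
    rw [ρ.map_mul, hE₁, ← σ₁.sec_app, ← hq₁]; rfl
  have hm₂ (X : GSet G) (z : F₂.obj X) :
      ρ.app X (E₂ X * j₂.app X z) = σ₂.sec X (π₂.app X z) := by
    rw [ρ.map_mul, hE₂, ← σ₂.sec_app, ← hq₂]; rfl
  -- Surjectivity of `ρ` gives uniqueness of the factorization at the end.
  have hsurj (X : GSet G) (z : R.obj X) : ∃ w, ρ.app X w = z := by
    obtain ⟨w₁, hw₁⟩ := hπ₁.surjective X (q₁.app X z)
    obtain ⟨w₂, hw₂⟩ := hπ₂.surjective X (q₂.app X z)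
    refine ⟨E₁ X * j₁.app X w₁ + E₂ X * j₂.app X w₂, ?_⟩
    rw [ρ.map_add, hm₁, hm₂, hw₁, hw₂, σ₁.sec_app, σ₂.sec_app, ← add_mul, hadd, one_mul]
  let f := GSet.toPoint (GSet.of (G := G) G)
  have hf : Function.Surjective f := fun y => ⟨GSet.ofEquiv (G := G) G 1, Subsingleton.elim _ _⟩
  refine IsFinitelyPresented.of_finite_set hF ρ
    (P := Set.range (fun i => ⟨A₁ i, E₁ _ * y₁ i, y₁ i⟩) ∪
      Set.range (fun i => ⟨A₂ i, E₂ _ * y₂ i, y₂ i⟩) ∪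
      Set.range (fun j => ⟨B₁ j, E₁ _ * j₁.app _ (l₁ j), E₁ _ * j₁.app _ (r₁ j)⟩) ∪
      Set.range (fun j => ⟨B₂ j, E₂ _ * j₂.app _ (l₂ j), E₂ _ * j₂.app _ (r₂ j)⟩) ∪
      {⟨_, e₁ + e₂, 1⟩, ⟨_, e₁ * e₂, 0⟩, ⟨_, F.nm f (F.res f e₁), e₁⟩,
        ⟨_, F.nm f (F.res f e₂), e₂⟩})
    ((((Set.finite_range _).union (Set.finite_range _)).union (Set.finite_range _)).union
      (Set.finite_range _) |>.union (Set.toFinite _)) ?_ ?_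
  · simp only [Set.mem_union, or_imp, forall_and, Set.forall_mem_range, Set.mem_insert_iff,
      Set.mem_singleton_iff, forall_eq]
    refine ⟨⟨⟨⟨fun i => ?_, fun i => ?_⟩, fun j => ?_⟩, fun j => ?_⟩, ?_, ?_, ?_, ?_⟩
    · rw [ρ.map_mul, hE₁, hy₁, σ₁.idem_mul_sec]
    · rw [ρ.map_mul, hE₂, hy₂, σ₂.idem_mul_sec]
    · rw [hm₁, hm₁, hπ₁.1]
    · rw [hm₂, hm₂, hπ₂.1]
    · rw [ρ.map_add, he₁, he₂, hadd, ρ.map_one]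
    · rw [ρ.map_mul, he₁, he₂, hmul, ρ.map_zero]
    · rw [ρ.map_nm, ρ.map_res, he₁, σ₁.res_idem, nm_idem_of_surjective σ₁ σ₂ hadd hmul f hf]
    · rw [ρ.map_nm, ρ.map_res, he₂, σ₂.res_idem,
        nm_idem_of_surjective σ₂ σ₁ (fun X => (add_comm _ _).trans (hadd X)) hmul' f hf]
  · intro S ψ
    simp only [Set.mem_union, or_imp, forall_and, Set.forall_mem_range, Set.mem_insert_iff,
      Set.mem_singleton_iff, forall_eq]
    rintro ⟨⟨⟨⟨hψ₁, hψ₂⟩, hψ₃⟩, hψ₄⟩, hψ₅, hψ₆, hψ₇, hψ₈⟩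
    rw [ψ.map_add, ψ.map_one] at hψ₅
    rw [ψ.map_mul, ψ.map_zero] at hψ₆
    rw [ψ.map_nm, ψ.map_res] at hψ₇ hψ₈
    -- Idempotency is not among the relations: it follows from `e₁ + e₂ = 1` and `e₁ * e₂ = 0`.
    let ε₁ : NormIdempotent S := .ofPoint (ψ.app _ e₁)
      (by rw [← add_zero (_ * _), ← hψ₆, ← mul_add, hψ₅, mul_one]) hψ₇
    let ε₂ : NormIdempotent S := .ofPoint (ψ.app _ e₂)
      (by rw [← zero_add (_ * _), ← hψ₆, ← add_mul, hψ₅, one_mul]) hψ₈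
    have hε₁ (X : GSet G) : ψ.app X (E₁ X) = ε₁.elt X := ψ.map_res _ _
    have hε₂ (X : GSet G) : ψ.app X (E₂ X) = ε₂.elt X := ψ.map_res _ _
    have εadd (X : GSet G) : ε₁.elt X + ε₂.elt X = 1 := by
      rw [← hε₁, ← hε₂, ψ.map_res, ψ.map_res, ← S.res_add, hψ₅, S.res_one]
    have εmul (X : GSet G) : ε₁.elt X * ε₂.elt X = 0 := by
      rw [← hε₁, ← hε₂, ψ.map_res, ψ.map_res, ← S.res_mul, hψ₆, S.res_zero]
    -- The old relations hold in `S` only after multiplication by `ε₁`, hence the universal property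
    -- of `R₁` is applied to the corner.
    obtain ⟨θ₁, hθ₁, -⟩ := hπ₁.2 ε₁.corner (ε₁.proj.comp (ψ.comp j₁)) fun j => by
      refine Subtype.ext ?_
      change ε₁.elt _ * ψ.app _ (j₁.app _ _) = ε₁.elt _ * ψ.app _ (j₁.app _ _)
      rw [← hε₁, ← ψ.map_mul, ← ψ.map_mul, hψ₃]
    obtain ⟨θ₂, hθ₂, -⟩ := hπ₂.2 ε₂.corner (ε₂.proj.comp (ψ.comp j₂)) fun j => by
      refine Subtype.ext ?_
      change ε₂.elt _ * ψ.app _ (j₂.app _ _) = ε₂.elt _ * ψ.app _ (j₂.app _ _)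
      rw [← hε₂, ← ψ.map_mul, ← ψ.map_mul, hψ₄]
    let θ : Hom R S := NormIdempotent.glueHom εadd εmul (θ₁.comp q₁) (θ₂.comp q₂)
    have hθ (X : GSet G) (z : R.obj X) : θ.app X z = ε₁.splitting.sec X (θ₁.app X (q₁.app X z)) +
      ε₂.splitting.sec X (θ₂.app X (q₂.app X z)) := rfl
    have hθs₁ (X : GSet G) (z : R₁.obj X) :
        θ.app X (σ₁.sec X z) = ε₁.splitting.sec X (θ₁.app X z) := by
      rw [hθ, σ₁.app_sec, app_sec_eq_zero σ₂ σ₁ hmul', θ₂.map_zero, ε₂.splitting.sec_zero, add_zero]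
    have hθs₂ (X : GSet G) (z : R₂.obj X) :
        θ.app X (σ₂.sec X z) = ε₂.splitting.sec X (θ₂.app X z) := by
      rw [hθ, σ₂.app_sec, app_sec_eq_zero σ₁ σ₂ hmul, θ₁.map_zero, ε₁.splitting.sec_zero, zero_add]
    -- Both maps start from a free algebra, so only the generators matter; `false` is the first case
    -- of `Bool`, so `e₂` is treated before `e₁`.
    have key : θ.comp ρ = ψ := hF.hom_ext fun i => by
      rcases i with i | i | _ | _
      · change θ.app _ (ρ.app _ (y₁ i)) = ψ.app _ (y₁ i)
        rw [hy₁, hθs₁, hθ₁, ← hψ₁, ψ.map_mul, hε₁, ← hj₁]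
        rfl
      · change θ.app _ (ρ.app _ (y₂ i)) = ψ.app _ (y₂ i)
        rw [hy₂, hθs₂, hθ₂, ← hψ₂, ψ.map_mul, hε₂, ← hj₂]
        rfl
      · change θ.app _ (ρ.app _ e₂) = ψ.app _ e₂
        rw [he₂, ← σ₂.sec_one, hθs₂, θ₂.map_one, ε₂.splitting.sec_one]
        exact S.addPart.res_id' (fun _ => Subsingleton.elim _ _) _
      · change θ.app _ (ρ.app _ e₁) = ψ.app _ e₁
        rw [he₁, ← σ₁.sec_one, hθs₁, θ₁.map_one, ε₁.splitting.sec_one]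
        exact S.addPart.res_id' (fun _ => Subsingleton.elim _ _) _
    refine ⟨θ, fun X z => ?_, fun θ' hθ' => Hom.ext fun X z => ?_⟩
    · rw [← key, Hom.comp_app]
    · obtain ⟨w, rfl⟩ := hsurj X z
      rw [hθ', ← key, Hom.comp_app]

end complement

theorem isFinitelyPresented_prod_iff [Finite G] (R₁ R₂ : TambaraAlgebra k) :
    (R₁.prod R₂).IsFinitelyPresented ↔ R₁.IsFinitelyPresented ∧ R₂.IsFinitelyPresented :=
  ⟨fun h => ⟨h.of_splitting (fstSplitting R₁ R₂), h.of_splitting (sndSplitting R₁ R₂)⟩,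
    fun ⟨h₁, h₂⟩ => .of_splittings (fstSplitting R₁ R₂) (sndSplitting R₁ R₂) h₁ h₂
      (prod_idem_add_idem R₁ R₂) (prod_idem_mul_idem R₁ R₂)⟩

end TambaraAlgebra

/-! ### Products and étaleness. -/

theorem mainTheorem9 {G : Type} [Group G] [Finite G] (k : TambaraFunctor.{u} G)
    (R₁ R₂ : TambaraAlgebra k) :
    ((R₁.prod R₂).IsFlat ↔ R₁.IsFlat ∧ R₂.IsFlat) ∧
    ((R₁.prod R₂).DifferentialsVanish ↔ R₁.DifferentialsVanish ∧ R₂.DifferentialsVanish) ∧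
    ((R₁.prod R₂).IsFinitelyPresented ↔ R₁.IsFinitelyPresented ∧ R₂.IsFinitelyPresented) ∧
    ((R₁.prod R₂).IsEtale ↔ R₁.IsEtale ∧ R₂.IsEtale) := by
  have h1 := TambaraAlgebra.isFlat_prod_iff R₁ R₂
  have h2 := TambaraAlgebra.differentialsVanish_prod_iff R₁ R₂
  have h3 := TambaraAlgebra.isFinitelyPresented_prod_iff R₁ R₂
  refine ⟨h1, h2, h3, ?_⟩
  unfold TambaraAlgebra.IsEtale TambaraAlgebra.IsFormallyEtale
  tauto
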